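/- **Conventions.** A closed plane curve is written as a $1$-periodic smooth regular map $\gamma:\mathbb R\to\mathbb R^2$, running counterclockwise; $\kappa$ is its curvature, $\nabla$ the derivative with respect to its arc length. A simple closed convex curve is *$\alpha$-noncollapsed* if $\kappa>0$ and at each point its inscribed radius (the radius of the largest disk touching the curve there from inside) is at least $\alpha/\kappa$. For maps $f(s,t)$ on $\Gamma\times I$, where $\Gamma=\{\gamma(t)\}$, the $C^{20}$-norm is the supremum of $\sum_{k+l\le 20}|\partial_s^k\nabla^l f|$. The mean curvature $H$ is the sum of the principal curvatures, taken positive on round cylinders; integrals over surfaces are with respect to area. **Necks.** Let $\hat\delta,\varepsilon,L>0$. A surface $N\subset\mathbb R^3$ is a neck of size $1$ with cross section $\Gamma$ if $\Gamma$ is a smooth simple closed convex curve which is $\frac1{1+\hat\delta}$-noncollapsed, has $\sum_{l=1}^{18}|\nabla^l\kappa|\le\frac1{100}$ everywhere and $\kappa=1$ somewhere, and $N$ is the image of a smooth map of $\Gamma\times[-L,L]$ into $\mathbb R^3$ whose difference from the inclusion has $C^{20}$-norm at most $\varepsilon$. (Every $(\hat\alpha,\hat\delta,\varepsilon,L)$-neck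 of size $1$ is such a neck in suitable coordinates, for every $\hat\alpha$.) **Surgery.** Fix once and for all: a smooth $\chi:\mathbb R\to\mathbb R$ with $\chi=1$ on $(-\infty,1]$ and $\chi=0$ on $[2,\infty)$; a smooth, convex, even $\Phi:\mathbb R\to\mathbb R$ with $\Phi(z)=|z|$ for $|z|\ge\frac1{100}$; a function $\omega$ with $\omega(\delta)\to0$ as $\delta\to0^+$; and a constant $C$. For $\Lambda>0$ put $\lambda=\Lambda^{1/4}$ and $b=\Lambda+2\lambda$, and let $L\ge b+1$. Let $N$ be a neck as above. Suppose the cross sections $N\cap\{x_3=s\}$, $|s|<L-1$, are $\{(\gamma_s(t),s):t\in[0,1]\}$, where $\gamma_s(t)$ is smooth in $(s,t)$, $1$-periodic in $t$, and $(s,t)\mapsto\gamma_s(t)-\gamma(t)$ has $C^{20}$-norm at most $C\varepsilon$ on $|s|<L-1$. Let $\tilde\gamma_r(t)$, smooth in $(r,t)$, be a homotopy through $\frac1{1+\hat\delta}$-noncollapsed simple closed convex curves with $\tilde\gamma_r=\gamma$ for $r\le\frac14$, $\tilde\gamma_r(t)=(\cos2\pi t,\sin2\pi t)$ for $r\ge\frac12$,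 and $|\partial_r\tilde\gamma_r|+|\partial_r\partial_t\tilde\gamma_r|+|\partial_r^2\tilde\gamma_r|\le\omega(\hat\delta)$. With $\rho(s)=1-e^{-4\Lambda/s}$, the $\Lambda$-surgically modified surface $\tilde N$ has, at height $s\le b$ (with $|s|<L-1$ when $s\le0$), the cross section parametrized by $$\begin{cases}\gamma_s(t)& s\le0,\\ \rho(s)\,\gamma_s(t)&0<s\le\lambda,\\ \rho(s)\,\big(\chi(s/\lambda)\gamma_s(t)+(1-\chi(s/\lambda))\gamma(t)\big)&\lambda<s\le2\lambda,\\ \rho(s)\,\tilde\gamma_{s/\Lambda}(t)&2\lambda<s\le\Lambda,\\ \tfrac12v_\Lambda(s)\,(\cos2\pi t,\sin2\pi t)&\Lambda<s\le b,\end{cases}$$ where, with $a=1-e^{-4}+\frac13(1-e^{-4})^2\lambda^{-1}$ and $g(s)=a\sqrt{\frac{b-s}{a+b-s}}$, $v_\Lambda=\rho+g-\lambda^{-1}\Phi(\lambda(\rho-g))$ for $s\le\Lambda+\lambda$ and $v_\Lambda=2g$ for $s>\Lambda+\lambda$. **Proposition.** There exist $\delta_*>0$, $\Lambda_*>0$ and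 a function $E_*$, positive on $(\Lambda_*,\infty)$, depending only on $\chi,\Phi,\omega,C$, with the following property. If $0<\hat\delta<\delta_*$, $\Lambda>\Lambda_*$, $0<\varepsilon<E_*(\Lambda)$ and $L\ge\Lambda+2\Lambda^{1/4}+1$, then for every neck $N$ of size $1$ and every surgically modified surface $\tilde N$ as above, with mean curvatures $H$ and $\tilde H$, both of the following integrals converge and $$\int_{\tilde N\cap\{0\le x_3\le\Lambda+2\Lambda^{1/4}\}}e^{-\frac{|x-p|^2}{4\tau}-r_0\tilde H}\ \le\ \int_{N\cap\{0\le x_3\le\Lambda+2\Lambda^{1/4}\}}e^{-\frac{|x-p|^2}{4\tau}-r_0H}$$ for all $r_0\in[\frac1{1000},1]$, all $\tau\ge\frac59$ and all $p\in\mathbb R^3$. -/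

import Mathlib

open scoped ContDiff Topology

namespace NeckSurgery

noncomputable section

/-- The Euclidean plane. -/
abbrev E2 : Type := EuclideanSpace ℝ (Fin 2)

/-- Euclidean three-space. -/
abbrev E3 : Type := EuclideanSpace ℝ (Fin 3)

/-- The point of three-space with horizontal part `x` and height `z`. -/
def lift (x : E2) (z : ℝ) : E3 := !₂[x 0, x 1, z]

/-- The standard parametrization of the unit circle on `[0, 1]`. -/
def circle (t : ℝ) : E2 := !₂[Real.cos (2 * Real.pi * t), Real.sin (2 * Real.pi * t)]

/-! ### Plane curves -/

/-- The determinant of two vectors of the plane. -/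
def det2 (u v : E2) : ℝ := u 0 * v 1 - u 1 * v 0

/-- Rotation by a quarter turn, counterclockwise. -/
def rot (u : E2) : E2 := !₂[-(u 1), u 0]

/-- Geodesic curvature of a counterclockwise regular plane curve (positive on circles). -/
def curvature (γ : ℝ → E2) (t : ℝ) : ℝ :=
  det2 (deriv γ t) (deriv (deriv γ) t) / ‖deriv γ t‖ ^ 3

/-- The unit normal pointing to the left of the curve: the inward normal of a counterclockwise
simple closed curve. -/
def inwardNormal (γ : ℝ → E2) (t : ℝ) : E2 := ‖deriv γ t‖⁻¹ • rot (deriv γ t)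

/-- Differentiation with respect to the arc length of `γ`. -/
def arcDeriv {V : Type*} [NormedAddCommGroup V] [NormedSpace ℝ V] (γ : ℝ → E2) (f : ℝ → V) :
    ℝ → V :=
  fun t => ‖deriv γ t‖⁻¹ • deriv f t

/-- The pointwise `C^20` size of a map `f (s, t)` on the cylinder over `γ`: the sum over
`k + l ≤ 20` of the norms of the derivatives, `k` times in the height `s` and `l` times in the
arc length of `γ`. -/
def normC20 {V : Type*} [NormedAddCommGroup V] [NormedSpace ℝ V] (γ : ℝ → E2)
    (f : ℝ → ℝ → V) (s t : ℝ) : ℝ :=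
  ∑ k ∈ Finset.range 21, ∑ l ∈ Finset.range (21 - k),
    ‖iteratedDeriv k (fun s' => (arcDeriv γ)^[l] (f s') t) s‖

/-- `γ` is a smooth regular parametrization, of period `1` and counterclockwise, of a simple closed
convex curve: the curve lies to the left of each of its tangent lines. -/
structure IsConvexCurve (γ : ℝ → E2) : Prop where
  smooth : ContDiff ℝ ∞ γ
  periodic : ∀ t, γ (t + 1) = γ t
  regular : ∀ t, deriv γ t ≠ 0
  simple : Set.InjOn γ (Set.Ico 0 1)
  convex : ∀ t t', 0 ≤ det2 (deriv γ t) (γ t' - γ t)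

/-- The curve is `α`-noncollapsed: at each of its points the curvature is positive and the inscribed
radius is at least `α / κ`, i.e. the disk of radius `α / κ` which touches the curve there from
inside contains no point of the curve in its interior. -/
def IsNoncollapsed (α : ℝ) (γ : ℝ → E2) : Prop :=
  ∀ t, 0 < curvature γ t ∧
    ∀ t', α / curvature γ t ≤ dist (γ t') (γ t + (α / curvature γ t) • inwardNormal γ t)

/-! ### Necks -/

/-- `dist_{C^20}(N, Γ × [-L, L]) ≤ ε`: the surface `N` is the image of a smooth map of the cylinder
`Γ × [-L, L]` whose difference from the inclusion has `C^20`-norm at most `ε`. -/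
def IsC20CloseToCylinder (ε L : ℝ) (γ : ℝ → E2) (N : Set E3) : Prop :=
  ∃ G : ℝ → ℝ → E3,
    ContDiff ℝ ∞ (fun z : ℝ × ℝ => G z.1 z.2) ∧
    (∀ s t, G s (t + 1) = G s t) ∧
    N = {x | ∃ s ∈ Set.Icc (-L) L, ∃ t, x = G s t} ∧
    ∀ s ∈ Set.Icc (-L) L, ∀ t, normC20 γ (fun s t => G s t - lift (γ t) s) s t ≤ ε

/-- `N` is a neck of size `1` with parameters `δ`, `ε`, `L`, in coordinates whose `x₃`-axis is the
axis of the neck, with cross section `Γ = γ([0, 1])`. (The further requirement of an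
`(α, δ, ε, L)`-neck, that an exterior collar of `N` of width `2 α` avoid the rest of the ambient
surface, is not imposed; so necks for every value of `α` are covered.) -/
structure IsNeck (δ ε L : ℝ) (γ : ℝ → E2) (N : Set E3) : Prop where
  curve : IsConvexCurve γ
  noncollapsed : IsNoncollapsed (1 / (1 + δ)) γ
  curvature_deriv : ∀ t,
    ∑ l ∈ Finset.Icc 1 18, |(arcDeriv γ)^[l] (curvature γ) t| ≤ 1 / 100
  curvature_eq_one : ∃ t, curvature γ t = 1
  close : IsC20CloseToCylinder ε L γ N

/-- The curves `γs s`, for `|s| < L - 1`, parametrize the cross sections `N ∩ {x₃ = s}` and are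
`C ε`-close to `γ` in `C^20`. -/
structure IsSliceFamily (C ε L : ℝ) (γ : ℝ → E2) (N : Set E3) (γs : ℝ → ℝ → E2) : Prop where
  smooth : ContDiffOn ℝ ∞ (fun z : ℝ × ℝ => γs z.1 z.2)
    (Set.Ioo (-(L - 1)) (L - 1) ×ˢ Set.univ)
  periodic : ∀ s ∈ Set.Ioo (-(L - 1)) (L - 1), ∀ t, γs s (t + 1) = γs s t
  slice : ∀ s ∈ Set.Ioo (-(L - 1)) (L - 1),
    {x ∈ N | x 2 = s} = {x | ∃ t, x = lift (γs s t) s}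
  close : ∀ s ∈ Set.Ioo (-(L - 1)) (L - 1), ∀ t,
    normC20 γ (fun s t => γs s t - γ t) s t ≤ C * ε

/-- `γt` is a homotopy, through `1 / (1 + δ)`-noncollapsed convex curves, from `γ` to the unit
circle, with the derivative bound `om δ`. It is stationary for `r ≤ 1 / 4` and for `r ≥ 1 / 2`, so it
is taken to be defined for all real `r`. -/
structure IsRounding (om : ℝ → ℝ) (δ : ℝ) (γ : ℝ → E2) (γt : ℝ → ℝ → E2) : Prop where
  smooth : ContDiff ℝ ∞ (fun z : ℝ × ℝ => γt z.1 z.2)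
  start : ∀ r ≤ 1 / 4, ∀ t, γt r t = γ t
  finish : ∀ r, 1 / 2 ≤ r → ∀ t, γt r t = circle t
  curve : ∀ r, IsConvexCurve (γt r)
  noncollapsed : ∀ r, IsNoncollapsed (1 / (1 + δ)) (γt r)
  bound : ∀ r t,
    ‖deriv (fun r' => γt r' t) r‖ + ‖deriv (fun r' => deriv (γt r') t) r‖
      + ‖deriv (deriv (fun r' => γt r' t)) r‖ ≤ om δ

/-! ### The surgery -/

/-- The cutoff function of the construction. -/
structure IsCutoff (χ : ℝ → ℝ) : Prop where
  smooth : ContDiff ℝ ∞ χ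
  eq_one : ∀ z ≤ 1, χ z = 1
  eq_zero : ∀ z, 2 ≤ z → χ z = 0

/-- A smooth, convex, even function which agrees with `|z|` for `|z| ≥ 1 / 100`. -/
structure IsSmoothedAbs (Φ : ℝ → ℝ) : Prop where
  smooth : ContDiff ℝ ∞ Φ
  convex : ConvexOn ℝ Set.univ Φ
  even : ∀ z, Φ (-z) = Φ z
  eq_abs : ∀ z, 1 / 100 ≤ |z| → Φ z = |z|

/-- `Λ^{1/4}`. -/
def quarterRoot (Λ : ℝ) : ℝ := Λ ^ (1 / 4 : ℝ)

/-- The height `Λ + 2 Λ^{1/4}` of the tip of the cap. -/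
def tipHeight (Λ : ℝ) : ℝ := Λ + 2 * quarterRoot Λ

/-- The bending factor `1 - e^{-4Λ/s}`. -/
def bend (Λ s : ℝ) : ℝ := 1 - Real.exp (-(4 * Λ) / s)

/-- The constant `a = 1 - e^{-4} + (1/3) (1 - e^{-4})² Λ^{-1/4}`. -/
def capConst (Λ : ℝ) : ℝ :=
  1 - Real.exp (-4) + 1 / 3 * (1 - Real.exp (-4)) ^ 2 * (quarterRoot Λ)⁻¹

/-- The radius profile `a √((Λ + 2Λ^{1/4} - s) / (a + Λ + 2Λ^{1/4} - s))` of the tip. -/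
def tipProfile (Λ s : ℝ) : ℝ :=
  capConst Λ * Real.sqrt ((tipHeight Λ - s) / (capConst Λ + tipHeight Λ - s))

/-- The function `v_Λ`; the cap has radius `v_Λ(s) / 2` at height `s`. -/
def capProfile (Φ : ℝ → ℝ) (Λ s : ℝ) : ℝ :=
  if s ≤ Λ + quarterRoot Λ then
    bend Λ s + tipProfile Λ s
      - (quarterRoot Λ)⁻¹ * Φ (quarterRoot Λ * (bend Λ s - tipProfile Λ s))
  else 2 * tipProfile Λ s

/-- The cross section at height `s` of the surgically modified surface. -/
def modifiedSlice (χ Φ : ℝ → ℝ) (Λ : ℝ) (γ : ℝ → E2) (γs γt : ℝ → ℝ → E2) (s t : ℝ) : E2 :=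
  if s ≤ 0 then γs s t
  else if s ≤ quarterRoot Λ then bend Λ s • γs s t
  else if s ≤ 2 * quarterRoot Λ then
    bend Λ s • (χ (s / quarterRoot Λ) • γs s t + (1 - χ (s / quarterRoot Λ)) • γ t)
  else if s ≤ Λ then bend Λ s • γt (s / Λ) t
  else (1 / 2 * capProfile Φ Λ s) • circle t

/-- The surface swept out by the curves `c s`, each placed at height `s`. -/
def sweep (c : ℝ → ℝ → E2) (s t : ℝ) : E3 := lift (c s t) s

/-! ### Surface integrals and mean curvature of parametrized surfaces -/

/-- First derivative in the first parameter. -/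
def dS (F : ℝ → ℝ → E3) (s t : ℝ) : E3 := deriv (fun s' => F s' t) s

/-- First derivative in the second parameter. -/
def dT (F : ℝ → ℝ → E3) (s t : ℝ) : E3 := deriv (F s) t

/-- The cross product `∂F/∂t × ∂F/∂s`. It points outward if `F s` runs counterclockwise around the
`x₃`-axis and the height increases with `s`. Its norm is the area density. -/
def normalVec (F : ℝ → ℝ → E3) (s t : ℝ) : E3 :=
  WithLp.toLp 2 (crossProduct (dT F s t).ofLp (dS F s t).ofLp)

/-- The outward unit normal. -/
def unitNormal (F : ℝ → ℝ → E3) (s t : ℝ) : E3 := ‖normalVec F s t‖⁻¹ • normalVec F s t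

/-- The mean curvature `H = g^{ij} h_{ij}` with `h_{ij} = - ⟨∂_i ∂_j F, ν⟩` and `ν` the outward unit
normal: the sum of the principal curvatures, positive on round cylinders. -/
def meanCurvature (F : ℝ → ℝ → E3) (s t : ℝ) : ℝ :=
  let gss := inner ℝ (dS F s t) (dS F s t)
  let gst := inner ℝ (dS F s t) (dT F s t)
  let gtt := inner ℝ (dT F s t) (dT F s t)
  let hss := -inner ℝ (dS (dS F) s t) (unitNormal F s t)
  let hst := -inner ℝ (dS (dT F) s t) (unitNormal F s t)
  let htt := -inner ℝ (dT (dT F) s t) (unitNormal F s t)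
  (gtt * hss - 2 * gst * hst + gss * htt) / (gss * gtt - gst ^ 2)

/-- The integrand `e^{-|x-p|²/(4τ) - r₀ H}` times the area density, in the parameters `(s, t)`. -/
def density (F : ℝ → ℝ → E3) (r₀ τ : ℝ) (p : E3) (z : ℝ × ℝ) : ℝ :=
  Real.exp (-‖F z.1 z.2 - p‖ ^ 2 / (4 * τ) - r₀ * meanCurvature F z.1 z.2)
    * ‖normalVec F z.1 z.2‖

/-- The parameter domain `0 ≤ s ≤ Λ + 2Λ^{1/4}`, `0 ≤ t ≤ 1`. For a surface swept out by closed
curves of period `1`, placed at height `s`, it parametrizes the part with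
`0 ≤ x₃ ≤ Λ + 2Λ^{1/4}`. -/
def paramDomain (Λ : ℝ) : Set (ℝ × ℝ) := Set.Icc 0 (tipHeight Λ) ×ˢ Set.Icc 0 1

end

end NeckSurgery

/-!
Both surfaces are swept out by closed curves `c s`, one at each height `s`, over the same heights.
At a fixed height the Gaussian `e^{-|x - p|² / (4 τ)}` is a factor depending only on `s` and `p`,
times `e^{-β |c|²}` with `β = 1 / (4 τ) ≤ 9 / 20`, times `e^{⟨Q, c⟩}` with `Q ∈ ℝ²` arbitrary. So it
suffices to compare, at almost every height and for every `Q`, the integrals over the angle of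
`weight · e^{⟨Q, c⟩}`, where `weight = e^{-β |c|² - r₀ H} · (area density)`.

For a nearly round curve `x` and a contracted curve `x' ≈ (1 - u) x`, the comparison holds for all
`Q` at once as soon as the weight drops pointwise by a factor `e^{-u / 100}`
(`integral_weight_mul_exp_le`): by convexity of `exp` the difference is bounded below by `u` times
an integral of `v e^{(1 - u) v}` with `v ≈ ⟨Q, x⟩`, which is essentially nonnegative because
`⟨Q, x⟩` has nearly vanishing mean.

The drop of the weight has three sources. Contracting by `ρ = 1 - u` multiplies the area density by
about `ρ`, that is by `e^{-u}`; the Gaussian gives back at most `e^{2 β u} ≤ e^{9 u / 10}`; and the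
mean curvature increases by about `u'' ≥ 0` because the surface bends inwards, which, since
`r₀ ≥ 1 / 1000`, absorbs all errors of the order of `u'` and `u''` (here `u' ≤ u + u''`). This is
`exists_weight_smul_le`; it rests on the first order expansion of the mean curvature and of the area
density at the round cylinder (`exists_linearization`). It tolerates replacing the original cross
section by another nearly round one whose distance to it is small compared with `u`, and needs the
curvature of the new cross section only from below. For the interpolation to the model cross
section the smallness comes from `ε`, which may depend on `Λ`; for the homotopy to the circle,
which takes place at heights where `u ≥ e^{-16}`, it comes from `δ`. There the lower curvature bound
is a consequence of noncollapsing (`bendDet_ge_of_noncollapsed`), and the matching upper bound for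
the original cross section follows from the bound on the derivative of its curvature
(`IsConvexCurve.curvature_le`).

On the caps, `H` is at least the reciprocal of the area density, so the weight is at most
`e^{-1 / 1000}` times the one of the round cylinder (`weight_cap_le`), by explicit estimates for the
two profiles (`junction_estimate`, `tip_estimate`). The integral of `e^{⟨Q, ·⟩}` over a centred circle
increases with the radius, so the radius may be replaced by `99 / 100`, which brings the caps back
to the case of a slight contraction.
-/

namespace NeckSurgery

/-! ### The plane: determinant, inner product and rotation -/

lemma inner_eq (u v : E2) : inner ℝ u v = u 0 * v 0 + u 1 * v 1 := by
  simp [PiLp.inner_apply, Fin.sum_univ_two, mul_comm]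

lemma norm_sq_eq (u : E2) : ‖u‖ ^ 2 = u 0 ^ 2 + u 1 ^ 2 := by
  rw [EuclideanSpace.norm_sq_eq]; simp [Fin.sum_univ_two]

lemma det2_add_left (u v w : E2) : det2 (u + v) w = det2 u w + det2 v w := by
  simp [det2]; ring

lemma det2_add_right (u v w : E2) : det2 u (v + w) = det2 u v + det2 u w := by
  simp [det2]; ring

lemma det2_sub_left (u v w : E2) : det2 (u - v) w = det2 u w - det2 v w := by
  simp [det2]; ring

lemma det2_sub_right (u v w : E2) : det2 u (v - w) = det2 u v - det2 u w := by
  simp [det2]; ring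

lemma det2_smul_left (a : ℝ) (u v : E2) : det2 (a • u) v = a * det2 u v := by
  simp [det2]; ring

lemma det2_smul_right (a : ℝ) (u v : E2) : det2 u (a • v) = a * det2 u v := by
  simp [det2]; ring

lemma det2_self (u : E2) : det2 u u = 0 := by
  simp [det2]; ring

lemma inner_sq_add_det2_sq (u v : E2) :
    (inner ℝ u v) ^ 2 + det2 u v ^ 2 = ‖u‖ ^ 2 * ‖v‖ ^ 2 := by
  rw [inner_eq, norm_sq_eq, norm_sq_eq, det2]; ring

lemma abs_det2_le (u v : E2) : |det2 u v| ≤ ‖u‖ * ‖v‖ := by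
  rw [← abs_of_nonneg (mul_nonneg (norm_nonneg u) (norm_nonneg v))]
  apply sq_le_sq.1
  nlinarith [inner_sq_add_det2_sq u v, sq_nonneg (inner ℝ u v)]

lemma norm_rot (u : E2) : ‖rot u‖ = ‖u‖ := by
  rw [← sq_eq_sq₀ (norm_nonneg _) (norm_nonneg _), norm_sq_eq, norm_sq_eq]
  simp [rot]; ring

lemma det2_rot_right (u v : E2) : det2 u (rot v) = inner ℝ u v := by
  rw [inner_eq]; simp [det2, rot]

lemma norm_circle (t : ℝ) : ‖circle t‖ = 1 := by
  rw [← sq_eq_sq₀ (norm_nonneg _) zero_le_one, norm_sq_eq]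
  simp [circle]

lemma circle_add_one (t : ℝ) : circle (t + 1) = circle t := by
  simp [circle, mul_add, Real.cos_add_two_pi, Real.sin_add_two_pi]

lemma circle_add_half (t : ℝ) : circle (t + 1 / 2) = -circle t := by
  have : 2 * Real.pi * (t + 1 / 2) = 2 * Real.pi * t + Real.pi := by ring
  ext i
  fin_cases i <;> simp [circle, this, Real.cos_add_pi, Real.sin_add_pi, -one_div]

lemma hasDerivAt_vec {f g : ℝ → ℝ} {f' g' t : ℝ} (hf : HasDerivAt f f' t)
    (hg : HasDerivAt g g' t) : HasDerivAt (fun t => (!₂[f t, g t] : E2)) !₂[f', g'] t := by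
  have h : HasDerivAt (fun t => (![f t, g t] : Fin 2 → ℝ)) ![f', g'] t := by
    rw [hasDerivAt_pi]; intro i; fin_cases i <;> simpa
  exact (PiLp.hasStrictFDerivAt_toLp (𝕜 := ℝ) 2
    (![f t, g t] : Fin 2 → ℝ)).hasFDerivAt.comp_hasDerivAt t h

lemma hasDerivAt_circle (t : ℝ) : HasDerivAt circle ((2 * Real.pi) • rot (circle t)) t := by
  have hl : HasDerivAt (fun t : ℝ => 2 * Real.pi * t) (2 * Real.pi) t := by
    simpa using (hasDerivAt_id t).const_mul (2 * Real.pi)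
  have := hasDerivAt_vec hl.cos hl.sin
  have e : (2 * Real.pi) • rot (circle t) = !₂[-Real.sin (2 * Real.pi * t) * (2 * Real.pi),
      Real.cos (2 * Real.pi * t) * (2 * Real.pi)] := by
    refine PiLp.ext fun i => ?_
    fin_cases i <;> simp [circle, rot] <;> ring
  rw [e]
  exact this

lemma hasDerivAt_rot_circle (t : ℝ) :
    HasDerivAt (fun t => rot (circle t)) (-((2 * Real.pi) • circle t)) t := by
  have hl : HasDerivAt (fun t : ℝ => 2 * Real.pi * t) (2 * Real.pi) t := by
    simpa using (hasDerivAt_id t).const_mul (2 * Real.pi)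
  have := hasDerivAt_vec hl.sin.neg hl.cos
  have e : -((2 * Real.pi) • circle t) = !₂[-(Real.cos (2 * Real.pi * t) * (2 * Real.pi)),
      -Real.sin (2 * Real.pi * t) * (2 * Real.pi)] := by
    refine PiLp.ext fun i => ?_
    fin_cases i <;> simp [circle] <;> ring
  rw [e]
  exact this

lemma contDiff_circle : ContDiff ℝ ∞ circle := by
  rw [contDiff_euclidean]
  intro i
  fin_cases i <;> simp [circle] <;> fun_prop

/-! ### Derivatives of families of plane curves -/

/-- The derivative in the height of a family of plane curves `c s t`. -/
noncomputable def dHeight (c : ℝ → ℝ → E2) (s t : ℝ) : E2 := deriv (fun s' => c s' t) s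

/-- The derivative of a family of plane curves `c s t` in the angle `2 π t`. With this
normalization it is `rot (circle t)` for the unit circle. -/
noncomputable def dAngle (c : ℝ → ℝ → E2) (s t : ℝ) : E2 := (2 * Real.pi)⁻¹ • deriv (c s) t

/-- The family `c s t` is smooth in the strip `U × ℝ`. -/
def SmoothStrip (U : Set ℝ) (c : ℝ → ℝ → E2) : Prop :=
  ContDiffOn ℝ ∞ (fun z : ℝ × ℝ => c z.1 z.2) (U ×ˢ Set.univ)

lemma two_pi_ne_zero : (2 * Real.pi) ≠ 0 := by positivity

section strip
variable {U : Set ℝ} {c c' : ℝ → ℝ → E2} {s : ℝ}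

lemma SmoothStrip.contDiffAt (hU : IsOpen U) (h : SmoothStrip U c) (hs : s ∈ U) (t : ℝ) :
    ContDiffAt ℝ ∞ (fun z : ℝ × ℝ => c z.1 z.2) (s, t) :=
  ContDiffOn.contDiffAt h ((hU.prod isOpen_univ).mem_nhds ⟨hs, trivial⟩)

lemma SmoothStrip.hasDerivAt_height_fderiv (hU : IsOpen U) (h : SmoothStrip U c) (hs : s ∈ U)
    (t : ℝ) : HasDerivAt (fun s' => c s' t)
      (fderiv ℝ (fun z : ℝ × ℝ => c z.1 z.2) (s, t) (1, 0)) s := by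
  have h1 := ((h.contDiffAt hU hs t).differentiableAt (by simp)).hasFDerivAt
  have h2 : HasDerivAt (fun s' : ℝ => (s', t)) ((1 : ℝ), (0 : ℝ)) s :=
    (hasDerivAt_id s).prodMk (hasDerivAt_const s t)
  exact h1.comp_hasDerivAt s h2

lemma SmoothStrip.hasDerivAt_angle_fderiv (hU : IsOpen U) (h : SmoothStrip U c) (hs : s ∈ U)
    (t : ℝ) : HasDerivAt (c s)
      (fderiv ℝ (fun z : ℝ × ℝ => c z.1 z.2) (s, t) (0, 1)) t := by
  have h1 := ((h.contDiffAt hU hs t).differentiableAt (by simp)).hasFDerivAt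
  have h2 : HasDerivAt (fun t' : ℝ => (s, t')) ((0 : ℝ), (1 : ℝ)) t :=
    (hasDerivAt_const t s).prodMk (hasDerivAt_id t)
  exact h1.comp_hasDerivAt t h2

lemma SmoothStrip.hasDerivAt_height (hU : IsOpen U) (h : SmoothStrip U c) (hs : s ∈ U) (t : ℝ) :
    HasDerivAt (fun s' => c s' t) (dHeight c s t) s :=
  (h.hasDerivAt_height_fderiv hU hs t).differentiableAt.hasDerivAt

lemma SmoothStrip.hasDerivAt_angle (hU : IsOpen U) (h : SmoothStrip U c) (hs : s ∈ U) (t : ℝ) :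
    HasDerivAt (c s) ((2 * Real.pi) • dAngle c s t) t := by
  rw [dAngle, smul_inv_smul₀ two_pi_ne_zero]
  exact (h.hasDerivAt_angle_fderiv hU hs t).differentiableAt.hasDerivAt

lemma SmoothStrip.contDiffOn_fderiv (hU : IsOpen U) (h : SmoothStrip U c) (v : ℝ × ℝ) :
    ContDiffOn ℝ ∞ (fun z : ℝ × ℝ => fderiv ℝ (fun z : ℝ × ℝ => c z.1 z.2) z v)
      (U ×ˢ Set.univ) :=
  (ContDiffOn.fderiv_of_isOpen h (hU.prod isOpen_univ) (m := ∞) (by simp)).clm_apply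
    contDiffOn_const

/-- On a strip over an open set, `dHeight` and `dAngle` preserve smoothness, so all the derivatives of a
family that occur below are again smooth families. -/
lemma SmoothStrip.smooth_dHeight (hU : IsOpen U) (h : SmoothStrip U c) :
    SmoothStrip U (dHeight c) := by
  refine (h.contDiffOn_fderiv hU (1, 0)).congr ?_
  rintro ⟨s, t⟩ ⟨hs, -⟩
  exact (h.hasDerivAt_height_fderiv hU hs t).deriv

lemma SmoothStrip.smooth_dAngle (hU : IsOpen U) (h : SmoothStrip U c) :
    SmoothStrip U (dAngle c) := by
  refine ((h.contDiffOn_fderiv hU (0, 1)).const_smul (2 * Real.pi)⁻¹).congr ?_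
  rintro ⟨s, t⟩ ⟨hs, -⟩
  simp only [dAngle]
  rw [(h.hasDerivAt_angle_fderiv hU hs t).deriv]

lemma SmoothStrip.continuousOn (h : SmoothStrip U c) :
    ContinuousOn (fun z : ℝ × ℝ => c z.1 z.2) (U ×ˢ Set.univ) :=
  ContDiffOn.continuousOn h

lemma SmoothStrip.continuous_slice (h : SmoothStrip U c) (hs : s ∈ U) : Continuous (c s) := by
  have h2 : Continuous (fun t : ℝ => (s, t)) := by fun_prop
  exact ContinuousOn.comp_continuous (f := fun t : ℝ => (s, t)) h.continuousOn h2
    (fun t => ⟨hs, trivial⟩)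

lemma dHeight_congr (hU : IsOpen U) (h : ∀ s ∈ U, c s = c' s) :
    ∀ s ∈ U, dHeight c s = dHeight c' s := by
  intro s hs
  ext1 t
  apply Filter.EventuallyEq.deriv_eq
  filter_upwards [hU.mem_nhds hs] with s' hs'
  rw [h s' hs']

/-! ### The area density and the mean curvature of a swept surface -/

/-- The mean curvature of a swept surface in terms of the scalar invariants
`P = |c_θ|²`, `a = det (c_θ, c_ss)`, `i = ⟨c_s, c_θ⟩`, `q = det (c_θ, c_sθ)`, `Y = |c_s|²`,
`J = det (c_θ, c_θθ)`, `d = det (c_θ, c_s)` of its cross sections. -/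
noncomputable def meanH (P a i q Y J d : ℝ) : ℝ :=
  (P * a - 2 * i * q + (1 + Y) * J) / (√(P + d ^ 2) * (P + d ^ 2))

/-- The mean curvature of the surface swept out by `c`, from the derivatives of `c`. -/
noncomputable def sliceH (c : ℝ → ℝ → E2) (s t : ℝ) : ℝ :=
  meanH (‖dAngle c s t‖ ^ 2) (det2 (dAngle c s t) (dHeight (dHeight c) s t))
    (inner ℝ (dHeight c s t) (dAngle c s t)) (det2 (dAngle c s t) (dHeight (dAngle c) s t))
    (‖dHeight c s t‖ ^ 2) (det2 (dAngle c s t) (dAngle (dAngle c) s t))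
    (det2 (dAngle c s t) (dHeight c s t))

/-- The area density of the surface swept out by `c`, with respect to height and angle. -/
noncomputable def sliceA (c : ℝ → ℝ → E2) (s t : ℝ) : ℝ :=
  √(‖dAngle c s t‖ ^ 2 + det2 (dAngle c s t) (dHeight c s t) ^ 2)

/-- The part of the integrand that does not depend on the centre `p` of the Gaussian, with
`β = 1 / (4 τ)`. -/
noncomputable def weight (β r₀ : ℝ) (c : ℝ → ℝ → E2) (s t : ℝ) : ℝ :=
  Real.exp (-β * ‖c s t‖ ^ 2 - r₀ * sliceH c s t) * (2 * Real.pi * sliceA c s t)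

lemma hasDerivAt_lift {f : ℝ → E2} {g : ℝ → ℝ} {f' : E2} {g' t : ℝ} (hf : HasDerivAt f f' t)
    (hg : HasDerivAt g g' t) : HasDerivAt (fun t => lift (f t) (g t)) (lift f' g') t := by
  have h : HasDerivAt (fun t => (![f t 0, f t 1, g t] : Fin 3 → ℝ)) ![f' 0, f' 1, g'] t := by
    have hc : ∀ i, HasDerivAt (fun t => f t i) (f' i) t := fun i =>
      (EuclideanSpace.proj i : E2 →L[ℝ] ℝ).hasFDerivAt.comp_hasDerivAt t hf
    rw [hasDerivAt_pi]; intro i; fin_cases i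
    · simpa using hc 0
    · simpa using hc 1
    · simpa using hg
  exact (PiLp.hasStrictFDerivAt_toLp (𝕜 := ℝ) 2
    (![f t 0, f t 1, g t] : Fin 3 → ℝ)).hasFDerivAt.comp_hasDerivAt t h

lemma dS_congr {F G : ℝ → ℝ → E3} (hU : IsOpen U) (h : ∀ s ∈ U, F s = G s) :
    ∀ s ∈ U, dS F s = dS G s := by
  intro s hs
  ext1 t
  apply Filter.EventuallyEq.deriv_eq
  filter_upwards [hU.mem_nhds hs] with s' hs'
  rw [h s' hs']

lemma dT_congr {F G : ℝ → ℝ → E3} (h : ∀ s ∈ U, F s = G s) :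
    ∀ s ∈ U, dT F s = dT G s := by
  intro s hs
  ext1 t
  rw [dT, dT, h s hs]

lemma SmoothStrip.dS_lift (hU : IsOpen U) (h : SmoothStrip U c) {g : ℝ → ℝ} {g' : ℝ}
    (hg : ∀ s, HasDerivAt g g' s) (hs : s ∈ U) :
    dS (fun s t => lift (c s t) (g s)) s = fun t => lift (dHeight c s t) g' := by
  ext1 t
  exact (hasDerivAt_lift (h.hasDerivAt_height hU hs t) (hg s)).deriv

lemma SmoothStrip.dT_lift (hU : IsOpen U) (h : SmoothStrip U c) {g : ℝ → ℝ} (hs : s ∈ U) :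
    dT (fun s t => lift (c s t) (g s)) s =
      fun t => lift ((2 * Real.pi) • dAngle c s t) 0 := by
  ext1 t
  exact (hasDerivAt_lift (h.hasDerivAt_angle hU hs t) (hasDerivAt_const t (g s))).deriv

/-- Area density and mean curvature of a swept surface. The factor `2 π` is due to the normalization
of `dAngle`. -/
lemma SmoothStrip.geometry (hU : IsOpen U) (h : SmoothStrip U c) (hs : s ∈ U) (t : ℝ) :
    ‖normalVec (sweep c) s t‖ = 2 * Real.pi * sliceA c s t ∧
      meanCurvature (sweep c) s t = sliceH c s t := by
  have hpi := Real.pi_pos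
  have e1 : ∀ s ∈ U, dS (sweep c) s = fun t => lift (dHeight c s t) 1 :=
    fun s hs => h.dS_lift hU (g := fun s => s) (fun s => hasDerivAt_id s) hs
  have e2 : ∀ s ∈ U, dT (sweep c) s = fun t => lift ((2 * Real.pi) • dAngle c s t) 0 :=
    fun s hs => h.dT_lift hU (g := fun s => s) hs
  have e3 : dS (dS (sweep c)) s t =
      lift (dHeight (dHeight c) s t) 0 := by
    rw [dS_congr hU e1 s hs, (h.smooth_dHeight hU).dS_lift hU (fun s => hasDerivAt_const s 1) hs]
  have e4 : dS (dT (sweep c)) s t =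
      lift ((2 * Real.pi) • dHeight (dAngle c) s t) 0 := by
    rw [dS_congr hU e2 s hs]
    refine (hasDerivAt_lift (HasDerivAt.const_smul (2 * Real.pi)
      ((h.smooth_dAngle hU).hasDerivAt_height hU hs t)) (hasDerivAt_const s 0)).deriv
  have e5 : dT (dT (sweep c)) s t = lift ((2 * Real.pi) • (2 * Real.pi) •
      dAngle (dAngle c) s t) 0 := by
    rw [dT_congr e2 s hs]
    refine (hasDerivAt_lift (HasDerivAt.const_smul (2 * Real.pi)
      ((h.smooth_dAngle hU).hasDerivAt_angle hU hs t)) (hasDerivAt_const t 0)).deriv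
  have e1' := congrFun (e1 s hs) t
  have e2' := congrFun (e2 s hs) t
  have hA0 : 0 ≤ ‖dAngle c s t‖ ^ 2 +
      det2 (dAngle c s t) (dHeight c s t) ^ 2 := by positivity
  have hn : ‖normalVec (sweep c) s t‖ = 2 * Real.pi * sliceA c s t := by
    rw [← sq_eq_sq₀ (norm_nonneg _) (by rw [sliceA]; positivity), mul_pow, sliceA,
      Real.sq_sqrt hA0, EuclideanSpace.norm_sq_eq, Fin.sum_univ_three, normalVec, e1', e2',
      cross_apply, norm_sq_eq, det2]
    simp [lift, mul_pow, sq_abs]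
    ring
  refine ⟨hn, ?_⟩
  have hin : ∀ x : E2, inner ℝ (lift x 0) (unitNormal (sweep c) s t) =
      -(det2 (dAngle c s t) x / sliceA c s t) := by
    intro x
    rw [unitNormal, inner_smul_right, hn, normalVec, e1', e2', cross_apply]
    have : inner ℝ (lift x 0) (WithLp.toLp 2 ![
        (lift ((2 * Real.pi) • dAngle c s t) 0).ofLp 1 *
            (lift (dHeight c s t) 1).ofLp 2 -
          (lift ((2 * Real.pi) • dAngle c s t) 0).ofLp 2 *
            (lift (dHeight c s t) 1).ofLp 1,
        (lift ((2 * Real.pi) • dAngle c s t) 0).ofLp 2 *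
            (lift (dHeight c s t) 1).ofLp 0 -
          (lift ((2 * Real.pi) • dAngle c s t) 0).ofLp 0 *
            (lift (dHeight c s t) 1).ofLp 2,
        (lift ((2 * Real.pi) • dAngle c s t) 0).ofLp 0 *
            (lift (dHeight c s t) 1).ofLp 1 -
          (lift ((2 * Real.pi) • dAngle c s t) 0).ofLp 1 *
            (lift (dHeight c s t) 1).ofLp 0] : E3) =
        -(2 * Real.pi * det2 (dAngle c s t) x) := by
      rw [PiLp.inner_apply, Fin.sum_univ_three]
      simp [lift, det2]
      ring
    rw [this, mul_inv]
    field_simp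
  have hll : ∀ (x y : E2) (z w : ℝ), inner ℝ (lift x z) (lift y w) = inner ℝ x y + z * w := by
    intro x y z w
    rw [PiLp.inner_apply, Fin.sum_univ_three, inner_eq]
    simp [lift]; ring
  have hlag := inner_sq_add_det2_sq (dHeight c s t) (dAngle c s t)
  have hdd : det2 (dHeight c s t) (dAngle c s t) ^ 2 =
      det2 (dAngle c s t) (dHeight c s t) ^ 2 := by
    simp only [det2]; ring
  rw [hdd] at hlag
  rw [meanCurvature, e3, e4, e5, hin, hin, hin, e1', e2', hll, hll, hll, sliceH, meanH]
  simp only [det2_smul_right, inner_smul_left, inner_smul_right, real_inner_self_eq_norm_sq,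
    ← sliceA.eq_1 c s t]
  have hpi2 : (2 * Real.pi) ^ 2 ≠ 0 := by positivity
  set P := ‖dAngle c s t‖ ^ 2
  set Y := ‖dHeight c s t‖ ^ 2
  set d := det2 (dAngle c s t) (dHeight c s t)
  set i := inner ℝ (dHeight c s t) (dAngle c s t)
  set A := sliceA c s t
  simp only [Real.ringHom_apply, neg_neg, mul_one, mul_zero, add_zero]
  have hden : (Y + 1) * (2 * Real.pi * (2 * Real.pi * P)) - (2 * Real.pi * i) ^ 2 =
      (2 * Real.pi) ^ 2 * (P + d ^ 2) := by
    linear_combination -(2 * Real.pi) ^ 2 * hlag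
  rw [hden]
  rw [show ∀ a q J : ℝ, 2 * Real.pi * (2 * Real.pi * P) * (a / A) - 2 * (2 * Real.pi * i) *
      (2 * Real.pi * q / A) + (Y + 1) * (2 * Real.pi * (2 * Real.pi * J) / A) =
      (2 * Real.pi) ^ 2 * ((P * a - 2 * i * q + (1 + Y) * J) / A) from fun a q J => by ring,
    mul_div_mul_left _ _ hpi2, div_div]

/-- The integrand at height `s` depends only on the cross sections at heights near `s`. -/
lemma density_congr (hU : IsOpen U) (h : ∀ s ∈ U, c s = c' s) (hs : s ∈ U) (r₀ τ : ℝ) (p : E3)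
    (t : ℝ) : density (sweep c) r₀ τ p (s, t) = density (sweep c') r₀ τ p (s, t) := by
  have h0 : ∀ s ∈ U, sweep c s = sweep c' s := by
    intro s hs; ext1 t; simp only [sweep, h s hs]
  have h1 := dS_congr hU h0
  have h2 := dT_congr h0
  have h3 := dS_congr hU h1
  have h4 := dS_congr hU h2
  have h5 := dT_congr h2
  simp only [density, meanCurvature, unitNormal, normalVec, h0 s hs, h1 s hs, h2 s hs, h3 s hs,
    h4 s hs, h5 s hs]

/-- The horizontal part of a point of space. -/
noncomputable def horizontal (p : E3) : E2 := !₂[p 0, p 1]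

/-- At a fixed height the Gaussian splits into a common factor, a factor depending on the distance
from the axis, and the exponential of a linear function. -/
lemma SmoothStrip.density_eq (hU : IsOpen U) (h : SmoothStrip U c) (hs : s ∈ U) {r₀ τ : ℝ}
    (hτ : 0 < τ) (p : E3) (t : ℝ) :
    density (sweep c) r₀ τ p (s, t) =
      Real.exp (-(‖horizontal p‖ ^ 2 + (s - p 2) ^ 2) / (4 * τ)) *
        (weight (1 / (4 * τ)) r₀ c s t *
          Real.exp (inner ℝ ((1 / (2 * τ)) • horizontal p) (c s t))) := by
  obtain ⟨h1, h2⟩ := h.geometry hU hs t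
  have h3 : ‖sweep c s t - p‖ ^ 2 = ‖c s t‖ ^ 2 - 2 * inner ℝ (horizontal p) (c s t) +
      ‖horizontal p‖ ^ 2 + (s - p 2) ^ 2 := by
    rw [EuclideanSpace.norm_sq_eq, Fin.sum_univ_three, norm_sq_eq, norm_sq_eq, inner_eq]
    simp [sweep, lift, horizontal]
    ring
  simp only [density]
  rw [h1, h2, weight, inner_smul_left, h3, mul_right_comm (Real.exp _) (2 * _ * _),
    ← Real.exp_add, ← mul_assoc (Real.exp _) (Real.exp _), ← Real.exp_add]
  congr 2
  simp only [Real.ringHom_apply]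
  field_simp
  ring

end strip

/-! ### Exponential integrals over nearly round curves -/

lemma hasDerivAt_inner_right (Q : E2) {f : ℝ → E2} {f' : E2} {t : ℝ} (hf : HasDerivAt f f' t) :
    HasDerivAt (fun t => inner ℝ Q (f t)) (inner ℝ Q f') t := by
  simpa using (hasDerivAt_const t Q).inner ℝ hf

lemma integral_inner_circle (Q : E2) : ∫ t in (0 : ℝ)..1, inner ℝ Q (circle t) = 0 := by
  have hd : ∀ t : ℝ, HasDerivAt (fun t => -(2 * Real.pi)⁻¹ * inner ℝ Q (rot (circle t)))
      (inner ℝ Q (circle t)) t := by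
    intro t
    have := (hasDerivAt_inner_right Q (hasDerivAt_rot_circle t)).const_mul (-(2 * Real.pi)⁻¹)
    refine this.congr_deriv ?_
    rw [inner_neg_right, inner_smul_right]
    have := Real.pi_ne_zero
    field_simp
  rw [intervalIntegral.integral_eq_sub_of_hasDerivAt (fun t _ => hd t)]
  · have : circle 1 = circle 0 := by simpa using circle_add_one 0
    rw [this, sub_self]
  · exact (by have := contDiff_circle.continuous; fun_prop :
      Continuous fun t => inner ℝ Q (circle t)).intervalIntegrable 0 1

lemma inner_circle_sq_add (Q : E2) (t : ℝ) :
    inner ℝ Q (circle t) ^ 2 + inner ℝ Q (rot (circle t)) ^ 2 = ‖Q‖ ^ 2 := by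
  rw [inner_eq, inner_eq, norm_sq_eq]
  simp only [circle, rot, PiLp.toLp_apply, Matrix.cons_val_zero, Matrix.cons_val_one]
  linear_combination (Q 0 ^ 2 + Q 1 ^ 2) * Real.sin_sq_add_cos_sq (2 * Real.pi * t)

lemma integral_inner_circle_sq (Q : E2) :
    ∫ t in (0 : ℝ)..1, inner ℝ Q (circle t) ^ 2 = ‖Q‖ ^ 2 / 2 := by
  have hd : ∀ t : ℝ, HasDerivAt (fun t => ‖Q‖ ^ 2 / 2 * t - (4 * Real.pi)⁻¹ *
      (inner ℝ Q (circle t) * inner ℝ Q (-rot (circle t)) * (-1)))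
      (inner ℝ Q (circle t) ^ 2) t := by
    intro t
    have h1 := hasDerivAt_inner_right Q (hasDerivAt_circle t)
    have h2 := hasDerivAt_inner_right Q (hasDerivAt_rot_circle t).fun_neg
    have h3 := ((hasDerivAt_id t).const_mul (‖Q‖ ^ 2 / 2)).sub
      (((h1.mul h2).mul_const (-1 : ℝ)).const_mul ((4 * Real.pi)⁻¹))
    refine h3.congr_deriv ?_
    have := Real.pi_ne_zero
    rw [← inner_circle_sq_add Q t]
    simp only [inner_neg_right, inner_smul_right]
    field_simp
    ring
  rw [intervalIntegral.integral_eq_sub_of_hasDerivAt (fun t _ => hd t)]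
  · have : circle 1 = circle 0 := by simpa using circle_add_one 0
    rw [this]; ring
  · exact (by have := contDiff_circle.continuous; fun_prop :
      Continuous fun t => inner ℝ Q (circle t) ^ 2).intervalIntegrable 0 1

lemma mul_exp_ge_self {ρ : ℝ} (hρ : 0 ≤ ρ) (v : ℝ) : v ≤ Real.exp (ρ * v) * v := by
  rcases le_total 0 v with hv | hv
  · have : 1 ≤ Real.exp (ρ * v) := Real.one_le_exp (by positivity)
    nlinarith
  · have : Real.exp (ρ * v) ≤ 1 := Real.exp_le_one_iff.2 (mul_nonpos_of_nonneg_of_nonpos hρ hv)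
    nlinarith

/-- Used when `Q` is large; for `v ≤ 0` it follows from `e^z (1 - z) ≤ 1`. -/
lemma mul_exp_ge_max {ρ : ℝ} (hρ : 9 / 10 ≤ ρ) (v : ℝ) :
    max v 0 - 2 ≤ Real.exp (ρ * v) * v := by
  rcases le_total 0 v with hv | hv
  · rw [max_eq_left hv]
    linarith [mul_exp_ge_self (by linarith : 0 ≤ ρ) v]
  · rw [max_eq_right hv]
    have h1 : 1 - ρ * v ≤ Real.exp (-(ρ * v)) := by linarith [Real.add_one_le_exp (-(ρ * v))]
    rw [Real.exp_neg] at h1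
    have hp := Real.exp_pos (ρ * v)
    have h2 : Real.exp (ρ * v) * (1 - ρ * v) ≤ 1 := by
      calc _ ≤ Real.exp (ρ * v) * (Real.exp (ρ * v))⁻¹ := by gcongr
        _ = 1 := mul_inv_cancel₀ hp.ne'
    nlinarith [mul_nonneg hp.le (neg_nonneg.2 hv)]

/-- Positivity of the derivative in the dilation factor, uniformly in `Q`. For bounded `Q` it comes
from `v ≤ e^{ρ v} v` and the vanishing mean of `⟨Q, x⟩`, for large `Q` from
`max v 0 - 2 ≤ e^{ρ v} v`. -/
lemma integral_mul_exp_nonneg {x : ℝ → E2} {W : ℝ → ℝ} (hxc : Continuous x) (hWc : Continuous W)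
    (hx : ∀ t, ‖x t - circle t‖ ≤ 1 / 100000) (hW : ∀ t, |W t - 1| ≤ 1 / 100000)
    {ρ : ℝ} (hρ : 9 / 10 ≤ ρ) (Q : E2) :
    0 ≤ ∫ t in (0 : ℝ)..1, W t * (Real.exp (ρ * (inner ℝ Q (x t) - 1 / 100000 * ‖Q‖ + 1 / 100)) *
      (inner ℝ Q (x t) - 1 / 100000 * ‖Q‖ + 1 / 100)) := by
  have hcc := contDiff_circle.continuous
  set K := ‖Q‖ with hK
  have hK0 : 0 ≤ K := norm_nonneg Q
  have hyx : ∀ t, |inner ℝ Q (x t) - inner ℝ Q (circle t)| ≤ 1 / 100000 * K := by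
    intro t
    rw [← inner_sub_right]
    calc _ ≤ ‖Q‖ * ‖x t - circle t‖ := abs_real_inner_le_norm _ _
      _ ≤ K * (1 / 100000) := by gcongr; exact hx t
      _ = _ := by ring
  have hy : ∀ t, |inner ℝ Q (circle t)| ≤ K := by
    intro t
    have := abs_real_inner_le_norm Q (circle t)
    rwa [norm_circle, mul_one] at this
  have hI : IntervalIntegrable (fun t => W t *
      (Real.exp (ρ * (inner ℝ Q (x t) - 1 / 100000 * K + 1 / 100)) *
      (inner ℝ Q (x t) - 1 / 100000 * K + 1 / 100))) MeasureTheory.volume 0 1 :=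
    Continuous.intervalIntegrable (by fun_prop) 0 1
  have hI1 : IntervalIntegrable (fun t => inner ℝ Q (circle t)) MeasureTheory.volume 0 1 :=
    Continuous.intervalIntegrable (by fun_prop) 0 1
  have hI2 : IntervalIntegrable (fun t => inner ℝ Q (circle t) ^ 2) MeasureTheory.volume 0 1 :=
    Continuous.intervalIntegrable (by fun_prop) 0 1
  -- the second case uses `max y 0 ≥ (y + y² / K) / 2` for `|y| ≤ K`, whose mean is `K / 4`
  rcases le_total K 32 with hK32 | hK32
  · have hlow : ∫ t in (0 : ℝ)..1, inner ℝ Q (circle t) ≤ ∫ t in (0 : ℝ)..1, W t *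
        (Real.exp (ρ * (inner ℝ Q (x t) - 1 / 100000 * K + 1 / 100)) *
        (inner ℝ Q (x t) - 1 / 100000 * K + 1 / 100)) := by
      refine intervalIntegral.integral_mono_on zero_le_one hI1 hI fun t _ => ?_
      have h1 := mul_exp_ge_self (by linarith : 0 ≤ ρ) (inner ℝ Q (x t) - 1 / 100000 * K + 1 / 100)
      have h2 := abs_le.1 (hW t)
      have h3 := abs_le.1 (hyx t)
      have h4 := abs_le.1 (hy t)
      set v := inner ℝ Q (x t) - 1 / 100000 * K + 1 / 100
      have h5 : W t * v ≤ W t * (Real.exp (ρ * v) * v) :=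
        mul_le_mul_of_nonneg_left h1 (by linarith)
      refine le_trans ?_ h5
      have h6 : |v| ≤ 40 := by rw [abs_le]; constructor <;> simp only [v] <;> linarith
      have h7 : |(W t - 1) * v| ≤ 1 / 100000 * 40 := by
        rw [abs_mul]; exact mul_le_mul (hW t) h6 (abs_nonneg _) (by norm_num)
      have h8 := (abs_le.1 h7).1
      have h9 : W t * v = v + (W t - 1) * v := by ring
      rw [h9]
      simp only [v] at h8 ⊢
      linarith
    rwa [integral_inner_circle] at hlow
  · have hKp : 0 < K := by linarith
    have hlow : ∫ t in (0 : ℝ)..1, (99 / 200 * inner ℝ Q (circle t) +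
          (99 / 200 / K * inner ℝ Q (circle t) ^ 2 + (-(1 / 50000) * K - 21 / 10))) ≤
        ∫ t in (0 : ℝ)..1, W t *
        (Real.exp (ρ * (inner ℝ Q (x t) - 1 / 100000 * K + 1 / 100)) *
        (inner ℝ Q (x t) - 1 / 100000 * K + 1 / 100)) := by
      refine intervalIntegral.integral_mono_on zero_le_one
        (Continuous.intervalIntegrable (by fun_prop) 0 1) hI fun t _ => ?_
      have h1 := mul_exp_ge_max hρ (inner ℝ Q (x t) - 1 / 100000 * K + 1 / 100)
      have h2 := abs_le.1 (hW t)
      have h3 := abs_le.1 (hyx t)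
      have h4 := abs_le.1 (hy t)
      set v := inner ℝ Q (x t) - 1 / 100000 * K + 1 / 100 with hv
      set y := inner ℝ Q (circle t)
      have h5 : W t * (max v 0 - 2) ≤ W t * (Real.exp (ρ * v) * v) :=
        mul_le_mul_of_nonneg_left h1 (by linarith)
      refine le_trans ?_ h5
      have h6 : (y + y ^ 2 / K) / 2 - 1 / 50000 * K ≤ max v 0 := by
        rcases le_total 0 y with hy0 | hy0
        · have : y ^ 2 / K ≤ y := by rw [div_le_iff₀ hKp]; nlinarith
          refine le_trans ?_ (le_max_left _ _)
          linarith
        · have : y ^ 2 / K ≤ -y := by rw [div_le_iff₀ hKp]; nlinarith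
          refine le_trans ?_ (le_max_right _ _)
          linarith
      have h7 : 0 ≤ max v 0 := le_max_right _ _
      have h8 : 99 / 100 * max v 0 ≤ W t * max v 0 :=
        mul_le_mul_of_nonneg_right (by linarith) h7
      have h9 : 99 / 200 / K * y ^ 2 = 99 / 200 * (y ^ 2 / K) := by ring
      rw [h9]
      linarith
    refine le_trans ?_ hlow
    rw [intervalIntegral.integral_add (hI1.const_mul _) ((hI2.const_mul _).add (by simp)),
      intervalIntegral.integral_add (hI2.const_mul _) (by simp),
      intervalIntegral.integral_const_mul, intervalIntegral.integral_const_mul,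
      integral_inner_circle, integral_inner_circle_sq, intervalIntegral.integral_const, ← hK]
    have : 99 / 200 / K * (K ^ 2 / 2) = 99 / 400 * K := by field_simp; norm_num
    rw [this]
    simp only [smul_eq_mul]
    linarith

/-- Comparison of two weighted slices for every linear weight `e^{⟨Q, x⟩}`: it suffices that
`x'` is nearly the contraction of a nearly round curve `x` by a factor `ρ`, and that the weight
drops pointwise by a factor `e^{-(1 - ρ)/100}`. -/
lemma integral_weight_mul_exp_le {x x' : ℝ → E2} {W W' : ℝ → ℝ} {w₀ : ℝ} (hw₀ : 0 < w₀)
    (hxc : Continuous x) (hWc : Continuous W)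
    (hx : ∀ t, ‖x t - circle t‖ ≤ 1 / 100000) (hW : ∀ t, |W t - w₀| ≤ 1 / 100000 * w₀)
    {ρ : ℝ} (hρ : 9 / 10 ≤ ρ) (hρ1 : ρ ≤ 1)
    (hx' : ∀ t, ‖x' t - ρ • x t‖ ≤ 1 / 100000 * (1 - ρ))
    (hW0 : ∀ t, 0 ≤ W' t)
    (hW' : ∀ t, W' t ≤ W t * Real.exp (-(1 - ρ) / 100)) (Q : E2) :
    ∫ t in Set.Icc (0 : ℝ) 1, W' t * Real.exp (inner ℝ Q (x' t)) ≤
      ∫ t in Set.Icc (0 : ℝ) 1, W t * Real.exp (inner ℝ Q (x t)) := by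
  have hWn : ∀ t, |W t / w₀ - 1| ≤ 1 / 100000 := by
    intro t
    have : W t / w₀ - 1 = (W t - w₀) / w₀ := by field_simp
    rw [this, abs_div, abs_of_pos hw₀, div_le_iff₀ hw₀]
    exact hW t
  have hWpos : ∀ t, 0 ≤ W t := fun t => by linarith [(abs_le.1 (hW t)).1]
  have hψ := integral_mul_exp_nonneg hxc (hWc.div_const w₀) hx hWn hρ Q
  rw [intervalIntegral.integral_of_le zero_le_one, ← MeasureTheory.integral_Icc_eq_integral_Ioc]
    at hψ
  set u := 1 - ρ with hu
  have hu0 : 0 ≤ u := by linarith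
  set v : ℝ → ℝ := fun t => inner ℝ Q (x t) - 1 / 100000 * ‖Q‖ + 1 / 100 with hv
  set E := Real.exp (1 / 100000 * ‖Q‖ - 1 / 100) with hE
  have hint : ∀ {f : ℝ → ℝ}, Continuous f → MeasureTheory.IntegrableOn f (Set.Icc 0 1) :=
    fun hf => hf.continuousOn.integrableOn_compact isCompact_Icc
  have hi1 : MeasureTheory.IntegrableOn (fun t => W t * (Real.exp (ρ * v t) * E)) (Set.Icc 0 1) :=
    hint (by simp only [hv]; fun_prop)
  have hi2 : MeasureTheory.IntegrableOn
      (fun t => u * E * w₀ * (W t / w₀ * (Real.exp (ρ * v t) * v t))) (Set.Icc 0 1) :=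
    hint (by simp only [hv]; fun_prop)
  have hi3 : MeasureTheory.IntegrableOn (fun t => W t * Real.exp (inner ℝ Q (x t)))
      (Set.Icc 0 1) := hint (by fun_prop)
  -- absorb the error in `x'` and the drop of the weight into the shifted exponent `v`
  have step1 : ∫ t in Set.Icc (0 : ℝ) 1, W' t * Real.exp (inner ℝ Q (x' t)) ≤
      ∫ t in Set.Icc (0 : ℝ) 1, W t * (Real.exp (ρ * v t) * E) := by
    refine MeasureTheory.integral_mono_of_nonneg
      (Filter.Eventually.of_forall fun t => mul_nonneg (hW0 t) (Real.exp_pos _).le) hi1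
      (Filter.Eventually.of_forall fun t => ?_)
    have h1 : inner ℝ Q (x' t) ≤ ρ * inner ℝ Q (x t) + 1 / 100000 * u * ‖Q‖ := by
      have h2 : inner ℝ Q (x' t - ρ • x t) ≤ ‖Q‖ * (1 / 100000 * u) :=
        (real_inner_le_norm _ _).trans (by gcongr; exact hx' t)
      rw [inner_sub_right, inner_smul_right] at h2
      linarith
    calc W' t * Real.exp (inner ℝ Q (x' t))
        ≤ (W t * Real.exp (-u / 100)) *
          Real.exp (ρ * inner ℝ Q (x t) + 1 / 100000 * u * ‖Q‖) := by
          gcongr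
          exacts [mul_nonneg (hWpos t) (Real.exp_pos _).le, hW' t]
      _ = W t * (Real.exp (ρ * v t) * E) := by
          rw [mul_assoc, ← Real.exp_add, hE, ← Real.exp_add]
          congr 2
          simp only [hv, hu]; ring
  refine step1.trans ?_
  -- the tangent line of `exp` at `ρ v`
  have step2 : ∫ t in Set.Icc (0 : ℝ) 1, (W t * (Real.exp (ρ * v t) * E) +
      u * E * w₀ * (W t / w₀ * (Real.exp (ρ * v t) * v t))) ≤
      ∫ t in Set.Icc (0 : ℝ) 1, W t * Real.exp (inner ℝ Q (x t)) := by
    refine MeasureTheory.integral_mono (hi1.add hi2) hi3 fun t => ?_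
    have h1 : Real.exp (inner ℝ Q (x t)) = Real.exp (ρ * v t) * E * Real.exp (u * v t) := by
      rw [hE, ← Real.exp_add, ← Real.exp_add]
      congr 1
      simp only [hv, hu]; ring
    have h2 := Real.add_one_le_exp (u * v t)
    have h3 : W t * (Real.exp (ρ * v t) * E) + u * E * w₀ * (W t / w₀ * (Real.exp (ρ * v t) * v t))
        = W t * (Real.exp (ρ * v t) * E * (u * v t + 1)) := by
      field_simp
      ring
    simp only [h1, h3]
    have : 0 ≤ Real.exp (ρ * v t) * E := by positivity
    have := hWpos t
    gcongr
  rw [MeasureTheory.integral_add hi1 hi2, MeasureTheory.integral_const_mul] at step2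
  have : 0 ≤ u * E * w₀ * ∫ t in Set.Icc (0 : ℝ) 1, W t / w₀ * (Real.exp (ρ * v t) * v t) :=
    mul_nonneg (by positivity) hψ
  linarith

/-- By symmetry the exponential integral over a centred circle increases with its radius. -/
lemma integral_exp_circle_mono {R R' : ℝ} (hR : 0 ≤ R) (hRR : R ≤ R') (Q : E2) :
    ∫ t in Set.Icc (0 : ℝ) 1, Real.exp (inner ℝ Q (R • circle t)) ≤
      ∫ t in Set.Icc (0 : ℝ) 1, Real.exp (inner ℝ Q (R' • circle t)) := by
  have hcc := contDiff_circle.continuous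
  have hsym : ∀ r : ℝ, ∫ t in Set.Icc (0 : ℝ) 1, Real.exp (inner ℝ Q (r • circle t)) =
      ∫ t in (0 : ℝ)..1, Real.cosh (r * inner ℝ Q (circle t)) := by
    intro r
    have hper : Function.Periodic (fun t => Real.exp (inner ℝ Q (r • circle t))) 1 := by
      intro t; simp only [circle_add_one]
    have hc : Continuous (fun t => Real.exp (inner ℝ Q (r • circle t))) := by fun_prop
    rw [MeasureTheory.integral_Icc_eq_integral_Ioc,
      ← intervalIntegral.integral_of_le zero_le_one]
    have h1 : ∫ t in (0 : ℝ)..1, Real.exp (inner ℝ Q (r • circle t)) =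
        ∫ t in (0 : ℝ)..1, Real.exp (-(r * inner ℝ Q (circle t))) := by
      have h2 := hper.intervalIntegral_add_eq 0 (1 / 2)
      rw [zero_add] at h2
      have h3 := intervalIntegral.integral_comp_add_right (a := 0) (b := 1)
        (fun t => Real.exp (inner ℝ Q (r • circle t))) (1 / 2 : ℝ)
      rw [zero_add, add_comm (1 : ℝ)] at h3
      rw [h2, ← h3]
      refine intervalIntegral.integral_congr fun t _ => ?_
      simp only [circle_add_half, smul_neg, inner_neg_right, inner_smul_right]
    have h4 : ∀ t, Real.cosh (r * inner ℝ Q (circle t)) =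
        1 / 2 * Real.exp (inner ℝ Q (r • circle t)) +
        1 / 2 * Real.exp (-(r * inner ℝ Q (circle t))) := by
      intro t; rw [Real.cosh_eq, inner_smul_right]; ring
    simp only [h4]
    rw [intervalIntegral.integral_add (Continuous.intervalIntegrable (by fun_prop) 0 1)
      (Continuous.intervalIntegrable (by fun_prop) 0 1), intervalIntegral.integral_const_mul,
      intervalIntegral.integral_const_mul, ← h1]
    ring
  rw [hsym, hsym]
  refine intervalIntegral.integral_mono_on zero_le_one
    (Continuous.intervalIntegrable (by fun_prop) 0 1)
    (Continuous.intervalIntegrable (by fun_prop) 0 1) fun t _ => ?_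
  rw [Real.cosh_le_cosh, abs_mul, abs_mul, abs_of_nonneg hR, abs_of_nonneg (hR.trans hRR)]
  gcongr

/-! ### Linearization at the round cylinder -/

/-- The invariants of the round unit cylinder, in the order of the arguments of `meanH`. -/
def cylinderInv : Fin 7 → ℝ := ![1, 0, 0, 0, 0, 1, 0]

/-- `meanH` as a function of the vector of invariants. -/
noncomputable def meanHVec (x : Fin 7 → ℝ) : ℝ := meanH (x 0) (x 1) (x 2) (x 3) (x 4) (x 5) (x 6)

lemma meanHVec_cylinderInv : meanHVec cylinderInv = 1 := by
  simp [meanHVec, meanH, cylinderInv]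

lemma hasStrictFDerivAt_coord (i : Fin 7) (x : Fin 7 → ℝ) :
    HasStrictFDerivAt (fun y : Fin 7 → ℝ => y i)
      (ContinuousLinearMap.proj i : (Fin 7 → ℝ) →L[ℝ] ℝ) x :=
  (ContinuousLinearMap.proj i : (Fin 7 → ℝ) →L[ℝ] ℝ).hasStrictFDerivAt

lemma exists_hasStrictFDerivAt_meanHVec : ∃ L : (Fin 7 → ℝ) →L[ℝ] ℝ,
    HasStrictFDerivAt meanHVec L cylinderInv ∧
      ∀ v, L v = -(3 / 2) * v 0 + v 1 + v 4 + v 5 := by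
  have h := fun i => hasStrictFDerivAt_coord i cylinderInv
  have hD := (h 0).add ((h 6).pow 2)
  have hD0 : cylinderInv 0 + cylinderInv 6 ^ 2 ≠ 0 := by simp [cylinderInv]
  have hden := (hD.sqrt hD0).mul hD
  have hinv := (hasStrictDerivAt_inv (x := √(cylinderInv 0 + cylinderInv 6 ^ 2) *
    (cylinderInv 0 + cylinderInv 6 ^ 2)) (by simp [cylinderInv])).comp_hasStrictFDerivAt
      cylinderInv hden
  have hnum := (((h 0).mul (h 1)).sub (((h 2).const_mul 2).mul (h 3))).add
    (((h 4).const_add 1).mul (h 5))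
  refine ⟨_, hnum.mul hinv, fun v => ?_⟩
  simp [cylinderInv]
  ring

lemma exists_hasStrictFDerivAt_log : ∃ L : (Fin 7 → ℝ) →L[ℝ] ℝ,
    HasStrictFDerivAt (fun x : Fin 7 → ℝ => Real.log (√(x 0 + x 6 ^ 2))) L cylinderInv ∧
      ∀ v, L v = 1 / 2 * v 0 := by
  have h := fun i => hasStrictFDerivAt_coord i cylinderInv
  have hD := (h 0).add ((h 6).pow 2)
  have hD0 : cylinderInv 0 + cylinderInv 6 ^ 2 ≠ 0 := by simp [cylinderInv]
  have hl := (hD.sqrt hD0).log (by simp [cylinderInv])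
  refine ⟨_, hl, fun v => ?_⟩
  simp [cylinderInv]

/-- Strict differentiability in coordinates, with the distance measured by any bound `M` for the
differences of the coordinates. -/
lemma HasStrictFDerivAt.exists_abs_le {f : (Fin 7 → ℝ) → ℝ} {L : (Fin 7 → ℝ) →L[ℝ] ℝ}
    {x₀ : Fin 7 → ℝ} (hf : HasStrictFDerivAt f L x₀) {η : ℝ} (hη : 0 < η) :
    ∃ ζ > 0, ∀ x y : Fin 7 → ℝ, (∀ i, |x i - x₀ i| ≤ ζ) → (∀ i, |y i - x₀ i| ≤ ζ) →
      ∀ M, (∀ i, |x i - y i| ≤ M) → |f x - f y - L (x - y)| ≤ η * M := by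
  have h := hf.isLittleO.bound hη
  obtain ⟨ε, hε, hb⟩ := Metric.eventually_nhds_iff.1 h
  refine ⟨ε / 2, by positivity, fun x y hx hy M hM => ?_⟩
  have hxd : dist x x₀ ≤ ε / 2 := (dist_pi_le_iff (by positivity)).2 hx
  have hyd : dist y x₀ ≤ ε / 2 := (dist_pi_le_iff (by positivity)).2 hy
  have hxy : dist (x, y) (x₀, x₀) < ε := by
    rw [Prod.dist_eq]; exact max_lt (by simpa using by linarith) (by simpa using by linarith)
  have h1 := hb hxy
  have hM0 : 0 ≤ M := (abs_nonneg _).trans (hM 0)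
  have h2 : ‖x - y‖ ≤ M := (pi_norm_le_iff_of_nonneg hM0).2 hM
  simp only [Real.norm_eq_abs] at h1
  exact h1.trans (by gcongr)

/-- First order expansion of the mean curvature and of the logarithm of the area density at the
round cylinder, with a uniformly small relative error. -/
lemma exists_linearization {η : ℝ} (hη : 0 < η) : ∃ ζ > 0, ∀ x y : Fin 7 → ℝ,
    (∀ i, |x i - cylinderInv i| ≤ ζ) → (∀ i, |y i - cylinderInv i| ≤ ζ) →
    ∀ M, (∀ i, |x i - y i| ≤ M) →
    |meanHVec x - meanHVec y - (-(3 / 2) * (x 0 - y 0) + (x 1 - y 1) + (x 4 - y 4) + (x 5 - y 5))|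
      ≤ η * M ∧
    |Real.log (√(x 0 + x 6 ^ 2)) - Real.log (√(y 0 + y 6 ^ 2)) - 1 / 2 * (x 0 - y 0)|
      ≤ η * M := by
  obtain ⟨L, hL, hLv⟩ := exists_hasStrictFDerivAt_meanHVec
  obtain ⟨L', hL', hLv'⟩ := exists_hasStrictFDerivAt_log
  obtain ⟨ζ, hζ, h⟩ := HasStrictFDerivAt.exists_abs_le hL hη
  obtain ⟨ζ', hζ', h'⟩ := HasStrictFDerivAt.exists_abs_le hL' hη
  refine ⟨min ζ ζ', lt_min hζ hζ', fun x y hx hy M hM => ⟨?_, ?_⟩⟩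
  · have := h x y (fun i => (hx i).trans (min_le_left _ _))
      (fun i => (hy i).trans (min_le_left _ _)) M hM
    rwa [hLv] at this
  · have := h' x y (fun i => (hx i).trans (min_le_right _ _))
      (fun i => (hy i).trans (min_le_right _ _)) M hM
    rwa [hLv'] at this

/-! ### Families of nearly round curves -/

/-- The derivatives of `c` at `(s, t)` that enter the geometry of the swept surface, except
`c_θθ`, are `ζ`-close to those of the constant family of unit circles. -/
structure NearRound (ζ : ℝ) (c : ℝ → ℝ → E2) (s t : ℝ) : Prop where
  pos : ‖c s t - circle t‖ ≤ ζ
  ang : ‖dAngle c s t - rot (circle t)‖ ≤ ζ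
  ht : ‖dHeight c s t‖ ≤ ζ
  ht2 : ‖dHeight (dHeight c) s t‖ ≤ ζ
  htAng : ‖dHeight (dAngle c) s t‖ ≤ ζ

/-- The derivatives of `c` and `c'` at `(s, t)` that enter the geometry of the swept surface, except
`c_θθ`, are `ε`-close. -/
structure JetClose (ε : ℝ) (c c' : ℝ → ℝ → E2) (s t : ℝ) : Prop where
  pos : ‖c s t - c' s t‖ ≤ ε
  ang : ‖dAngle c s t - dAngle c' s t‖ ≤ ε
  ht : ‖dHeight c s t - dHeight c' s t‖ ≤ ε
  ht2 : ‖dHeight (dHeight c) s t - dHeight (dHeight c') s t‖ ≤ ε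
  htAng : ‖dHeight (dAngle c) s t - dHeight (dAngle c') s t‖ ≤ ε

/-- The curvature invariant `det (c_θ, c_θθ)` of a family of curves. -/
noncomputable def bendDet (c : ℝ → ℝ → E2) (s t : ℝ) : ℝ :=
  det2 (dAngle c s t) (dAngle (dAngle c) s t)

lemma norm_sub_one_le {v e : E2} {ζ : ℝ} (he : ‖e‖ = 1) (h : ‖v - e‖ ≤ ζ) : |‖v‖ - 1| ≤ ζ := by
  rw [← he]; exact (abs_norm_sub_norm_le v e).trans h

lemma NearRound.norm_pos {ζ : ℝ} {c : ℝ → ℝ → E2} {s t : ℝ} (h : NearRound ζ c s t) :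
    |‖c s t‖ - 1| ≤ ζ := norm_sub_one_le (norm_circle t) h.pos

lemma NearRound.norm_ang {ζ : ℝ} {c : ℝ → ℝ → E2} {s t : ℝ} (h : NearRound ζ c s t) :
    |‖dAngle c s t‖ - 1| ≤ ζ := norm_sub_one_le (by rw [norm_rot, norm_circle]) h.ang

lemma abs_det2_sub_le (a b a' b' : E2) :
    |det2 a b - det2 a' b'| ≤ ‖a - a'‖ * ‖b‖ + ‖a'‖ * ‖b - b'‖ := by
  have : det2 a b - det2 a' b' = det2 (a - a') b + det2 a' (b - b') := by
    simp only [det2_sub_left, det2_sub_right]; ring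
  rw [this]
  exact (abs_add_le _ _).trans (add_le_add (abs_det2_le _ _) (abs_det2_le _ _))

lemma abs_inner_sub_le (a b a' b' : E2) :
    |inner ℝ a b - inner ℝ a' b'| ≤ ‖a - a'‖ * ‖b‖ + ‖a'‖ * ‖b - b'‖ := by
  have : inner ℝ a b - inner ℝ a' b' = inner ℝ (a - a') b + inner ℝ a' (b - b') := by
    simp only [inner_sub_left, inner_sub_right]; ring
  rw [this]
  exact (abs_add_le _ _).trans
    (add_le_add (abs_real_inner_le_norm _ _) (abs_real_inner_le_norm _ _))

lemma abs_norm_sq_sub_le (a a' : E2) : |‖a‖ ^ 2 - ‖a'‖ ^ 2| ≤ ‖a - a'‖ * (‖a‖ + ‖a'‖) := by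
  have : ‖a‖ ^ 2 - ‖a'‖ ^ 2 = (‖a‖ - ‖a'‖) * (‖a‖ + ‖a'‖) := by ring
  rw [this, abs_mul, abs_of_nonneg (by positivity : 0 ≤ ‖a‖ + ‖a'‖)]
  gcongr
  exact abs_norm_sub_norm_le a a'

/-- The mean curvature increases with the curvature of the cross sections. -/
lemma meanH_mono {P a i q Y J J' d : ℝ} (hP : 0 ≤ P) (hY : 0 ≤ Y) (h : J ≤ J') :
    meanH P a i q Y J d ≤ meanH P a i q Y J' d := by
  unfold meanH
  gcongr

/-- Scaling of the mean curvature when the cross section is scaled by `ρ` and the height is not; the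
argument is in the form in which `bentInv` collects the invariants. -/
lemma meanH_smul {ρ : ℝ} (hρ : 0 < ρ) (P A i q Y J d : ℝ) :
    meanH (ρ ^ 2 * P) (ρ * A) (ρ * i) (ρ ^ 2 * q) Y (ρ ^ 2 * J) (ρ * d) =
      ρ⁻¹ * meanH P (ρ * A) i (ρ * q) Y J d := by
  unfold meanH
  have h1 : ρ ^ 2 * P + (ρ * d) ^ 2 = ρ ^ 2 * (P + d ^ 2) := by ring
  rw [h1, Real.sqrt_mul (by positivity), Real.sqrt_sq hρ.le,
    show ρ * √(P + d ^ 2) * (ρ ^ 2 * (P + d ^ 2)) = ρ ^ 3 * (√(P + d ^ 2) * (P + d ^ 2)) by ring,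
    show ρ ^ 2 * P * (ρ * A) - 2 * (ρ * i) * (ρ ^ 2 * q) + (1 + Y) * (ρ ^ 2 * J) =
      ρ ^ 2 * (P * (ρ * A) - 2 * i * (ρ * q) + (1 + Y) * J) by ring]
  field_simp

/-- The invariants of a family of curves, in the order of the arguments of `meanH`. -/
noncomputable def sliceInv (c : ℝ → ℝ → E2) (s t : ℝ) : Fin 7 → ℝ :=
  ![‖dAngle c s t‖ ^ 2, det2 (dAngle c s t) (dHeight (dHeight c) s t),
    inner ℝ (dHeight c s t) (dAngle c s t), det2 (dAngle c s t) (dHeight (dAngle c) s t),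
    ‖dHeight c s t‖ ^ 2, bendDet c s t, det2 (dAngle c s t) (dHeight c s t)]

lemma sliceH_eq (c : ℝ → ℝ → E2) (s t : ℝ) : sliceH c s t = meanHVec (sliceInv c s t) := by
  simp [sliceH, meanHVec, sliceInv, bendDet]

lemma NearRound.abs_sliceInv_sub_le {ζ : ℝ} {c : ℝ → ℝ → E2} {s t : ℝ} (h : NearRound ζ c s t)
    (hζ : ζ ≤ 1) (hJ : |bendDet c s t - 1| ≤ ζ) (i : Fin 7) :
    |sliceInv c s t i - cylinderInv i| ≤ 4 * ζ := by
  have hp := abs_le.1 h.norm_ang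
  have h0 : 0 ≤ ζ := (abs_nonneg _).trans hJ
  have hd : ∀ x : E2, ‖x‖ ≤ ζ → |det2 (dAngle c s t) x| ≤ 4 * ζ := fun x hx =>
    (abs_det2_le _ _).trans (by nlinarith [norm_nonneg x])
  have hv := h.ht
  have hv0 := norm_nonneg (dHeight c s t)
  fin_cases i
  · simp only [sliceInv, cylinderInv, Fin.zero_eta, Matrix.cons_val_zero]
    rw [abs_le]; constructor <;> nlinarith
  · simpa [sliceInv, cylinderInv] using hd _ h.ht2
  · simp only [sliceInv, cylinderInv, Fin.reduceFinMk, Matrix.cons_val, sub_zero]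
    exact (abs_real_inner_le_norm _ _).trans (by nlinarith)
  · simpa [sliceInv, cylinderInv] using hd _ h.htAng
  · simp only [sliceInv, cylinderInv, Fin.reduceFinMk, Matrix.cons_val, sub_zero]
    rw [abs_of_nonneg (by positivity)]; nlinarith
  · simp only [sliceInv, cylinderInv, Fin.reduceFinMk, Matrix.cons_val]
    linarith
  · simpa [sliceInv, cylinderInv] using hd _ h.ht

/-! ### Shrinking the cross sections -/

section bent
variable {U : Set ℝ} {σ : ℝ → ℝ → E2} {ρ ρ' ρ'' : ℝ → ℝ}

lemma dAngle_smul (s t : ℝ) : dAngle (fun s t => ρ s • σ s t) s t = ρ s • dAngle σ s t := by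
  simp only [dAngle]
  rw [show deriv (fun t => ρ s • σ s t) t = ρ s • deriv (σ s) t from
    deriv_const_smul_field (ρ s) (σ s), smul_comm]

lemma bendDet_smul (s t : ℝ) :
    bendDet (fun s t => ρ s • σ s t) s t = ρ s ^ 2 * bendDet σ s t := by
  have h : dAngle (fun s t => ρ s • σ s t) = fun s t => ρ s • dAngle σ s t := by
    ext1 s; ext1 t; exact dAngle_smul s t
  simp only [bendDet, h, dAngle_smul, det2_smul_left, det2_smul_right]
  ring

lemma SmoothStrip.dHeight_smul (hU : IsOpen U) (hσ : SmoothStrip U σ)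
    (hρ : ∀ s ∈ U, HasDerivAt ρ (ρ' s) s) {s : ℝ} (hs : s ∈ U) (t : ℝ) :
    dHeight (fun s t => ρ s • σ s t) s t = ρ' s • σ s t + ρ s • dHeight σ s t := by
  rw [add_comm]
  exact ((hρ s hs).smul (hσ.hasDerivAt_height hU hs t)).deriv

lemma SmoothStrip.dHeight_dHeight_smul (hU : IsOpen U) (hσ : SmoothStrip U σ)
    (hρ : ∀ s ∈ U, HasDerivAt ρ (ρ' s) s) (hρ' : ∀ s ∈ U, HasDerivAt ρ' (ρ'' s) s) {s : ℝ}
    (hs : s ∈ U) (t : ℝ) :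
    dHeight (dHeight (fun s t => ρ s • σ s t)) s t =
      ρ'' s • σ s t + (2 * ρ' s) • dHeight σ s t + ρ s • dHeight (dHeight σ) s t := by
  have h : ∀ s ∈ U, dHeight (fun s t => ρ s • σ s t) s =
      (fun s t => ρ' s • σ s t + ρ s • dHeight σ s t) s := by
    intro s hs; ext1 t; exact hσ.dHeight_smul hU hρ hs t
  rw [dHeight_congr hU h s hs]
  have h1 := (hρ' s hs).smul (hσ.hasDerivAt_height hU hs t)
  have h2 := (hρ s hs).smul ((hσ.smooth_dHeight hU).hasDerivAt_height hU hs t)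
  refine (h1.add h2).deriv.trans ?_
  module

lemma SmoothStrip.dHeight_dAngle_smul (hU : IsOpen U) (hσ : SmoothStrip U σ)
    (hρ : ∀ s ∈ U, HasDerivAt ρ (ρ' s) s) {s : ℝ} (hs : s ∈ U) (t : ℝ) :
    dHeight (dAngle (fun s t => ρ s • σ s t)) s t =
      ρ' s • dAngle σ s t + ρ s • dHeight (dAngle σ) s t := by
  have h : dAngle (fun s t => ρ s • σ s t) = fun s t => ρ s • dAngle σ s t := by
    ext1 s; ext1 t; exact dAngle_smul s t
  rw [h]
  exact (hσ.smooth_dAngle hU).dHeight_smul hU hρ hs t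

/-- The invariants of `ρ σ` after rescaling the cross section to the size of `σ`; `J` is the
curvature invariant. -/
noncomputable def bentInv (ρ ρ₁ ρ₂ : ℝ) (σ : ℝ → ℝ → E2) (J s t : ℝ) : Fin 7 → ℝ :=
  ![‖dAngle σ s t‖ ^ 2,
    ρ * det2 (dAngle σ s t)
      (ρ₂ • σ s t + (2 * ρ₁) • dHeight σ s t + ρ • dHeight (dHeight σ) s t),
    inner ℝ (ρ₁ • σ s t + ρ • dHeight σ s t) (dAngle σ s t),
    ρ * det2 (dAngle σ s t) (dHeight (dAngle σ) s t),
    ‖ρ₁ • σ s t + ρ • dHeight σ s t‖ ^ 2, J,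
    det2 (dAngle σ s t) (ρ₁ • σ s t + ρ • dHeight σ s t)]

lemma SmoothStrip.sliceH_smul (hU : IsOpen U) (hσ : SmoothStrip U σ)
    (hρ : ∀ s ∈ U, HasDerivAt ρ (ρ' s) s) (hρ' : ∀ s ∈ U, HasDerivAt ρ' (ρ'' s) s) {s : ℝ}
    (hs : s ∈ U) (hpos : 0 < ρ s) (t : ℝ) :
    sliceH (fun s t => ρ s • σ s t) s t =
      (ρ s)⁻¹ * meanHVec (bentInv (ρ s) (ρ' s) (ρ'' s) σ (bendDet σ s t) s t) := by
  have h1 := bendDet_smul (ρ := ρ) (σ := σ) s t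
  rw [bendDet] at h1
  rw [sliceH, h1, hσ.dHeight_dHeight_smul hU hρ hρ' hs, hσ.dHeight_dAngle_smul hU hρ hs,
    hσ.dHeight_smul hU hρ hs, dAngle_smul, norm_smul, mul_pow, Real.norm_eq_abs, sq_abs,
    inner_smul_right]
  simp only [det2_smul_left]
  rw [show ρ s * det2 (dAngle σ s t) (ρ' s • dAngle σ s t + ρ s • dHeight (dAngle σ) s t) =
    ρ s ^ 2 * det2 (dAngle σ s t) (dHeight (dAngle σ) s t) by
      rw [det2_add_right, det2_smul_right, det2_smul_right, det2_self]; ring, meanH_smul hpos]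
  simp [meanHVec, bentInv]

lemma SmoothStrip.sliceA_smul (hU : IsOpen U) (hσ : SmoothStrip U σ)
    (hρ : ∀ s ∈ U, HasDerivAt ρ (ρ' s) s) {s : ℝ}
    (hs : s ∈ U) (hpos : 0 < ρ s) (J ρ₂ t : ℝ) :
    sliceA (fun s t => ρ s • σ s t) s t =
      ρ s * √(bentInv (ρ s) (ρ' s) ρ₂ σ J s t 0 + bentInv (ρ s) (ρ' s) ρ₂ σ J s t 6 ^ 2) := by
  rw [sliceA, hσ.dHeight_smul hU hρ hs, dAngle_smul, norm_smul, mul_pow, Real.norm_eq_abs, sq_abs,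
    det2_smul_left, mul_pow, ← mul_add, Real.sqrt_mul (by positivity), Real.sqrt_sq hpos.le]
  simp [bentInv]

end bent

/-- The support function `-det (σ_θ, σ)` of a nearly round curve is nearly `1`. -/
lemma NearRound.abs_support_le {σ : ℝ → ℝ → E2} {s t ζ : ℝ} (hζ : ζ ≤ 1 / 100000)
    (hσ : NearRound ζ σ s t) : |det2 (dAngle σ s t) (σ s t) + 1| ≤ 3 * ζ := by
  have h1 := abs_det2_sub_le (dAngle σ s t) (σ s t) (rot (circle t)) (circle t)
  have h2 : det2 (rot (circle t)) (circle t) = -1 := by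
    have := det2_rot_right (circle t) (circle t)
    rw [real_inner_self_eq_norm_sq, norm_circle] at this
    simp only [det2] at this ⊢; linarith
  rw [h2, norm_rot, norm_circle, sub_neg_eq_add] at h1
  have h3 := hσ.pos
  have h4 := hσ.ang
  have h5 := (abs_le.1 hσ.norm_pos).2
  nlinarith [norm_nonneg (dAngle σ s t - rot (circle t)), norm_nonneg (σ s t)]

lemma mul_le_two_mul {a b ζ : ℝ} (ha : a ≤ 11 / 10) (hb : b ≤ ζ) (hb0 : 0 ≤ b) :
    a * b ≤ 2 * ζ := by nlinarith

/-- Bounds for the scalar products that enter the invariants of a bent family. -/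
lemma NearRound.bounds {σ : ℝ → ℝ → E2} {s t ζ : ℝ} (hζ : ζ ≤ 1 / 100000)
    (hσ : NearRound ζ σ s t) :
    |det2 (dAngle σ s t) (dHeight σ s t)| ≤ 2 * ζ ∧
    |det2 (dAngle σ s t) (dHeight (dHeight σ) s t)| ≤ 2 * ζ ∧
    |det2 (dAngle σ s t) (dHeight (dAngle σ) s t)| ≤ 2 * ζ ∧
    |inner ℝ (dHeight σ s t) (dAngle σ s t)| ≤ 2 * ζ ∧
    |inner ℝ (σ s t) (dAngle σ s t)| ≤ 2 := by
  have hp := (abs_le.1 hσ.norm_ang).2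
  have hx := (abs_le.1 hσ.norm_pos).2
  have hp' : ‖dAngle σ s t‖ ≤ 11 / 10 := by linarith
  refine ⟨(abs_det2_le _ _).trans (mul_le_two_mul hp' hσ.ht (norm_nonneg _)),
    (abs_det2_le _ _).trans (mul_le_two_mul hp' hσ.ht2 (norm_nonneg _)),
    (abs_det2_le _ _).trans (mul_le_two_mul hp' hσ.htAng (norm_nonneg _)),
    (abs_real_inner_le_norm _ _).trans ?_, (abs_real_inner_le_norm _ _).trans ?_⟩
  · rw [mul_comm]; exact mul_le_two_mul hp' hσ.ht (norm_nonneg _)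
  · nlinarith [norm_nonneg (σ s t), norm_nonneg (dAngle σ s t)]

/-- Differences of the scalar products that enter the invariants of two close families. -/
lemma JetClose.bounds {c σ : ℝ → ℝ → E2} {s t ζ ε : ℝ} (hζ : ζ ≤ 1 / 100000)
    (hσ : NearRound ζ σ s t) (hc : NearRound ζ c s t) (hcl : JetClose ε σ c s t) :
    |‖dAngle σ s t‖ ^ 2 - ‖dAngle c s t‖ ^ 2| ≤ 3 * ε ∧
    |det2 (dAngle σ s t) (dHeight σ s t) - det2 (dAngle c s t) (dHeight c s t)| ≤ 2 * ε ∧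
    |det2 (dAngle σ s t) (dHeight (dHeight σ) s t) -
      det2 (dAngle c s t) (dHeight (dHeight c) s t)| ≤ 2 * ε ∧
    |det2 (dAngle σ s t) (dHeight (dAngle σ) s t) -
      det2 (dAngle c s t) (dHeight (dAngle c) s t)| ≤ 2 * ε ∧
    |inner ℝ (dHeight σ s t) (dAngle σ s t) - inner ℝ (dHeight c s t) (dAngle c s t)| ≤ 2 * ε ∧
    |‖dHeight σ s t‖ ^ 2 - ‖dHeight c s t‖ ^ 2| ≤ ε := by
  have hp := (abs_le.1 hσ.norm_ang).2
  have hcp := (abs_le.1 hc.norm_ang).2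
  have hp0 := norm_nonneg (dAngle σ s t)
  have hcp0 := norm_nonneg (dAngle c s t)
  have hε0 : 0 ≤ ε := (norm_nonneg _).trans hcl.pos
  have gen : ∀ a b x y : ℝ, 0 ≤ a → 0 ≤ b → 0 ≤ x → 0 ≤ y → a ≤ ε → b ≤ 1 / 2 → x ≤ 11 / 10 →
      y ≤ ε → a * b + x * y ≤ 2 * ε := fun a b x y _ _ _ _ h1 h2 h3 h4 => by
    have : a * b ≤ ε * (1 / 2) := by gcongr
    have : x * y ≤ 11 / 10 * ε := by gcongr
    linarith
  have hdet : ∀ x y : E2, ‖x‖ ≤ ζ → ‖x - y‖ ≤ ε →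
      |det2 (dAngle σ s t) x - det2 (dAngle c s t) y| ≤ 2 * ε := fun x y hx hxy =>
    (abs_det2_sub_le _ _ _ _).trans (gen _ _ _ _ (norm_nonneg _) (norm_nonneg _) hcp0
      (norm_nonneg _) hcl.ang (by linarith) (by linarith) hxy)
  refine ⟨(abs_norm_sq_sub_le _ _).trans ?_, hdet _ _ hσ.ht hcl.ht, hdet _ _ hσ.ht2 hcl.ht2,
    hdet _ _ hσ.htAng hcl.htAng, ?_, (abs_norm_sq_sub_le _ _).trans ?_⟩
  · calc _ ≤ ε * 3 := by gcongr; exacts [hcl.ang, by linarith]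
      _ = _ := by ring
  · have h1 := abs_inner_sub_le (dAngle σ s t) (dHeight σ s t) (dAngle c s t) (dHeight c s t)
    rw [real_inner_comm, real_inner_comm (dHeight c s t)] at h1
    rw [real_inner_comm, real_inner_comm (dAngle c s t)]
    rw [real_inner_comm, real_inner_comm (dHeight c s t)]
    exact h1.trans (gen _ _ _ _ (norm_nonneg _) (norm_nonneg _) hcp0
      (norm_nonneg _) hcl.ang (by linarith [hσ.ht]) (by linarith) hcl.ht)
  · have h1 := hσ.ht
    have h2 := hc.ht
    calc _ ≤ ε * 1 := by gcongr; exacts [hcl.ht, by linarith]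
      _ = _ := by ring

lemma bentInv_one (u u₁ u₂ : ℝ) (σ : ℝ → ℝ → E2) (J s t : ℝ) :
    bentInv (1 - u) (-u₁) (-u₂) σ J s t 1 =
      (1 - u) ^ 2 * det2 (dAngle σ s t) (dHeight (dHeight σ) s t) -
        2 * (1 - u) * u₁ * det2 (dAngle σ s t) (dHeight σ s t) -
        (1 - u) * u₂ * det2 (dAngle σ s t) (σ s t) := by
  simp only [bentInv, Matrix.cons_val, det2_add_right, det2_smul_right]; ring

lemma bentInv_two (u u₁ u₂ : ℝ) (σ : ℝ → ℝ → E2) (J s t : ℝ) :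
    bentInv (1 - u) (-u₁) (-u₂) σ J s t 2 =
      (1 - u) * inner ℝ (dHeight σ s t) (dAngle σ s t) -
        u₁ * inner ℝ (σ s t) (dAngle σ s t) := by
  simp [bentInv, inner_add_left, inner_smul_left]; ring

lemma bentInv_six (u u₁ u₂ : ℝ) (σ : ℝ → ℝ → E2) (J s t : ℝ) :
    bentInv (1 - u) (-u₁) (-u₂) σ J s t 6 =
      (1 - u) * det2 (dAngle σ s t) (dHeight σ s t) - u₁ * det2 (dAngle σ s t) (σ s t) := by
  simp only [bentInv, Matrix.cons_val, det2_add_right, det2_smul_right]; ring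

section estimates
variable {c σ : ℝ → ℝ → E2} {s t ζ ε u u₁ u₂ J : ℝ}

lemma norm_bent_le (hζ : ζ ≤ 1 / 100000) (hσ : NearRound ζ σ s t)
    (hu : 0 ≤ u) (hu' : u ≤ 1 / 10) (hu₁ : 0 ≤ u₁) (hu₁ζ : u₁ ≤ ζ) :
    ‖(-u₁) • σ s t + (1 - u) • dHeight σ s t‖ ≤ 5 / 2 * ζ := by
  have hx := (abs_le.1 hσ.norm_pos).2
  have hσ1 := hσ.ht
  refine (norm_add_le _ _).trans ?_
  rw [norm_smul, norm_smul, norm_neg, Real.norm_of_nonneg hu₁, Real.norm_of_nonneg (by linarith)]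
  have h1 : u₁ * ‖σ s t‖ ≤ ζ * (11 / 10) := by gcongr; exacts [hu₁.trans hu₁ζ, by linarith]
  have h2 : (1 - u) * ‖dHeight σ s t‖ ≤ 1 * ζ := by gcongr; linarith
  linarith

lemma abs_norm_bent_sq_sub_le (hζ : ζ ≤ 1 / 100000) (hσ : NearRound ζ σ s t)
    (hu : 0 ≤ u) (hu' : u ≤ 1 / 10) (hu₁ : 0 ≤ u₁) (hu₁ζ : u₁ ≤ ζ) :
    |‖(-u₁) • σ s t + (1 - u) • dHeight σ s t‖ ^ 2 - ‖dHeight σ s t‖ ^ 2| ≤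
      1 / 20000 * (u + u₁) := by
  refine (abs_norm_sq_sub_le _ _).trans ?_
  have hx := (abs_le.1 hσ.norm_pos).2
  have hσ1 := hσ.ht
  have n1 : ‖(-u₁) • σ s t + (1 - u) • dHeight σ s t - dHeight σ s t‖ ≤
      11 / 10 * (u + u₁) := by
    have : (-u₁) • σ s t + (1 - u) • dHeight σ s t - dHeight σ s t =
        (-u₁) • σ s t + (-u) • dHeight σ s t := by module
    rw [this]
    refine (norm_add_le _ _).trans ?_
    rw [norm_smul, norm_smul, norm_neg, norm_neg, Real.norm_of_nonneg hu, Real.norm_of_nonneg hu₁]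
    have h1 : u₁ * ‖σ s t‖ ≤ u₁ * (11 / 10) := by gcongr; linarith
    have h2 : u * ‖dHeight σ s t‖ ≤ u * (11 / 10) := by gcongr; linarith
    linarith
  have n2 := norm_bent_le hζ hσ hu hu' hu₁ hu₁ζ
  calc _ ≤ (11 / 10 * (u + u₁)) * (1 / 25000) := by gcongr; linarith
    _ ≤ _ := by linarith

/-- The support term `-(1 - u) u₂ det (σ_θ, σ)` in the second invariant is about `u₂`. -/
lemma support_term_bounds (hζ : ζ ≤ 1 / 100000) (hσ : NearRound ζ σ s t)
    (hu : 0 ≤ u) (hu' : u ≤ 1 / 10) (hu₂ : 0 ≤ u₂) :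
    4 / 5 * u₂ ≤ -((1 - u) * u₂ * det2 (dAngle σ s t) (σ s t)) ∧
      -((1 - u) * u₂ * det2 (dAngle σ s t) (σ s t)) ≤ 2 * u₂ := by
  have hs1 := abs_le.1 (hσ.abs_support_le hζ)
  have h1 : 0 ≤ (1 - u) * u₂ := mul_nonneg (by linarith) hu₂
  have h2 : 9 / 10 * u₂ ≤ (1 - u) * u₂ := by gcongr; linarith
  have h3 : (1 - u) * u₂ ≤ 1 * u₂ := by gcongr; linarith
  have h4 : 9 / 10 ≤ -det2 (dAngle σ s t) (σ s t) := by linarith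
  have h5 : -det2 (dAngle σ s t) (σ s t) ≤ 2 := by linarith
  constructor
  · have := mul_le_mul h2 h4 (by norm_num) h1
    linarith
  · have := mul_le_mul h3 h5 (by linarith) (by linarith)
    linarith

lemma abs_mul_le_of {a A D B : ℝ} (ha : |a| ≤ A) (hD : |D| ≤ B) : |a * D| ≤ A * B := by
  rw [abs_mul]; exact mul_le_mul ha hD (abs_nonneg _) ((abs_nonneg _).trans ha)

lemma bentInv_near (hζ : ζ ≤ 1 / 100000) (hσ : NearRound ζ σ s t)
    (hJ : |J - 1| ≤ 2 * ζ)
    (hu : 0 ≤ u) (hu' : u ≤ 1 / 10) (hu₁ : 0 ≤ u₁) (hu₂ : 0 ≤ u₂) (hu₁ζ : u₁ ≤ ζ) (hu₂ζ : u₂ ≤ ζ)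
    (i : Fin 7) : |bentInv (1 - u) (-u₁) (-u₂) σ J s t i - cylinderInv i| ≤ 10 * ζ := by
  have hp := abs_le.1 hσ.norm_ang
  obtain ⟨d1, d2, d3, i1, i0⟩ := hσ.bounds hζ
  have hζ0 : 0 ≤ ζ := hu₁.trans hu₁ζ
  have hs2 := support_term_bounds hζ hσ hu hu' hu₂
  have hs1 := abs_le.1 (hσ.abs_support_le hζ)
  have hρ : |1 - u| ≤ 1 := by rw [abs_le]; constructor <;> linarith
  have hu₁a : |u₁| ≤ ζ := by rwa [abs_of_nonneg hu₁]
  fin_cases i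
  · simp only [bentInv, cylinderInv, Fin.zero_eta, Matrix.cons_val_zero]
    rw [abs_le]; constructor <;> nlinarith [norm_nonneg (dAngle σ s t)]
  · simp only [Fin.mk_one, bentInv_one]
    simp only [cylinderInv, Matrix.cons_val, sub_zero]
    have h1 := abs_le.1 (abs_mul_le_of (abs_mul_le_of hρ hρ) d2)
    have h2 := abs_le.1 (abs_mul_le_of (abs_mul_le_of hρ hu₁a) d1)
    have h3 : ζ * (2 * ζ) ≤ ζ := by nlinarith
    rw [abs_le]; constructor <;> linarith
  · simp only [Fin.reduceFinMk, bentInv_two]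
    simp only [cylinderInv, Matrix.cons_val, sub_zero]
    have h1 := abs_le.1 (abs_mul_le_of hρ i1)
    have h2 := abs_le.1 (abs_mul_le_of hu₁a i0)
    rw [abs_le]; constructor <;> linarith
  · simp only [bentInv, cylinderInv, Fin.reduceFinMk, Matrix.cons_val, sub_zero]
    have h1 := abs_mul_le_of hρ d3
    linarith
  · simp only [bentInv, cylinderInv, Fin.reduceFinMk, Matrix.cons_val, sub_zero]
    have h1 := norm_bent_le hζ hσ hu hu' hu₁ hu₁ζ
    rw [abs_of_nonneg (by positivity)]
    calc _ ≤ (5 / 2 * ζ) ^ 2 := by gcongr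
      _ ≤ _ := by nlinarith
  · simp only [bentInv, cylinderInv, Fin.reduceFinMk, Matrix.cons_val]
    linarith
  · simp only [Fin.reduceFinMk, bentInv_six]
    simp only [cylinderInv, Matrix.cons_val, sub_zero]
    have h1 := abs_le.1 (abs_mul_le_of hρ d1)
    have h2 : |det2 (dAngle σ s t) (σ s t)| ≤ 2 := by rw [abs_le]; constructor <;> linarith
    have h3 := abs_le.1 (abs_mul_le_of hu₁a h2)
    rw [abs_le]; constructor <;> linarith

/-- Closeness of the rescaled invariants of the bent family `(1 - u) σ` to those of `c`; the second
estimate keeps the sign of the second derivative `-u₂` of the bending factor. -/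
lemma bentInv_sub_bounds (hζ : ζ ≤ 1 / 100000) (hσ : NearRound ζ σ s t) (hc : NearRound ζ c s t)
    (hcl : JetClose ε σ c s t) (hJ : |J - bendDet c s t| ≤ ε)
    (hu : 0 ≤ u) (hu' : u ≤ 1 / 10) (hu₁ : 0 ≤ u₁) (hu₂ : 0 ≤ u₂) (hu₁ζ : u₁ ≤ ζ)
    (hu₁' : u₁ ≤ u + u₂) :
    (∀ i, |bentInv (1 - u) (-u₁) (-u₂) σ J s t i - sliceInv c s t i| ≤ 10 * (ε + u + u₂)) ∧
    -(10 * ε) - u / 1000 + u₂ / 2 ≤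
      -(3 / 2) * (bentInv (1 - u) (-u₁) (-u₂) σ J s t 0 - sliceInv c s t 0) +
        (bentInv (1 - u) (-u₁) (-u₂) σ J s t 1 - sliceInv c s t 1) +
        (bentInv (1 - u) (-u₁) (-u₂) σ J s t 4 - sliceInv c s t 4) +
        (bentInv (1 - u) (-u₁) (-u₂) σ J s t 5 - sliceInv c s t 5) := by
  have hε0 : 0 ≤ ε := (abs_nonneg _).trans hJ
  have hζ0 : 0 ≤ ζ := hu₁.trans hu₁ζ
  obtain ⟨d1', d2', d3', i1', i0⟩ := hσ.bounds hζ
  obtain ⟨e0, d1, d2, d3, i1, y1⟩ := hcl.bounds hζ hσ hc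
  have hs1 := abs_le.1 (hσ.abs_support_le hζ)
  have hs2 := support_term_bounds hζ hσ hu hu' hu₂
  have hY' := abs_le.1 (abs_norm_bent_sq_sub_le hζ hσ hu hu' hu₁ hu₁ζ)
  have e0' := abs_le.1 e0
  have y1' := abs_le.1 y1
  have hJ' := abs_le.1 hJ
  have d1a := abs_le.1 d1
  have d2a := abs_le.1 d2
  have d3a := abs_le.1 d3
  have i1a := abs_le.1 i1
  have hua : |u| ≤ u := (abs_of_nonneg hu).le
  have hu₁a : |u₁| ≤ u₁ := (abs_of_nonneg hu₁).le
  have hρ : |1 - u| ≤ 1 := by rw [abs_le]; constructor <;> linarith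
  have hz : ∀ {D : ℝ}, |D| ≤ 2 * ζ → |D| ≤ 1 / 50000 := fun h => by linarith
  have h2 : |det2 (dAngle σ s t) (σ s t)| ≤ 2 := by rw [abs_le]; constructor <;> linarith
  have r2 : |((1 - u) ^ 2 - 1) * det2 (dAngle σ s t) (dHeight (dHeight σ) s t)| ≤
      (2 * u) * (1 / 50000) := by
    refine abs_mul_le_of ?_ (hz d2')
    rw [abs_le]; constructor <;> nlinarith
  have r2' := abs_le.1 r2
  have r1 := abs_le.1 (abs_mul_le_of (abs_mul_le_of hρ hu₁a) (hz d1'))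
  have hI' := abs_le.1 (abs_mul_le_of hu₁a i0)
  have hE' := abs_le.1 (abs_mul_le_of hu₁a h2)
  have t1 := abs_le.1 (abs_mul_le_of hua (hz d1'))
  have t3 := abs_le.1 (abs_mul_le_of hua (hz d3'))
  have ti := abs_le.1 (abs_mul_le_of hua (hz i1'))
  refine ⟨fun i => ?_, ?_⟩
  · fin_cases i
    · simp only [bentInv, sliceInv, Fin.zero_eta, Matrix.cons_val_zero]
      linarith only [e0, hε0, hu, hu₂]
    · simp only [Fin.mk_one, bentInv_one]
      simp only [sliceInv, Matrix.cons_val]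
      rw [abs_le]
      constructor <;> linarith only [r2', r1, d2a, hs2, hε0, hu, hu₂, hu₁']
    · simp only [Fin.reduceFinMk, bentInv_two]
      simp only [sliceInv, Matrix.cons_val]
      rw [abs_le]; constructor <;> linarith only [i1a, ti, hI', hε0, hu, hu₂, hu₁']
    · simp only [bentInv, sliceInv, Fin.reduceFinMk, Matrix.cons_val]
      rw [abs_le]; constructor <;> linarith only [d3a, t3, hε0, hu, hu₂]
    · simp only [bentInv, sliceInv, Fin.reduceFinMk, Matrix.cons_val]
      rw [abs_le]; constructor <;> linarith only [hY', y1', hε0, hu, hu₂, hu₁']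
    · simp only [bentInv, sliceInv, Fin.reduceFinMk, Matrix.cons_val]
      linarith only [hJ, hε0, hu, hu₂]
    · simp only [Fin.reduceFinMk, bentInv_six]
      simp only [sliceInv, Matrix.cons_val]
      rw [abs_le]; constructor <;> linarith only [d1a, t1, hE', hε0, hu, hu₂, hu₁']
  · rw [bentInv_one]
    simp only [bentInv, sliceInv, Matrix.cons_val]
    linarith only [e0', r2', r1, d2a, hs2, hY', y1', hJ', hε0, hu, hu₂, hu₁']

end estimates

/-! ### Comparison of the weights -/

/-- The weight of the round unit cylinder, for which `H = 1`. -/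
noncomputable def roundWeight (β r₀ : ℝ) : ℝ := 2 * Real.pi * Real.exp (-β - r₀)

lemma roundWeight_pos (β r₀ : ℝ) : 0 < roundWeight β r₀ := by
  unfold roundWeight; positivity

lemma NearRound.mono {ζ ζ' : ℝ} {c : ℝ → ℝ → E2} {s t : ℝ} (h : NearRound ζ c s t)
    (hζ : ζ ≤ ζ') : NearRound ζ' c s t :=
  ⟨h.pos.trans hζ, h.ang.trans hζ, h.ht.trans hζ, h.ht2.trans hζ, h.htAng.trans hζ⟩

/-- The weight of a nearly round family is nearly that of the round cylinder. -/
lemma exists_abs_weight_sub_le : ∃ ζ > 0, ζ ≤ 1 / 100000 ∧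
    ∀ (c : ℝ → ℝ → E2) (s t β r₀ : ℝ), 0 ≤ β → β ≤ 1 → 0 ≤ r₀ → r₀ ≤ 1 → NearRound ζ c s t →
      |bendDet c s t - 1| ≤ ζ →
      |weight β r₀ c s t - roundWeight β r₀| ≤ 1 / 100000 * roundWeight β r₀ := by
  obtain ⟨ζ₁, hζ₁, hlin⟩ := exists_linearization (η := 1) one_pos
  refine ⟨min (1 / 10000000) (ζ₁ / 4), lt_min (by norm_num) (by positivity),
    (min_le_left _ _).trans (by norm_num), fun c s t β r₀ hβ hβ1 hr hr1 hc hJ => ?_⟩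
  have hz1 : min (1 / 10000000) (ζ₁ / 4) ≤ 1 / 10000000 := min_le_left _ _
  have hz2 : min (1 / 10000000) (ζ₁ / 4) ≤ ζ₁ / 4 := min_le_right _ _
  set ζ := min (1 / 10000000) (ζ₁ / 4)
  have hY := hc.abs_sliceInv_sub_le (by linarith) hJ
  obtain ⟨h1, h2⟩ := hlin (sliceInv c s t) cylinderInv (fun i => (hY i).trans (by linarith))
    (fun i => by simpa using hζ₁.le) (4 * ζ) hY
  rw [meanHVec_cylinderInv, ← sliceH_eq] at h1
  have hlog1 : Real.log √(cylinderInv 0 + cylinderInv 6 ^ 2) = 0 := by simp [cylinderInv]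
  rw [hlog1] at h2
  have hA : sliceA c s t = √(sliceInv c s t 0 + sliceInv c s t 6 ^ 2) := by
    simp [sliceA, sliceInv]
  rw [← hA] at h2
  have hApos : 0 < sliceA c s t := by
    rw [hA]
    apply Real.sqrt_pos.2
    have := (abs_le.1 (hY 0)).1
    simp only [cylinderInv, Matrix.cons_val_zero] at this
    nlinarith [sq_nonneg (sliceInv c s t 6)]
  have h1' := abs_le.1 h1
  have h2' := abs_le.1 h2
  have y0 := abs_le.1 (hY 0)
  have y1 := abs_le.1 (hY 1)
  have y4 := abs_le.1 (hY 4)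
  have y5 := abs_le.1 (hY 5)
  have hx := abs_le.1 hc.norm_pos
  have hx2 : |‖c s t‖ ^ 2 - 1| ≤ 3 * ζ := by
    rw [abs_le]; constructor <;> nlinarith [norm_nonneg (c s t)]
  have hx3 := abs_le.1 (abs_mul_le_of (abs_of_nonneg hβ).le hx2)
  have hH : |sliceH c s t - 1| ≤ 22 * ζ := by
    rw [abs_le]; constructor <;> linarith
  have hH' := abs_le.1 (abs_mul_le_of (abs_of_nonneg hr).le hH)
  have hζ0 : 0 ≤ ζ := (abs_nonneg _).trans hJ
  set E := -β * (‖c s t‖ ^ 2 - 1) - r₀ * (sliceH c s t - 1) + Real.log (sliceA c s t) with hE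
  have hEb : |E| ≤ 40 * ζ := by
    have a1 : β * (3 * ζ) ≤ 1 * (3 * ζ) := by gcongr
    have a2 : r₀ * (22 * ζ) ≤ 1 * (22 * ζ) := by gcongr
    rw [abs_le]; constructor <;> linarith
  have hw : weight β r₀ c s t = roundWeight β r₀ * Real.exp E := by
    rw [weight, roundWeight, mul_assoc (2 * Real.pi), ← Real.exp_add,
      show -β - r₀ + E = (-β * ‖c s t‖ ^ 2 - r₀ * sliceH c s t) + Real.log (sliceA c s t) by
        rw [hE]; ring, Real.exp_add, Real.exp_log hApos]
    ring
  have hexp := Real.abs_exp_sub_one_le (x := E) (by linarith)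
  rw [hw, show roundWeight β r₀ * Real.exp E - roundWeight β r₀ =
    roundWeight β r₀ * (Real.exp E - 1) by ring, abs_mul, abs_of_pos (roundWeight_pos β r₀),
    mul_comm]
  exact mul_le_mul_of_nonneg_right (by linarith) (roundWeight_pos β r₀).le

lemma meanHVec_bentInv_mono (ρ ρ₁ ρ₂ : ℝ) (σ : ℝ → ℝ → E2) {J J' : ℝ} (s t : ℝ) (h : J ≤ J') :
    meanHVec (bentInv ρ ρ₁ ρ₂ σ J s t) ≤ meanHVec (bentInv ρ ρ₁ ρ₂ σ J' s t) := by
  simp only [meanHVec, bentInv, Matrix.cons_val]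
  exact meanH_mono (by positivity) (by positivity) h

/-- The Gaussian weight grows under the contraction by at most about `2 β u ≤ 9 u / 10`. -/
lemma gauss_loss_le {c σ : ℝ → ℝ → E2} {s t ζ ε ρ u β : ℝ} (hζ : ζ ≤ 1 / 100000)
    (hσ : NearRound ζ σ s t) (hc : NearRound ζ c s t) (hcl : ‖σ s t - c s t‖ ≤ ε)
    (hρ : ρ = 1 - u) (hu : 0 ≤ u) (hβ : 0 ≤ β) (hβ1 : β ≤ 9 / 20) :
    β * (‖c s t‖ ^ 2 - ‖ρ • σ s t‖ ^ 2) ≤ 9 / 20 * (201 / 100 * u + 3 * ε) := by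
  have hε : 0 ≤ ε := (norm_nonneg _).trans hcl
  have n1 := abs_le.1 hc.norm_pos
  have n2 := abs_le.1 hσ.norm_pos
  have n4 := abs_le.1 (abs_norm_sq_sub_le (σ s t) (c s t))
  have n5 : ‖σ s t - c s t‖ * (‖σ s t‖ + ‖c s t‖) ≤ ε * 3 := by gcongr; linarith
  have n6 : ‖σ s t‖ ^ 2 ≤ (1001 / 1000) ^ 2 := by gcongr; linarith
  have n7 : ‖c s t‖ ^ 2 - ‖ρ • σ s t‖ ^ 2 ≤ 201 / 100 * u + 3 * ε := by
    rw [norm_smul, mul_pow, Real.norm_eq_abs, sq_abs, hρ]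
    have h1 : (1 - (1 - u) ^ 2) * ‖σ s t‖ ^ 2 ≤ (2 * u) * (1001 / 1000) ^ 2 := by
      gcongr; nlinarith
    linarith
  calc _ ≤ β * (201 / 100 * u + 3 * ε) := by gcongr
    _ ≤ _ := by gcongr

set_option maxHeartbeats 1000000 in
/-- Shrinking the cross sections by a factor `1 - u` with `u₁ = u'` and `u₂ = u''` small and
nonnegative lowers the weight by a factor `e^{-u/100}`. The area gains `-u`, the Gaussian loses at
most `2 β u ≤ 9 u / 10`, and the mean curvature grows by about `u₂`, which absorbs every error of
the order of `u₁` and `u₂`. The curvature of the sections is needed only from below. -/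
lemma exists_weight_smul_le : ∃ ζ > 0, ζ ≤ 1 / 100000 ∧
    ∀ (U : Set ℝ) (c σ : ℝ → ℝ → E2) (ρ u u₁ u₂ : ℝ → ℝ) (s t β r₀ ε : ℝ), IsOpen U →
      SmoothStrip U σ → s ∈ U → (∀ s ∈ U, ρ s = 1 - u s) →
      (∀ s ∈ U, HasDerivAt u (u₁ s) s) → (∀ s ∈ U, HasDerivAt u₁ (u₂ s) s) →
      NearRound ζ σ s t → NearRound ζ c s t → |bendDet c s t - 1| ≤ ζ →
      JetClose ε σ c s t → bendDet c s t - ε ≤ bendDet σ s t →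
      0 ≤ u s → u s ≤ 1 / 10 → 0 ≤ u₁ s → 0 ≤ u₂ s → u₁ s ≤ ζ → u₂ s ≤ ζ →
      u₁ s ≤ u s + u₂ s → ε ≤ ζ → ε ≤ u s / 100000 →
      0 ≤ β → β ≤ 9 / 20 → 1 / 1000 ≤ r₀ → r₀ ≤ 1 →
      weight β r₀ (fun s t => ρ s • σ s t) s t ≤ weight β r₀ c s t * Real.exp (-u s / 100) := by
  obtain ⟨ζ₁, hζ₁, hlin⟩ := exists_linearization (η := 1 / 1000000) (by norm_num)
  refine ⟨min (1 / 100000) (ζ₁ / 10), lt_min (by norm_num) (by positivity), min_le_left _ _,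
    fun U c σ ρ u u₁ u₂ s t β r₀ ε hU hσs hs hρ hd1 hd2 hσ hc hJc hcl hJσ hu hu' hu1 hu2 hu1ζ
      hu2ζ hu12 hεζ hεu hβ hβ1 hr hr1 => ?_⟩
  have hz1 : min (1 / 100000) (ζ₁ / 10) ≤ 1 / 100000 := min_le_left _ _
  have hz2 : min (1 / 100000) (ζ₁ / 10) ≤ ζ₁ / 10 := min_le_right _ _
  generalize min (1 / 100000) (ζ₁ / 10) = ζ at *
  have hζ0 : 0 ≤ ζ := (abs_nonneg _).trans hJc
  have hε0 : 0 ≤ ε := (norm_nonneg _).trans hcl.pos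
  have hρ' : ∀ s ∈ U, HasDerivAt ρ (-u₁ s) s := by
    intro s hs
    have h1 := (hd1 s hs).const_sub 1
    refine h1.congr_of_eventuallyEq ?_
    filter_upwards [hU.mem_nhds hs] with s' hs' using hρ s' hs'
  have hρ'' : ∀ s ∈ U, HasDerivAt (fun s => -u₁ s) (-u₂ s) s := fun s hs => (hd2 s hs).neg
  have hρs := hρ s hs
  have hρpos : 0 < ρ s := by linarith
  -- the curvature of the section may be replaced by a value close to that of `c`
  obtain ⟨J, hJdef⟩ : ∃ J, J = bendDet c s t - ε := ⟨_, rfl⟩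
  obtain ⟨X, hX⟩ : ∃ X, X = bentInv (1 - u s) (-u₁ s) (-u₂ s) σ J s t := ⟨_, rfl⟩
  have hJabs := abs_le.1 hJc
  have hXn : ∀ i, |X i - cylinderInv i| ≤ 10 * ζ := hX ▸
    bentInv_near hz1 hσ (by rw [abs_le]; constructor <;> linarith) hu hu' hu1 hu2 hu1ζ hu2ζ
  obtain ⟨hXd, hXL⟩ := bentInv_sub_bounds (J := J) hz1 hσ hc hcl
    (by rw [hJdef, sub_sub_cancel_left, abs_neg, abs_of_nonneg hε0]) hu hu' hu1 hu2 hu1ζ hu12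
  rw [← hX] at hXd hXL
  have hYn := hc.abs_sliceInv_sub_le (by linarith) hJc
  obtain ⟨h1, h2⟩ := hlin X (sliceInv c s t) (fun i => (hXn i).trans (by linarith))
    (fun i => (hYn i).trans (by linarith)) _ hXd
  obtain ⟨h3, -⟩ := hlin X cylinderInv (fun i => (hXn i).trans (by linarith))
    (fun i => by simpa using hζ₁.le) _ hXn
  rw [meanHVec_cylinderInv] at h3
  have hHX : 0 ≤ meanHVec X := by
    have x0 := abs_le.1 (hXn 0)
    have x1 := abs_le.1 (hXn 1)
    have x4 := abs_le.1 (hXn 4)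
    have x5 := abs_le.1 (hXn 5)
    have := (abs_le.1 h3).1
    linarith only [this, x0, x1, x4, x5, hz1]
  have hH : meanHVec X ≤ sliceH (fun s t => ρ s • σ s t) s t := by
    rw [hσs.sliceH_smul hU hρ' hρ'' hs hρpos]
    have hm : meanHVec X ≤ meanHVec (bentInv (ρ s) (-u₁ s) (-u₂ s) σ (bendDet σ s t) s t) := by
      rw [hX, ← hρs]
      exact meanHVec_bentInv_mono _ _ _ _ s t (hJdef ▸ hJσ)
    have h4 : 1 ≤ (ρ s)⁻¹ := (one_le_inv₀ hρpos).2 (by linarith)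
    calc meanHVec X ≤ (ρ s)⁻¹ * meanHVec X := le_mul_of_one_le_left hHX h4
      _ ≤ _ := by gcongr
  have hXpos : 0 < √(X 0 + X 6 ^ 2) := by
    apply Real.sqrt_pos.2
    have := (abs_le.1 (hXn 0)).1
    simp only [cylinderInv, Matrix.cons_val_zero] at this
    nlinarith [sq_nonneg (X 6)]
  have hYpos : 0 < √(sliceInv c s t 0 + sliceInv c s t 6 ^ 2) := by
    apply Real.sqrt_pos.2
    have := (abs_le.1 (hYn 0)).1
    simp only [cylinderInv, Matrix.cons_val_zero] at this
    nlinarith [sq_nonneg (sliceInv c s t 6)]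
  have hA : sliceA c s t = √(sliceInv c s t 0 + sliceInv c s t 6 ^ 2) := by
    simp [sliceA, sliceInv]
  have hA' : sliceA (fun s t => ρ s • σ s t) s t = ρ s * √(X 0 + X 6 ^ 2) := by
    rw [hσs.sliceA_smul hU hρ' hs hρpos J (-u₂ s), hX, ← hρs]
  have hlogρ : Real.log (ρ s) ≤ -u s := by
    have := Real.log_le_sub_one_of_pos hρpos; linarith
  have hgauss := gauss_loss_le (ρ := ρ s) hz1 hσ hc hcl.pos hρs hu hβ hβ1
  have hexp : -β * ‖ρ s • σ s t‖ ^ 2 - r₀ * sliceH (fun s t => ρ s • σ s t) s t +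
      (Real.log (ρ s) + Real.log √(X 0 + X 6 ^ 2)) ≤
      -β * ‖c s t‖ ^ 2 - r₀ * sliceH c s t + Real.log (sliceA c s t) + -u s / 100 := by
    rw [← sliceH_eq] at h1
    rw [← hA] at h2
    have h1' := (abs_le.1 h1).1
    have h2' := (abs_le.1 h2).2
    have x0 := abs_le.1 (hXd 0)
    have hX0 : X 0 - sliceInv c s t 0 ≤ 3 * ε := by
      rw [hX]
      simp only [bentInv, sliceInv, Matrix.cons_val_zero]
      exact (abs_le.1 (hcl.bounds hz1 hσ hc).1).2
    -- the gain `r₀ u₂ / 2` from the second derivative dominates the error in the area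
    have hgain : -(11 * ε) - u s / 500 + 2 / 5 * u₂ s ≤
        sliceH (fun s t => ρ s • σ s t) s t - sliceH c s t := by
      linarith only [hH, h1', hXL, hu, hu2, hε0]
    have hr' : -(11 * ε) - u s / 500 + 1 / 1000 * (2 / 5 * u₂ s) ≤
        r₀ * (sliceH (fun s t => ρ s • σ s t) s t - sliceH c s t) := by
      have h5 : r₀ * (-(11 * ε) - u s / 500 + 2 / 5 * u₂ s) ≤
          r₀ * (sliceH (fun s t => ρ s • σ s t) s t - sliceH c s t) := by gcongr
      have h6 : r₀ * (11 * ε + u s / 500) ≤ 1 * (11 * ε + u s / 500) := by gcongr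
      have h7 : 1 / 1000 * (2 / 5 * u₂ s) ≤ r₀ * (2 / 5 * u₂ s) := by gcongr
      linarith only [h5, h6, h7]
    linarith only [hr', hgauss, hlogρ, h2', hX0, hεu, hu, hu2, hε0]
  calc weight β r₀ (fun s t => ρ s • σ s t) s t
      = 2 * Real.pi * Real.exp (-β * ‖ρ s • σ s t‖ ^ 2 -
          r₀ * sliceH (fun s t => ρ s • σ s t) s t +
            (Real.log (ρ s) + Real.log √(X 0 + X 6 ^ 2))) := by
        rw [weight, hA', Real.exp_add, Real.exp_add (Real.log _), Real.exp_log hρpos,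
          Real.exp_log hXpos]
        ring
    _ ≤ 2 * Real.pi * Real.exp (-β * ‖c s t‖ ^ 2 - r₀ * sliceH c s t +
          Real.log (sliceA c s t) + -u s / 100) := by gcongr
    _ = weight β r₀ c s t * Real.exp (-u s / 100) := by
        rw [weight, Real.exp_add, Real.exp_add, Real.exp_log (hA ▸ hYpos)]
        ring

/-! ### The bending factor -/

/-- The defect `1 - bend Λ s` of the bending factor, for `s > 0`. -/
noncomputable def gap (Λ s : ℝ) : ℝ := Real.exp (-(4 * Λ) / s)

/-- The first derivative of `gap`, for `s > 0`. -/
noncomputable def gap₁ (Λ s : ℝ) : ℝ := 4 * Λ / s ^ 2 * gap Λ s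

/-- The second derivative of `gap`, for `s > 0`. -/
noncomputable def gap₂ (Λ s : ℝ) : ℝ := ((4 * Λ / s ^ 2) ^ 2 - 8 * Λ / s ^ 3) * gap Λ s

lemma bend_eq (Λ s : ℝ) : bend Λ s = 1 - gap Λ s := rfl

lemma gap_pos (Λ s : ℝ) : 0 < gap Λ s := Real.exp_pos _

section gap
variable {Λ s : ℝ}

lemma hasDerivAt_gap (hs : 0 < s) : HasDerivAt (gap Λ) (gap₁ Λ s) s := by
  have h : HasDerivAt (fun s => -(4 * Λ) / s) (4 * Λ / s ^ 2) s := by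
    have := (hasDerivAt_const s (-(4 * Λ))).div (hasDerivAt_id s) hs.ne'
    refine this.congr_deriv ?_
    simp only [id]; ring
  refine h.exp.congr_deriv ?_
  rw [gap₁, gap]; ring

lemma hasDerivAt_gap₁ (hs : 0 < s) : HasDerivAt (gap₁ Λ) (gap₂ Λ s) s := by
  have h : HasDerivAt (fun s => 4 * Λ / s ^ 2) (-(8 * Λ) / s ^ 3) s := by
    have := (hasDerivAt_const s (4 * Λ)).div (hasDerivAt_pow 2 s) (by positivity)
    refine this.congr_deriv ?_
    field_simp
    ring
  refine (h.mul (hasDerivAt_gap hs)).congr_deriv ?_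
  rw [gap₂, gap₁]; ring

lemma gap₁_nonneg (hΛ : 0 < Λ) : 0 ≤ gap₁ Λ s := by
  have := gap_pos Λ s
  unfold gap₁; positivity

lemma gap₂_eq (hΛ : 0 < Λ) (hs : 0 < s) :
    gap₂ Λ s = (4 * Λ / s ^ 2) ^ 2 * (1 - s / (2 * Λ)) * gap Λ s := by
  unfold gap₂; field_simp; ring

lemma gap₂_nonneg (hΛ : 0 < Λ) (hs : 0 < s) (h : s ≤ 2 * Λ) : 0 ≤ gap₂ Λ s := by
  rw [gap₂_eq hΛ hs]
  have h1 : s / (2 * Λ) ≤ 1 := (div_le_one (by positivity)).2 h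
  have h2 : 0 ≤ 1 - s / (2 * Λ) := by linarith
  have := gap_pos Λ s
  positivity

/-- From `x ≤ 1 + x² / 2` for the logarithmic derivative `x` of `gap`; for `s ≤ Λ` the second derivative
is at least `x² / 2` times `gap`. -/
lemma gap₁_le_add (hΛ : 0 < Λ) (hs : 0 < s) (h : s ≤ Λ) : gap₁ Λ s ≤ gap Λ s + gap₂ Λ s := by
  rw [gap₂_eq hΛ hs, gap₁]
  have h1 : s / (2 * Λ) ≤ 1 / 2 := by rw [div_le_div_iff₀ (by positivity) two_pos]; linarith
  have := gap_pos Λ s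
  have h2 : 4 * Λ / s ^ 2 ≤ 1 + (4 * Λ / s ^ 2) ^ 2 * (1 - s / (2 * Λ)) := by
    have : (4 * Λ / s ^ 2) ^ 2 * (1 / 2) ≤ (4 * Λ / s ^ 2) ^ 2 * (1 - s / (2 * Λ)) := by
      gcongr; linarith
    nlinarith [sq_nonneg (4 * Λ / s ^ 2 - 1)]
  nlinarith

/-- From `z ^ n / n! ≤ e ^ z`. It makes the derivatives of `gap` small uniformly in the height. -/
lemma pow_mul_gap_le (hΛ : 0 < Λ) (hs : 0 < s) (n : ℕ) :
    (4 * Λ / s) ^ n * gap Λ s ≤ n.factorial := by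
  have h := Real.pow_div_factorial_le_exp (4 * Λ / s) (by positivity) n
  have hg : gap Λ s = (Real.exp (4 * Λ / s))⁻¹ := by rw [gap, neg_div, Real.exp_neg]
  rw [div_le_iff₀ (by positivity)] at h
  rw [hg, ← div_eq_mul_inv, div_le_iff₀ (Real.exp_pos _)]
  linarith

lemma gap₁_le (hΛ : 0 < Λ) (hs : 0 < s) : gap₁ Λ s ≤ 1 / Λ := by
  have h := pow_mul_gap_le hΛ hs 2
  have : gap₁ Λ s = (4 * Λ / s) ^ 2 * gap Λ s / (4 * Λ) := by
    unfold gap₁; field_simp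
  rw [this, div_le_div_iff₀ (by positivity) hΛ]
  norm_num [Nat.factorial] at h ⊢
  nlinarith

lemma gap₂_le (hΛ : 0 < Λ) (hs : 0 < s) : gap₂ Λ s ≤ 2 / Λ ^ 2 := by
  have h := pow_mul_gap_le hΛ hs 4
  have h1 : gap₂ Λ s ≤ (4 * Λ / s ^ 2) ^ 2 * gap Λ s := by
    have := gap_pos Λ s
    unfold gap₂
    gcongr
    have : 0 ≤ 8 * Λ / s ^ 3 := by positivity
    linarith
  have h2 : (4 * Λ / s ^ 2) ^ 2 * gap Λ s = (4 * Λ / s) ^ 4 * gap Λ s / (16 * Λ ^ 2) := by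
    field_simp; ring
  rw [h2] at h1
  refine h1.trans ?_
  rw [div_le_div_iff₀ (by positivity) (by positivity)]
  norm_num [Nat.factorial] at h ⊢
  have := sq_nonneg Λ
  nlinarith

lemma gap_mono (hΛ : 0 < Λ) (hs : 0 < s) {s' : ℝ} (h : s ≤ s') : gap Λ s ≤ gap Λ s' := by
  unfold gap
  apply Real.exp_le_exp.2
  rw [neg_div, neg_div]
  have : 4 * Λ / s' ≤ 4 * Λ / s := by gcongr
  linarith

lemma gap_self (hΛ : 0 < Λ) : gap Λ Λ = Real.exp (-4) := by
  unfold gap; congr 1; field_simp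

lemma gap_quarter (hΛ : 0 < Λ) : gap Λ (Λ / 4) = Real.exp (-16) := by
  unfold gap; congr 1; field_simp; norm_num

end gap

lemma exp_neg_four_bounds : 1 / 60 ≤ Real.exp (-4) ∧ Real.exp (-4) ≤ 1 / 50 := by
  have h1 := Real.exp_one_gt_d9
  have h2 := Real.exp_one_lt_d9
  have h3 : Real.exp 4 = Real.exp 1 ^ 4 := by rw [← Real.exp_nat_mul]; norm_num
  have h4 : Real.exp 1 ^ 4 ≤ (2.72 : ℝ) ^ 4 := by gcongr; linarith
  have h5 : (2.7 : ℝ) ^ 4 ≤ Real.exp 1 ^ 4 := by gcongr; linarith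
  rw [Real.exp_neg, h3]
  constructor
  · rw [one_div]; apply inv_anti₀ (by positivity); norm_num at h4 ⊢; linarith
  · rw [one_div]; apply inv_anti₀ (by norm_num); norm_num at h5 ⊢; linarith

lemma contDiffOn_bend (Λ : ℝ) : ContDiffOn ℝ ∞ (bend Λ) (Set.Ioi 0) := by
  unfold bend
  have : ∀ s ∈ Set.Ioi (0 : ℝ), s ≠ 0 := fun s hs => ne_of_gt hs
  exact contDiffOn_const.sub (Real.contDiff_exp.comp_contDiffOn
    (contDiffOn_const.div contDiffOn_id this))

/-! ### Rotationally symmetric caps -/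

section cap
variable {U : Set ℝ} {R R₁ R₂ : ℝ → ℝ} {s : ℝ}

lemma smoothStrip_circle (U : Set ℝ) : SmoothStrip U (fun _ t => circle t) :=
  (contDiff_circle.comp contDiff_snd).contDiffOn

lemma dAngle_circle (s t : ℝ) : dAngle (fun _ t => circle t) s t = rot (circle t) := by
  rw [dAngle, (hasDerivAt_circle t).deriv, inv_smul_smul₀ two_pi_ne_zero]

lemma dHeight_const (f : ℝ → E2) (s t : ℝ) : dHeight (fun _ t => f t) s t = 0 := by
  simp [dHeight]

lemma dHeight_dHeight_const (f : ℝ → E2) (s t : ℝ) :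
    dHeight (dHeight (fun _ t => f t)) s t = 0 := by
  have : dHeight (fun _ t => f t) = fun _ _ => 0 := by ext1; ext1; exact dHeight_const _ _ _
  rw [this]; exact dHeight_const (fun _ => 0) s t

lemma dHeight_dAngle_const (f : ℝ → E2) (s t : ℝ) :
    dHeight (dAngle (fun _ t => f t)) s t = 0 :=
  dHeight_const (fun t => (2 * Real.pi)⁻¹ • deriv f t) s t

lemma bendDet_circle (s t : ℝ) : bendDet (fun _ t => circle t) s t = 1 := by
  have h : dAngle (fun _ t => circle t) = fun _ t => rot (circle t) := by
    ext1 s; ext1 t; exact dAngle_circle s t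
  rw [bendDet, h, dAngle, (hasDerivAt_rot_circle t).deriv, smul_neg,
    inv_smul_smul₀ two_pi_ne_zero]
  have := norm_sq_eq (circle t)
  rw [norm_circle] at this
  simp [det2, rot]
  linarith

lemma bentInv_circle (ρ ρ₁ ρ₂ s t : ℝ) :
    bentInv ρ ρ₁ ρ₂ (fun _ t => circle t) 1 s t =
      ![1, ρ * -ρ₂, 0, 0, ρ₁ ^ 2, 1, -ρ₁] := by
  have h1 : det2 (rot (circle t)) (circle t) = -1 := by
    have := norm_sq_eq (circle t)
    rw [norm_circle] at this
    simp [det2, rot]; linarith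
  have h2 : inner ℝ (circle t) (rot (circle t)) = 0 := by
    rw [inner_eq]; simp [rot]; ring
  rw [bentInv]
  simp only [dAngle_circle, dHeight_const, dHeight_dHeight_const, dHeight_dAngle_const, norm_rot,
    norm_circle, smul_zero, add_zero, det2_smul_right, h1, inner_smul_left, h2, norm_smul, mul_pow,
    Real.norm_eq_abs, sq_abs]
  simp [det2]

/-- A concave cap of revolution has `H ≥ 1 / A`, where `A` is its area density, so its weight is
controlled by `A` and the radius alone. -/
lemma weight_cap_le (hU : IsOpen U) (hs : s ∈ U) (h1 : ∀ s ∈ U, HasDerivAt R (R₁ s) s)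
    (h2 : ∀ s ∈ U, HasDerivAt R₁ (R₂ s) s) (hR : 0 < R s) (hR1 : R s ≤ 1) (hR2 : R₂ s ≤ 0)
    (hA : R s * √(1 + R₁ s ^ 2) - 1 + 9 / 20 * (1 - R s ^ 2) ≤ -(1 / 1000)) {β r₀ : ℝ}
    (hβ : β ≤ 9 / 20) (hr : 0 ≤ r₀) (t : ℝ) :
    weight β r₀ (fun s t => R s • circle t) s t ≤ roundWeight β r₀ * Real.exp (-1 / 1000) := by
  have hsm := smoothStrip_circle U
  have hHeq := hsm.sliceH_smul hU h1 h2 hs hR t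
  have hAeq := hsm.sliceA_smul hU h1 hs hR 1 (R₂ s) t
  rw [bendDet_circle] at hHeq
  rw [bentInv_circle] at hHeq hAeq
  simp only [Matrix.cons_val, meanHVec, meanH, neg_sq] at hHeq hAeq
  have hR12 : R s ^ 2 ≤ 1 := by nlinarith
  set A := R s * √(1 + R₁ s ^ 2) with hAdef
  have hsq : 0 < √(1 + R₁ s ^ 2) := by positivity
  have hApos : 0 < A := by positivity
  have hA1 : A ≤ 1 := by linarith
  have hH : 1 ≤ sliceH (fun s t => R s • circle t) s t := by
    have h3 : 1 ≤ A⁻¹ := (one_le_inv₀ hApos).2 hA1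
    have h4 : (1 + R₁ s ^ 2) / (√(1 + R₁ s ^ 2) * (1 + R₁ s ^ 2)) = (√(1 + R₁ s ^ 2))⁻¹ := by
      field_simp
    have h5 : A⁻¹ = (R s)⁻¹ * ((1 + R₁ s ^ 2) / (√(1 + R₁ s ^ 2) * (1 + R₁ s ^ 2))) := by
      rw [h4, hAdef, mul_inv]
    rw [hHeq]
    refine h3.trans (h5.le.trans ?_)
    have h6 : 0 ≤ R s * -R₂ s := mul_nonneg hR.le (by linarith)
    refine mul_le_mul_of_nonneg_left (div_le_div_of_nonneg_right ?_ (by positivity))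
      (by positivity)
    linarith
  have hrH : r₀ ≤ r₀ * sliceH (fun s t => R s • circle t) s t := le_mul_of_one_le_right hr hH
  have hnorm : ‖R s • circle t‖ ^ 2 = R s ^ 2 := by
    rw [norm_smul, norm_circle, mul_one, Real.norm_eq_abs, sq_abs]
  have hAe : A ≤ Real.exp (A - 1) := by linarith [Real.add_one_le_exp (A - 1)]
  have hβR : β * (1 - R s ^ 2) ≤ 9 / 20 * (1 - R s ^ 2) := by gcongr
  rw [weight, hAeq, hnorm, roundWeight, mul_assoc (2 * Real.pi), ← Real.exp_add,
    mul_left_comm]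
  gcongr
  calc _ ≤ Real.exp (-β * R s ^ 2 - r₀ * sliceH (fun s t => R s • circle t) s t) *
        Real.exp (A - 1) := by gcongr
    _ = Real.exp (-β * R s ^ 2 - r₀ * sliceH (fun s t => R s • circle t) s t + (A - 1)) :=
        (Real.exp_add _ _).symm
    _ ≤ _ := Real.exp_le_exp.2 (by linarith)

end cap

/-! ### The profile of the tip -/

lemma quarterRoot_pow_four {Λ : ℝ} (hΛ : 0 ≤ Λ) : quarterRoot Λ ^ 4 = Λ := by
  rw [quarterRoot, ← Real.rpow_natCast, ← Real.rpow_mul hΛ]; norm_num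

lemma capConst_bounds {Λ : ℝ} (h : 1000 ≤ quarterRoot Λ) :
    9 / 10 ≤ capConst Λ ∧ capConst Λ ≤ 985 / 1000 := by
  obtain ⟨h1, h2⟩ := exp_neg_four_bounds
  have h3 : (quarterRoot Λ)⁻¹ ≤ 1 / 1000 := by
    rw [one_div]; exact inv_anti₀ (by norm_num) h
  have h4 : 0 ≤ (quarterRoot Λ)⁻¹ := by positivity
  have h5 : (1 - Real.exp (-4)) ^ 2 ≤ 1 := by nlinarith
  have h6 : 0 ≤ 1 / 3 * (1 - Real.exp (-4)) ^ 2 * (quarterRoot Λ)⁻¹ := by positivity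
  have h7 : 1 / 3 * (1 - Real.exp (-4)) ^ 2 * (quarterRoot Λ)⁻¹ ≤ 1 / 3 * 1 * (1 / 1000) := by
    gcongr
  unfold capConst
  constructor <;> linarith

/-- The derivative of `tipProfile`, below the tip. -/
noncomputable def tipProfile₁ (Λ s : ℝ) : ℝ :=
  -(capConst Λ ^ 3 / 2) / ((capConst Λ + tipHeight Λ - s) ^ 2 * tipProfile Λ s)

/-- The second derivative of `tipProfile`, below the tip. -/
noncomputable def tipProfile₂ (Λ s : ℝ) : ℝ :=
  -(capConst Λ ^ 3 / 2) * (2 * (capConst Λ + tipHeight Λ - s) * tipProfile Λ s -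
      (capConst Λ + tipHeight Λ - s) ^ 2 * tipProfile₁ Λ s) /
    ((capConst Λ + tipHeight Λ - s) ^ 2 * tipProfile Λ s) ^ 2

section tip
variable {Λ s : ℝ}

/-- Away from the tip, by a distance large compared with `a`, the profile is nearly the constant `a`. -/
lemma tipProfile_sq (ha : 0 < capConst Λ) (hs : s < tipHeight Λ) :
    tipProfile Λ s ^ 2 = capConst Λ ^ 2 * (1 - capConst Λ / (capConst Λ + tipHeight Λ - s)) := by
  have hq : 0 < capConst Λ + tipHeight Λ - s := by linarith
  have : 0 ≤ (tipHeight Λ - s) / (capConst Λ + tipHeight Λ - s) :=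
    div_nonneg (by linarith) hq.le
  rw [tipProfile, mul_pow, Real.sq_sqrt this]
  field_simp
  ring

lemma tipProfile_pos (ha : 0 < capConst Λ) (hs : s < tipHeight Λ) : 0 < tipProfile Λ s := by
  have hq : 0 < capConst Λ + tipHeight Λ - s := by linarith
  have : 0 < (tipHeight Λ - s) / (capConst Λ + tipHeight Λ - s) := div_pos (by linarith) hq
  unfold tipProfile; positivity

lemma hasDerivAt_tipProfile (ha : 0 < capConst Λ) (hs : s < tipHeight Λ) :
    HasDerivAt (tipProfile Λ) (tipProfile₁ Λ s) s := by
  have hq : 0 < capConst Λ + tipHeight Λ - s := by linarith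
  have hpos : 0 < (tipHeight Λ - s) / (capConst Λ + tipHeight Λ - s) := div_pos (by linarith) hq
  have h1 : HasDerivAt (fun s => (tipHeight Λ - s) / (capConst Λ + tipHeight Λ - s))
      (-capConst Λ / (capConst Λ + tipHeight Λ - s) ^ 2) s := by
    have := ((hasDerivAt_id s).const_sub (tipHeight Λ)).div
      ((hasDerivAt_id s).const_sub (capConst Λ + tipHeight Λ)) hq.ne'
    refine this.congr_deriv ?_
    simp only [id]
    congr 1
    ring
  refine ((h1.sqrt hpos.ne').const_mul (capConst Λ)).congr_deriv ?_
  rw [tipProfile₁, tipProfile]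
  have : 0 < √((tipHeight Λ - s) / (capConst Λ + tipHeight Λ - s)) := Real.sqrt_pos.2 hpos
  field_simp

lemma hasDerivAt_tipProfile₁ (ha : 0 < capConst Λ) (hs : s < tipHeight Λ) :
    HasDerivAt (tipProfile₁ Λ) (tipProfile₂ Λ s) s := by
  have hq : 0 < capConst Λ + tipHeight Λ - s := by linarith
  have hg := tipProfile_pos ha hs
  have h1 := (((hasDerivAt_id s).const_sub (capConst Λ + tipHeight Λ)).pow 2).mul
    (hasDerivAt_tipProfile ha hs)
  have h2 := (hasDerivAt_const s (-(capConst Λ ^ 3 / 2))).div h1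
    (by simp only [Pi.mul_apply, Pi.pow_apply, id]; positivity)
  refine h2.congr_deriv ?_
  rw [tipProfile₂]
  simp
  ring

lemma tipProfile₁_nonpos (ha : 0 < capConst Λ) (hs : s < tipHeight Λ) : tipProfile₁ Λ s ≤ 0 := by
  have hg := tipProfile_pos ha hs
  unfold tipProfile₁
  apply div_nonpos_of_nonpos_of_nonneg
  · have : 0 < capConst Λ ^ 3 := by positivity
    linarith
  · positivity

lemma tipProfile₂_nonpos (ha : 0 < capConst Λ) (hs : s < tipHeight Λ) : tipProfile₂ Λ s ≤ 0 := by
  have hg := tipProfile_pos ha hs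
  have hg1 := tipProfile₁_nonpos ha hs
  have hq : 0 < capConst Λ + tipHeight Λ - s := by linarith
  unfold tipProfile₂
  apply div_nonpos_of_nonpos_of_nonneg _ (by positivity)
  apply mul_nonpos_of_nonpos_of_nonneg
  · have : 0 < capConst Λ ^ 3 := by positivity
    linarith
  · have : 0 ≤ (capConst Λ + tipHeight Λ - s) ^ 2 * -tipProfile₁ Λ s :=
      mul_nonneg (by positivity) (by linarith)
    have : 0 ≤ 2 * (capConst Λ + tipHeight Λ - s) * tipProfile Λ s := by positivity
    linarith

lemma contDiffOn_tipProfile (ha : 0 < capConst Λ) :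
    ContDiffOn ℝ ∞ (tipProfile Λ) (Set.Iio (tipHeight Λ)) := by
  unfold tipProfile
  refine contDiffOn_const.mul (ContDiffOn.sqrt ?_ ?_)
  · refine ContDiffOn.div (by fun_prop) (by fun_prop) fun s hs => ?_
    have : s < tipHeight Λ := hs
    linarith
  · intro s hs
    have : s < tipHeight Λ := hs
    exact (div_pos (by linarith) (by linarith)).ne'

/-- The area density of the tip is at most `a (1 - w / 2)` and its radius is `a √(1 - w)`, where
`w = a / (a + b - s)` ranges over `(0, 1)`. -/
lemma tip_estimate (ha : 9 / 10 ≤ capConst Λ) (ha' : capConst Λ ≤ 985 / 1000)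
    (hs : s < tipHeight Λ) :
    tipProfile Λ s * √(1 + tipProfile₁ Λ s ^ 2) - 1 + 9 / 20 * (1 - tipProfile Λ s ^ 2) ≤
      -(1 / 1000) := by
  have ha0 : 0 < capConst Λ := by linarith
  have hq : 0 < capConst Λ + tipHeight Λ - s := by linarith
  have hg := tipProfile_pos ha0 hs
  have hsq := tipProfile_sq ha0 hs
  set a := capConst Λ with ha_def
  set g := tipProfile Λ s with hg_def
  obtain ⟨w, hw⟩ : ∃ w, w = a / (a + tipHeight Λ - s) := ⟨_, rfl⟩
  have hw0 : 0 ≤ w := by rw [hw]; positivity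
  have hw1 : w ≤ 1 := by rw [hw, div_le_one hq]; linarith
  rw [← hw] at hsq
  have hgg : (g * tipProfile₁ Λ s) ^ 2 = a ^ 2 * w ^ 4 / 4 := by
    have : g * tipProfile₁ Λ s = -(a * w ^ 2 / 2) := by
      rw [hw, tipProfile₁, ← ha_def, ← hg_def]; field_simp
    rw [this]; ring
  have hA : g * √(1 + tipProfile₁ Λ s ^ 2) ≤ a * (1 - w / 2) := by
    refine (sq_le_sq₀ (by positivity) (mul_nonneg ha0.le (by linarith))).1 ?_
    rw [mul_pow, Real.sq_sqrt (by positivity), mul_add, mul_one, ← mul_pow, hgg, hsq]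
    have h4 : w ^ 4 ≤ w ^ 2 := pow_le_pow_of_le_one hw0 hw1 (by norm_num)
    nlinarith [mul_le_mul_of_nonneg_left h4 (sq_nonneg a)]
  rw [hsq]
  have h5 : w * (-a / 2 + 9 / 20 * a ^ 2) ≤ 0 :=
    mul_nonpos_of_nonneg_of_nonpos hw0 (by nlinarith)
  nlinarith

end tip

/-! ### The smoothed minimum of the two profiles -/

section smoothedAbs
variable {Φ : ℝ → ℝ}

lemma IsSmoothedAbs.self_le (hΦ : IsSmoothedAbs Φ) (z : ℝ) : z ≤ Φ z := by
  rcases le_or_gt (1 / 100) |z| with h | h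
  · rw [hΦ.eq_abs z h]; exact le_abs_self z
  · have hz := abs_lt.1 h
    have h1 : 0 < 1 - z := by linarith
    have h2 := hΦ.convex.2 (Set.mem_univ z) (Set.mem_univ (1 : ℝ))
      (show 0 ≤ (99 / 100) / (1 - z) by positivity)
      (show 0 ≤ (1 / 100 - z) / (1 - z) from div_nonneg (by linarith) h1.le)
      (by field_simp; ring)
    have h3 : (99 / 100) / (1 - z) * z + (1 / 100 - z) / (1 - z) * 1 = 1 / 100 := by
      field_simp; ring
    simp only [smul_eq_mul] at h2
    rw [h3, hΦ.eq_abs _ (by norm_num), hΦ.eq_abs 1 (by norm_num), abs_one,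
      abs_of_pos (by norm_num : (0 : ℝ) < 1 / 100), mul_one] at h2
    have h4 : (99 / 100) / (1 - z) * z ≤ (99 / 100) / (1 - z) * Φ z := by linarith
    exact le_of_mul_le_mul_left h4 (by positivity)

lemma IsSmoothedAbs.neg_le (hΦ : IsSmoothedAbs Φ) (z : ℝ) : -z ≤ Φ z := hΦ.even z ▸ hΦ.self_le (-z)

lemma IsSmoothedAbs.le_abs_add (hΦ : IsSmoothedAbs Φ) (z : ℝ) : Φ z ≤ |z| + 1 / 100 := by
  rcases le_or_gt (1 / 100) |z| with h | h
  · rw [hΦ.eq_abs z h]; linarith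
  · have hz := abs_lt.1 h
    have := hΦ.convex.le_max_of_mem_Icc (Set.mem_univ (-(1 / 100))) (Set.mem_univ (1 / 100))
      (Set.mem_Icc.2 ⟨hz.1.le, hz.2.le⟩)
    rw [hΦ.even, max_self, hΦ.eq_abs (1 / 100) (by norm_num),
      abs_of_pos (by norm_num : (0 : ℝ) < 1 / 100)] at this
    linarith [abs_nonneg z]

lemma IsSmoothedAbs.differentiable (hΦ : IsSmoothedAbs Φ) : Differentiable ℝ Φ :=
  hΦ.smooth.differentiable (by simp)

lemma IsSmoothedAbs.contDiff_deriv (hΦ : IsSmoothedAbs Φ) : ContDiff ℝ ∞ (deriv Φ) :=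
  ((contDiff_infty_iff_deriv (𝕜 := ℝ)).1 hΦ.smooth).2

lemma IsSmoothedAbs.abs_deriv_le (hΦ : IsSmoothedAbs Φ) (z : ℝ) : |deriv Φ z| ≤ 1 := by
  have ha := le_abs_self z
  have ha' := neg_abs_le z
  have h0 := abs_nonneg z
  rw [abs_le]
  constructor
  · have h := hΦ.convex.slope_le_deriv (Set.mem_univ (-(|z| + 1))) (Set.mem_univ z) (by linarith)
      (hΦ.differentiable z)
    refine le_trans ?_ h
    rw [slope_def_field, hΦ.even, hΦ.eq_abs (|z| + 1) (by rw [abs_of_nonneg] <;> linarith),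
      abs_of_nonneg (by linarith : 0 ≤ |z| + 1), le_div_iff₀ (by linarith)]
    linarith [hΦ.neg_le z]
  · have h := hΦ.convex.deriv_le_slope (Set.mem_univ z) (Set.mem_univ (|z| + 1)) (by linarith)
      (hΦ.differentiable z)
    refine h.trans ?_
    rw [slope_def_field, hΦ.eq_abs (|z| + 1) (by rw [abs_of_nonneg] <;> linarith),
      abs_of_nonneg (by linarith : 0 ≤ |z| + 1), div_le_iff₀ (by linarith)]
    linarith [hΦ.self_le z]

lemma IsSmoothedAbs.deriv_deriv_nonneg (hΦ : IsSmoothedAbs Φ) (z : ℝ) : 0 ≤ deriv (deriv Φ) z := by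
  have h : Monotone (deriv Φ) := monotoneOn_univ.1
    (hΦ.convex.monotoneOn_deriv fun x _ => hΦ.differentiable x)
  exact h.deriv_nonneg

end smoothedAbs

/-- The radius of the cap below the tip, as a function of the height. -/
noncomputable def junctionRadius (Φ : ℝ → ℝ) (Λ s : ℝ) : ℝ :=
  1 / 2 * (bend Λ s + tipProfile Λ s
    - (quarterRoot Λ)⁻¹ * Φ (quarterRoot Λ * (bend Λ s - tipProfile Λ s)))

/-- The derivative of `junctionRadius`. -/
noncomputable def junctionRadius₁ (Φ : ℝ → ℝ) (Λ s : ℝ) : ℝ :=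
  1 / 2 * (-gap₁ Λ s + tipProfile₁ Λ s -
    deriv Φ (quarterRoot Λ * (bend Λ s - tipProfile Λ s)) * (-gap₁ Λ s - tipProfile₁ Λ s))

/-- The second derivative of `junctionRadius`. -/
noncomputable def junctionRadius₂ (Φ : ℝ → ℝ) (Λ s : ℝ) : ℝ :=
  1 / 2 * (-gap₂ Λ s + tipProfile₂ Λ s -
    (deriv (deriv Φ) (quarterRoot Λ * (bend Λ s - tipProfile Λ s)) *
      (quarterRoot Λ * (-gap₁ Λ s - tipProfile₁ Λ s)) * (-gap₁ Λ s - tipProfile₁ Λ s) +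
    deriv Φ (quarterRoot Λ * (bend Λ s - tipProfile Λ s)) * (-gap₂ Λ s - tipProfile₂ Λ s)))

section junction
variable {Φ : ℝ → ℝ} {Λ s : ℝ}

lemma hasDerivAt_bend (hs : 0 < s) : HasDerivAt (bend Λ) (-gap₁ Λ s) s :=
  (hasDerivAt_gap hs).const_sub 1

lemma hasDerivAt_junctionRadius (hΦ : IsSmoothedAbs Φ) (hl : 0 < quarterRoot Λ)
    (ha : 0 < capConst Λ) (hs0 : 0 < s) (hs : s < tipHeight Λ) :
    HasDerivAt (junctionRadius Φ Λ) (junctionRadius₁ Φ Λ s) s := by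
  have h1 := hasDerivAt_bend (Λ := Λ) hs0
  have h2 := hasDerivAt_tipProfile ha hs
  have h3 := (hΦ.differentiable _).hasDerivAt.comp s ((h1.sub h2).const_mul (quarterRoot Λ))
  refine ((((h1.add h2).sub (h3.const_mul (quarterRoot Λ)⁻¹))).const_mul (1 / 2)).congr_deriv ?_
  rw [junctionRadius₁]
  simp only [Pi.sub_apply]
  field_simp

lemma hasDerivAt_junctionRadius₁ (hΦ : IsSmoothedAbs Φ)
    (ha : 0 < capConst Λ) (hs0 : 0 < s) (hs : s < tipHeight Λ) :
    HasDerivAt (junctionRadius₁ Φ Λ) (junctionRadius₂ Φ Λ s) s := by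
  have h1 := hasDerivAt_bend (Λ := Λ) hs0
  have h2 := hasDerivAt_tipProfile ha hs
  have h4 := (hasDerivAt_gap₁ (Λ := Λ) hs0).neg
  have h5 := hasDerivAt_tipProfile₁ ha hs
  have h3 := (hΦ.contDiff_deriv.differentiable (by simp) _).hasDerivAt.comp s
    ((h1.sub h2).const_mul (quarterRoot Λ))
  exact ((((h4.add h5).sub (h3.mul (h4.sub h5)))).const_mul (1 / 2))

/-- The smoothed minimum of two concave functions is concave. -/
lemma junctionRadius₂_nonpos (hΦ : IsSmoothedAbs Φ) (hl : 0 < quarterRoot Λ)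
    (hΛ : 0 < Λ) (ha : 0 < capConst Λ) (hs0 : 0 < s) (hs : s < tipHeight Λ) (hs2 : s ≤ 2 * Λ) :
    junctionRadius₂ Φ Λ s ≤ 0 := by
  have h1 := gap₂_nonneg hΛ hs0 hs2
  have h2 := tipProfile₂_nonpos ha hs
  have h3 := hΦ.deriv_deriv_nonneg (quarterRoot Λ * (bend Λ s - tipProfile Λ s))
  have h4 := abs_le.1 (hΦ.abs_deriv_le (quarterRoot Λ * (bend Λ s - tipProfile Λ s)))
  unfold junctionRadius₂
  set D := deriv Φ (quarterRoot Λ * (bend Λ s - tipProfile Λ s))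
  set D2 := deriv (deriv Φ) (quarterRoot Λ * (bend Λ s - tipProfile Λ s))
  have h5 : 0 ≤ D2 * (quarterRoot Λ * (-gap₁ Λ s - tipProfile₁ Λ s)) *
      (-gap₁ Λ s - tipProfile₁ Λ s) := by
    rw [show D2 * (quarterRoot Λ * (-gap₁ Λ s - tipProfile₁ Λ s)) *
      (-gap₁ Λ s - tipProfile₁ Λ s) = D2 * quarterRoot Λ * (-gap₁ Λ s - tipProfile₁ Λ s) ^ 2 by
        ring]
    positivity
  nlinarith [mul_nonneg h1 (by linarith : 0 ≤ 1 - D),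
    mul_nonneg (neg_nonneg.2 h2) (by linarith : 0 ≤ 1 + D)]

lemma abs_junctionRadius₁_le (hΦ : IsSmoothedAbs Φ) :
    |junctionRadius₁ Φ Λ s| ≤ |gap₁ Λ s| + |tipProfile₁ Λ s| := by
  have h4 := hΦ.abs_deriv_le (quarterRoot Λ * (bend Λ s - tipProfile Λ s))
  unfold junctionRadius₁
  set D := deriv Φ (quarterRoot Λ * (bend Λ s - tipProfile Λ s))
  have h1 : |(1 - D) * gap₁ Λ s| ≤ 2 * |gap₁ Λ s| := by
    rw [abs_mul]; gcongr
    have := abs_le.1 h4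
    rw [abs_le]; constructor <;> linarith
  have h2 : |(1 + D) * tipProfile₁ Λ s| ≤ 2 * |tipProfile₁ Λ s| := by
    rw [abs_mul]; gcongr
    have := abs_le.1 h4
    rw [abs_le]; constructor <;> linarith
  have h1' := abs_le.1 h1
  have h2' := abs_le.1 h2
  rw [abs_le]; constructor <;> nlinarith

lemma junctionRadius_le_bend (hΦ : IsSmoothedAbs Φ) (hl : 0 < quarterRoot Λ) :
    junctionRadius Φ Λ s ≤ bend Λ s := by
  have h := hΦ.neg_le (quarterRoot Λ * (bend Λ s - tipProfile Λ s))
  have h2 : (quarterRoot Λ)⁻¹ * -(quarterRoot Λ * (bend Λ s - tipProfile Λ s)) ≤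
      (quarterRoot Λ)⁻¹ * Φ (quarterRoot Λ * (bend Λ s - tipProfile Λ s)) := by gcongr
  have h3 : (quarterRoot Λ)⁻¹ * -(quarterRoot Λ * (bend Λ s - tipProfile Λ s)) =
      -(bend Λ s - tipProfile Λ s) := by field_simp
  unfold junctionRadius
  linarith

lemma junctionRadius_pos (hΦ : IsSmoothedAbs Φ) (hl : 1 ≤ quarterRoot Λ)
    (h1 : 1 / 4 ≤ bend Λ s) (h2 : 1 / 4 ≤ tipProfile Λ s) : 0 < junctionRadius Φ Λ s := by
  have h := hΦ.le_abs_add (quarterRoot Λ * (bend Λ s - tipProfile Λ s))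
  have hl0 : 0 < quarterRoot Λ := by linarith
  have h3 : (quarterRoot Λ)⁻¹ * Φ (quarterRoot Λ * (bend Λ s - tipProfile Λ s)) ≤
      (quarterRoot Λ)⁻¹ * (|quarterRoot Λ * (bend Λ s - tipProfile Λ s)| + 1 / 100) := by gcongr
  have h4 : (quarterRoot Λ)⁻¹ * (|quarterRoot Λ * (bend Λ s - tipProfile Λ s)| + 1 / 100) =
      |bend Λ s - tipProfile Λ s| + (quarterRoot Λ)⁻¹ * (1 / 100) := by
    rw [abs_mul, abs_of_pos hl0]; field_simp
  have h5 : (quarterRoot Λ)⁻¹ ≤ 1 := inv_le_one_of_one_le₀ hl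
  unfold junctionRadius
  rcases abs_cases (bend Λ s - tipProfile Λ s) with ⟨h6, -⟩ | ⟨h6, -⟩ <;> rw [h6] at h4 <;>
    linarith

lemma contDiffOn_junctionRadius (hΦ : IsSmoothedAbs Φ) (ha : 0 < capConst Λ) :
    ContDiffOn ℝ ∞ (junctionRadius Φ Λ) (Set.Ioo 0 (tipHeight Λ)) := by
  have h1 := (contDiffOn_bend Λ).mono (Set.Ioo_subset_Ioi_self : Set.Ioo 0 (tipHeight Λ) ⊆ _)
  have h2 := (contDiffOn_tipProfile ha).mono
    (Set.Ioo_subset_Iio_self : Set.Ioo 0 (tipHeight Λ) ⊆ _)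
  exact contDiffOn_const.mul ((h1.add h2).sub (contDiffOn_const.mul
    (hΦ.smooth.comp_contDiffOn (contDiffOn_const.mul (h1.sub h2)))))

lemma tipProfile_estimate (ha : 9 / 10 ≤ capConst Λ) (ha' : capConst Λ ≤ 985 / 1000)
    (hq : 1000 ≤ tipHeight Λ - s) :
    1 / 2 ≤ tipProfile Λ s ∧ |tipProfile₁ Λ s| ≤ 1 / 1000 := by
  have ha0 : 0 < capConst Λ := by linarith
  have hst : s < tipHeight Λ := by linarith
  have hq0 : 0 < capConst Λ + tipHeight Λ - s := by linarith
  have hg2 : (1 / 2) ^ 2 ≤ tipProfile Λ s ^ 2 := by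
    rw [tipProfile_sq ha0 hst]
    have h1 : 1 / 2 ≤ 1 - capConst Λ / (capConst Λ + tipHeight Λ - s) := by
      have : capConst Λ / (capConst Λ + tipHeight Λ - s) ≤ 1 / 2 := by
        rw [div_le_div_iff₀ hq0 two_pos]; linarith
      linarith
    calc ((1 : ℝ) / 2) ^ 2 ≤ (9 / 10) ^ 2 * (1 / 2) := by norm_num
      _ ≤ _ := by gcongr
  have hgpos := tipProfile_pos ha0 hst
  have hg : 1 / 2 ≤ tipProfile Λ s := (sq_le_sq₀ (by norm_num) hgpos.le).1 hg2
  refine ⟨hg, ?_⟩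
  rw [tipProfile₁, abs_div, abs_neg, abs_of_pos (by positivity), abs_of_pos (by positivity),
    div_le_div_iff₀ (by positivity) (by norm_num)]
  have h7 : capConst Λ ^ 3 ≤ 1 := pow_le_one₀ ha0.le (by linarith)
  have h8 : (1000 : ℝ) ^ 2 * (1 / 2) ≤
      (capConst Λ + tipHeight Λ - s) ^ 2 * tipProfile Λ s := by
    gcongr; linarith
  linarith

lemma gap_bounds_above (hΛ : 0 < Λ) (hs1 : Λ ≤ s) (hs2 : s ≤ 2 * Λ) :
    1 / 60 ≤ gap Λ s ∧ gap Λ s ≤ 1 / 2 := by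
  have hs0 : 0 < s := by linarith
  refine ⟨exp_neg_four_bounds.1.trans (gap_self hΛ ▸ gap_mono hΛ hΛ hs1), ?_⟩
  have h5 : gap Λ s ≤ Real.exp (-2) := by
    unfold gap
    apply Real.exp_le_exp.2
    rw [div_le_iff₀ hs0]; linarith
  have h6 : Real.exp (-2) ≤ 1 / 2 := by
    have := Real.add_one_le_exp (2 : ℝ)
    rw [Real.exp_neg, one_div]
    exact inv_anti₀ two_pos (by linarith)
  linarith

lemma nearly_cylindrical_estimate {R R₁ : ℝ} (hR0 : 0 ≤ R) (hR : R ≤ 59 / 60)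
    (hR1 : |R₁| ≤ 2 / 1000) :
    R * √(1 + R₁ ^ 2) - 1 + 9 / 20 * (1 - R ^ 2) ≤ -(1 / 1000) := by
  have h9 : R₁ ^ 2 ≤ (2 / 1000) ^ 2 := sq_le_sq' (by linarith [(abs_le.1 hR1).1])
    (abs_le.1 hR1).2
  have h10 : √(1 + R₁ ^ 2) ≤ 1 + 1 / 100000 := by
    apply Real.sqrt_le_iff.2
    constructor
    · norm_num
    · linarith
  have h11 : R * √(1 + R₁ ^ 2) ≤ R * (1 + 1 / 100000) := by gcongr
  have h12 : 1 / 60 * (1 / 10) ≤ (1 - R) * (55 / 100 - 45 / 100 * R) :=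
    mul_le_mul (by linarith) (by linarith) (by norm_num) (by linarith)
  linarith

/-- Below the tip the radius is nearly constant and at most `bend Λ Λ = 1 - e^{-4}`. -/
lemma junction_estimate (hΦ : IsSmoothedAbs Φ) (hl : 1000 ≤ quarterRoot Λ) (hΛ : 0 < Λ)
    (hs1 : Λ < s) (hs2 : s < Λ + quarterRoot Λ) :
    0 < junctionRadius Φ Λ s ∧ junctionRadius Φ Λ s ≤ 59 / 60 ∧
      junctionRadius₂ Φ Λ s ≤ 0 ∧
      junctionRadius Φ Λ s * √(1 + junctionRadius₁ Φ Λ s ^ 2) - 1 +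
        9 / 20 * (1 - junctionRadius Φ Λ s ^ 2) ≤ -(1 / 1000) := by
  obtain ⟨ha, ha'⟩ := capConst_bounds hl
  have ha0 : 0 < capConst Λ := by linarith
  have hl0 : 0 < quarterRoot Λ := by linarith
  have h4 := quarterRoot_pow_four hΛ.le
  have hs0 : 0 < s := hΛ.trans hs1
  have hΛl : quarterRoot Λ ≤ Λ := by
    have := le_self_pow₀ (by linarith : 1 ≤ quarterRoot Λ) (by norm_num : 4 ≠ 0)
    linarith
  have hst : quarterRoot Λ ≤ tipHeight Λ - s := by unfold tipHeight; linarith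
  have hst' : s < tipHeight Λ := by linarith
  have hs2' : s ≤ 2 * Λ := by linarith
  obtain ⟨hg, hg1⟩ := tipProfile_estimate ha ha' (hl.trans hst)
  obtain ⟨hgap1, hgap2⟩ := gap_bounds_above hΛ hs1.le hs2'
  have hRpos := junctionRadius_pos hΦ (by linarith) (by rw [bend_eq]; linarith)
    (by linarith : 1 / 4 ≤ tipProfile Λ s)
  have hRle := junctionRadius_le_bend (s := s) hΦ hl0
  rw [bend_eq] at hRle
  have hR : junctionRadius Φ Λ s ≤ 59 / 60 := by linarith
  have hR1 : |junctionRadius₁ Φ Λ s| ≤ 2 / 1000 := by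
    refine (abs_junctionRadius₁_le hΦ).trans ?_
    have h5 : |gap₁ Λ s| ≤ 1 / 1000 := by
      rw [abs_of_nonneg (gap₁_nonneg hΛ)]
      refine (gap₁_le hΛ hs0).trans ?_
      exact one_div_le_one_div_of_le (by norm_num) (by linarith)
    linarith
  exact ⟨hRpos, hR, junctionRadius₂_nonpos hΦ hl0 hΛ ha0 hs0 hst' hs2',
    nearly_cylindrical_estimate hRpos.le hR hR1⟩

end junction

/-! ### The homotopy to the circle -/

section rounding
variable {om : ℝ → ℝ} {δ : ℝ} {γ : ℝ → E2} {γt : ℝ → ℝ → E2}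

lemma smoothStrip_of_contDiff {c : ℝ → ℝ → E2} (h : ContDiff ℝ ∞ (fun z : ℝ × ℝ => c z.1 z.2))
    (U : Set ℝ) : SmoothStrip U c := h.contDiffOn

lemma one_le_two_pi : 1 ≤ 2 * Real.pi := by linarith [Real.pi_gt_three]

lemma IsRounding.norm_dHeight_le (h : IsRounding om δ γ γt) (r t : ℝ) :
    ‖dHeight γt r t‖ ≤ om δ ∧ ‖dHeight (dAngle γt) r t‖ ≤ om δ ∧
      ‖dHeight (dHeight γt) r t‖ ≤ om δ := by
  have hb := h.bound r t
  have h1 := norm_nonneg (deriv (fun r' => γt r' t) r)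
  have h2 := norm_nonneg (deriv (fun r' => deriv (γt r') t) r)
  have h3 := norm_nonneg (deriv (deriv (fun r' => γt r' t)) r)
  refine ⟨?_, ?_, ?_⟩
  · change ‖deriv (fun r' => γt r' t) r‖ ≤ om δ
    linarith
  · have : dHeight (dAngle γt) r t = (2 * Real.pi)⁻¹ • deriv (fun r' => deriv (γt r') t) r :=
      deriv_const_smul_field (2 * Real.pi)⁻¹ (fun r' => deriv (γt r') t)
    rw [this, norm_smul, Real.norm_of_nonneg (by positivity)]
    have h4 : (2 * Real.pi)⁻¹ ≤ 1 := inv_le_one_of_one_le₀ one_le_two_pi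
    nlinarith
  · change ‖deriv (deriv (fun r' => γt r' t)) r‖ ≤ om δ
    linarith

lemma IsRounding.om_nonneg (h : IsRounding om δ γ γt) : 0 ≤ om δ :=
  (norm_nonneg _).trans (h.norm_dHeight_le 0 0).1

lemma norm_sub_le_of_hasDerivAt {f f' : ℝ → E2} {B : ℝ} (hf : ∀ x, HasDerivAt f (f' x) x)
    (hB : ∀ x, ‖f' x‖ ≤ B) (x y : ℝ) : ‖f y - f x‖ ≤ B * |y - x| :=
  Convex.norm_image_sub_le_of_norm_hasDerivWithin_le (s := Set.univ)
    (fun x _ => (hf x).hasDerivWithinAt) (fun x _ => hB x) convex_univ trivial trivial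

/-- The homotopy ends at the circle and its velocity is small, so it stays near the circle. -/
lemma IsRounding.norm_sub_circle_le (h : IsRounding om δ γ γt) {r : ℝ} (hr0 : 0 ≤ r) (hr1 : r ≤ 1)
    (t : ℝ) : ‖γt r t - circle t‖ ≤ om δ ∧ ‖dAngle γt r t - rot (circle t)‖ ≤ om δ := by
  have hsm := smoothStrip_of_contDiff h.smooth Set.univ
  have hr : |r - 1 / 2| ≤ 1 := by rw [abs_le]; constructor <;> linarith
  have hω := h.om_nonneg
  constructor
  · have := norm_sub_le_of_hasDerivAt (f := fun r => γt r t)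
      (fun r => hsm.hasDerivAt_height isOpen_univ trivial t)
      (fun r => (h.norm_dHeight_le r t).1) (1 / 2) r
    rw [h.finish (1 / 2) le_rfl] at this
    exact this.trans (mul_le_of_le_one_right hω hr)
  · have := norm_sub_le_of_hasDerivAt (f := fun r => dAngle γt r t)
      (fun r => (hsm.smooth_dAngle isOpen_univ).hasDerivAt_height isOpen_univ trivial t)
      (fun r => (h.norm_dHeight_le r t).2.1) (1 / 2) r
    have h2 : dAngle γt (1 / 2) t = rot (circle t) := by
      have : γt (1 / 2) = circle := funext (h.finish (1 / 2) le_rfl)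
      rw [dAngle, this, (hasDerivAt_circle t).deriv, inv_smul_smul₀ two_pi_ne_zero]
    simp only [h2] at this
    exact this.trans (mul_le_of_le_one_right hω hr)

lemma IsRounding.eq_zero (h : IsRounding om δ γ γt) : γt 0 = γ :=
  funext (h.start 0 (by norm_num))

/-- The homotopy, slowed down to the scale `Λ`, is a family of nearly round curves. -/
lemma IsRounding.nearRound (h : IsRounding om δ γ γt) {Λ s : ℝ} (hΛ : 1 ≤ Λ) (hs0 : 0 ≤ s)
    (hs1 : s ≤ Λ) (t : ℝ) : NearRound (om δ) (fun s t => γt (s / Λ) t) s t := by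
  have hΛ0 : 0 < Λ := by linarith
  have hω := h.om_nonneg
  have hsm := smoothStrip_of_contDiff h.smooth Set.univ
  have hr0 : 0 ≤ s / Λ := by positivity
  have hr1 : s / Λ ≤ 1 := (div_le_one hΛ0).2 hs1
  have hinv : Λ⁻¹ ≤ 1 := inv_le_one_of_one_le₀ hΛ
  have hinv0 : 0 ≤ Λ⁻¹ := by positivity
  have hd : ∀ (s : ℝ), HasDerivAt (fun s => s / Λ) Λ⁻¹ s := fun s => by
    simpa using (hasDerivAt_id s).div_const Λ
  have key : ∀ c : ℝ → ℝ → E2, SmoothStrip Set.univ c →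
      dHeight (fun s t => c (s / Λ) t) = fun s t => Λ⁻¹ • dHeight c (s / Λ) t := by
    intro c hc
    ext1 s; ext1 t
    exact ((hc.hasDerivAt_height isOpen_univ trivial t).scomp s (hd s)).deriv
  have hle : ∀ v : E2, ‖v‖ ≤ om δ → ‖Λ⁻¹ • v‖ ≤ om δ := by
    intro v hv
    rw [norm_smul, Real.norm_of_nonneg hinv0]
    nlinarith [norm_nonneg v]
  have hb := h.norm_dHeight_le (s / Λ) t
  refine ⟨(h.norm_sub_circle_le hr0 hr1 t).1, (h.norm_sub_circle_le hr0 hr1 t).2, ?_, ?_, ?_⟩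
  · rw [key _ hsm]; exact hle _ hb.1
  · have h2 : dHeight (dHeight fun s t => γt (s / Λ) t) s t =
        Λ⁻¹ • Λ⁻¹ • dHeight (dHeight γt) (s / Λ) t := by
      rw [key _ hsm]
      have := congrFun (congrFun (key _ (hsm.smooth_dHeight isOpen_univ)) s) t
      rw [← this]
      exact deriv_const_smul_field Λ⁻¹ (fun s' => dHeight γt (s' / Λ) t)
    rw [h2]; exact hle _ (hle _ hb.2.2)
  · have h2 : dAngle (fun s t => γt (s / Λ) t) = fun s t => dAngle γt (s / Λ) t := rfl
    rw [h2, key _ (hsm.smooth_dAngle isOpen_univ)]; exact hle _ hb.2.1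

end rounding

/-! ### The lower curvature bound -/

lemma dAngle_dAngle_eq (c : ℝ → ℝ → E2) (s t : ℝ) :
    dAngle (dAngle c) s t = (2 * Real.pi)⁻¹ • (2 * Real.pi)⁻¹ • deriv (deriv (c s)) t := by
  rw [dAngle]
  congr 1
  exact deriv_const_smul_field (2 * Real.pi)⁻¹ (deriv (c s))

lemma bendDet_eq_det2 (c : ℝ → ℝ → E2) (s t : ℝ) :
    bendDet c s t = (2 * Real.pi)⁻¹ ^ 3 * det2 (deriv (c s) t) (deriv (deriv (c s)) t) := by
  rw [bendDet, dAngle_dAngle_eq, dAngle, det2_smul_left, det2_smul_right, det2_smul_right]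
  ring

/-- The invariant `bendDet` is the curvature up to the cube of the speed of the parametrization. -/
lemma bendDet_eq_curvature (c : ℝ → ℝ → E2) {s t : ℝ} (h : deriv (c s) t ≠ 0) :
    bendDet c s t = curvature (c s) t * ‖dAngle c s t‖ ^ 3 := by
  have hn : ‖deriv (c s) t‖ ≠ 0 := norm_ne_zero_iff.2 h
  rw [bendDet_eq_det2, curvature, dAngle, norm_smul, Real.norm_of_nonneg (by positivity)]
  field_simp

/-- A touching disk of radius `r` that does not contain the nearly antipodal point of a nearly
round curve has `r ≤ 1 + O(η)`. -/
lemma radius_le_of_nearly_round {γ : ℝ → E2} {t r η : ℝ} {p : E2} (hη : η ≤ 1 / 1000)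
    (h1 : ∀ t, ‖γ t - circle t‖ ≤ η) (h2 : ‖p - rot (circle t)‖ ≤ η) (hr : 0 ≤ r)
    (h : r ≤ dist (γ (t + 1 / 2)) (γ t + r • (‖p‖⁻¹ • rot p))) : r ≤ 1 + 10 * η := by
  have hη0 : 0 ≤ η := (norm_nonneg _).trans h2
  have hp := abs_le.1 (norm_sub_one_le (by rw [norm_rot, norm_circle]) h2)
  have hp0 : 0 < ‖p‖ := by linarith
  set d := γ (t + 1 / 2) - γ t with hd
  have hdist : dist (γ (t + 1 / 2)) (γ t + r • (‖p‖⁻¹ • rot p)) =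
      ‖d - (r * ‖p‖⁻¹) • rot p‖ := by
    rw [dist_eq_norm, hd, smul_smul]; congr 1; abel
  rw [hdist] at h
  have hsq : r ^ 2 ≤ ‖d - (r * ‖p‖⁻¹) • rot p‖ ^ 2 := by gcongr
  rw [norm_sub_sq_real, inner_smul_right, norm_smul, norm_rot, mul_pow, Real.norm_eq_abs, sq_abs,
    mul_pow, inv_pow, mul_assoc (r ^ 2), inv_mul_cancel₀ (by positivity), mul_one] at hsq
  -- `d` is nearly `-2 e` and `rot p` is nearly `-e`, with `e = circle t`
  have hd' : ‖d + (2 : ℝ) • circle t‖ ≤ 2 * η := by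
    have h3 := h1 (t + 1 / 2)
    have h4 := h1 t
    rw [circle_add_half] at h3
    have : d + (2 : ℝ) • circle t = (γ (t + 1 / 2) - -circle t) - (γ t - circle t) := by
      rw [hd]; module
    rw [this]
    exact (norm_sub_le _ _).trans (by linarith)
  have hp' : ‖rot p + circle t‖ ≤ η := by
    have : rot p + circle t = rot (p - rot (circle t)) := by
      refine PiLp.ext fun i => ?_
      fin_cases i
      · simp [rot]; ring
      · simp [rot]
    rw [this, norm_rot]; exact h2
  have hin : inner ℝ d (rot p) = 2 - 2 * inner ℝ (circle t) (rot p + circle t)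
      - inner ℝ (d + (2 : ℝ) • circle t) (circle t)
      + inner ℝ (d + (2 : ℝ) • circle t) (rot p + circle t) := by
    have hc : inner ℝ (circle t) (circle t) = (1 : ℝ) := by
      rw [real_inner_self_eq_norm_sq, norm_circle]; norm_num
    simp only [inner_add_left, inner_add_right, inner_smul_left, hc, Real.ringHom_apply]
    ring
  have b1 := abs_le.1 ((abs_real_inner_le_norm (circle t) (rot p + circle t)).trans
    (mul_le_mul_of_nonneg_left hp' (norm_nonneg _)))
  have b2 := abs_le.1 ((abs_real_inner_le_norm (d + (2 : ℝ) • circle t) (circle t)).trans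
    (mul_le_mul_of_nonneg_right hd' (norm_nonneg _)))
  have b3 := abs_le.1 ((abs_real_inner_le_norm (d + (2 : ℝ) • circle t) (rot p + circle t)).trans
    (mul_le_mul hd' hp' (norm_nonneg _) (by positivity)))
  rw [norm_circle] at b1 b2
  have hlow : 2 - 5 * η ≤ inner ℝ d (rot p) := by
    rw [hin]; nlinarith
  have hdn : ‖d‖ ≤ 2 + 2 * η := by
    have h5 : d = (d + (2 : ℝ) • circle t) - (2 : ℝ) • circle t := by abel
    calc ‖d‖ = ‖(d + (2 : ℝ) • circle t) - (2 : ℝ) • circle t‖ := by rw [← h5]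
      _ ≤ 2 * η + 2 := (norm_sub_le _ _).trans
          (by rw [norm_smul, norm_circle]; norm_num; linarith)
      _ = _ := by ring
  have hdn2 : ‖d‖ ^ 2 ≤ (2 + 2 * η) ^ 2 := by gcongr
  have hq : 2 * r * (2 - 5 * η) ≤ (2 + 2 * η) ^ 2 * ‖p‖ := by
    have h6 : 2 * (r * ‖p‖⁻¹ * inner ℝ d (rot p)) ≤ (2 + 2 * η) ^ 2 := by linarith
    have h7 : 2 * (r * ‖p‖⁻¹ * inner ℝ d (rot p)) * ‖p‖ = 2 * r * inner ℝ d (rot p) := by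
      field_simp
    have h8 : 2 * (r * ‖p‖⁻¹ * inner ℝ d (rot p)) * ‖p‖ ≤ (2 + 2 * η) ^ 2 * ‖p‖ := by gcongr
    have h9 : 2 * r * (2 - 5 * η) ≤ 2 * r * inner ℝ d (rot p) := by gcongr
    linarith
  have hq2 : (2 + 2 * η) ^ 2 * ‖p‖ ≤ (2 + 2 * η) ^ 2 * (1 + η) := by gcongr; linarith
  have h10 : (2 + 2 * η) ^ 2 * (1 + η) ≤ (4 - 10 * η) * (1 + 10 * η) := by nlinarith
  by_contra hcon
  push Not at hcon
  have h11 : (4 - 10 * η) * (1 + 10 * η) < (4 - 10 * η) * r :=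
    mul_lt_mul_of_pos_left hcon (by linarith)
  linarith

/-- Nearly round noncollapsed curves have curvature almost at least `1`. -/
lemma bendDet_ge_of_noncollapsed {c : ℝ → ℝ → E2} {s t δ η : ℝ} (hη : η ≤ 1 / 1000)
    (hδ : 0 < δ) (hδ' : δ ≤ 1 / 1000)
    (hreg : deriv (c s) t ≠ 0) (hnc : IsNoncollapsed (1 / (1 + δ)) (c s))
    (h1 : ∀ t, ‖c s t - circle t‖ ≤ η) (h2 : ‖dAngle c s t - rot (circle t)‖ ≤ η) :
    1 - δ - 14 * η ≤ bendDet c s t := by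
  obtain ⟨hκ, hin⟩ := hnc t
  have hη0 : 0 ≤ η := (norm_nonneg _).trans h2
  have hN : inwardNormal (c s) t = ‖dAngle c s t‖⁻¹ • rot (dAngle c s t) := by
    have hr : rot (dAngle c s t) = (2 * Real.pi)⁻¹ • rot (deriv (c s) t) := by
      refine PiLp.ext fun i => ?_
      fin_cases i <;> simp [rot, dAngle]
    have hn : ‖deriv (c s) t‖ ≠ 0 := norm_ne_zero_iff.2 hreg
    rw [hr, inwardNormal, dAngle, norm_smul, Real.norm_of_nonneg (by positivity), smul_smul]
    congr 1
    field_simp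
  have h3 := hin (t + 1 / 2)
  rw [hN] at h3
  have hr := radius_le_of_nearly_round hη h1 h2 (by positivity) h3
  have hp := abs_le.1 (norm_sub_one_le (by rw [norm_rot, norm_circle]) h2)
  rw [bendDet_eq_curvature c hreg]
  set κ := curvature (c s) t
  rw [div_le_iff₀ hκ, div_le_iff₀ (by linarith)] at hr
  have h4 : (1 - η) ^ 3 ≤ ‖dAngle c s t‖ ^ 3 := by
    apply pow_le_pow_left₀ (by linarith); linarith
  have h5 : 1 - 3 * η ≤ (1 - η) ^ 3 := by nlinarith [mul_nonneg hη0 hη0]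
  -- `κ ≥ 1 / ((1 + 10 η)(1 + δ))`
  have h6 : 1 - δ - 10 * η ≤ κ := by
    by_contra hcon
    push Not at hcon
    have h7 : (1 + 10 * η) * κ * (1 + δ) ≤ (1 + 10 * η) * (1 - δ - 10 * η) * (1 + δ) := by
      gcongr
    nlinarith [mul_nonneg hη0 hδ.le, mul_nonneg hη0 hη0, mul_nonneg hδ.le hδ.le]
  calc 1 - δ - 14 * η ≤ (1 - δ - 10 * η) * (1 - 3 * η) := by
        nlinarith [mul_nonneg hη0 hδ.le, mul_nonneg hη0 hη0]
    _ ≤ κ * ‖dAngle c s t‖ ^ 3 := by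
        apply mul_le_mul h6 (h5.trans h4) (by linarith) hκ.le

/-- The unit tangent vector of a plane curve. -/
noncomputable def tangent (γ : ℝ → E2) (t : ℝ) : E2 := ‖deriv γ t‖⁻¹ • deriv γ t

section curve
variable {γ : ℝ → E2}

lemma IsConvexCurve.smooth_deriv (h : IsConvexCurve γ) : ContDiff ℝ ∞ (deriv γ) :=
  ((contDiff_infty_iff_deriv (𝕜 := ℝ)).1 h.smooth).2

lemma IsConvexCurve.hasDerivAt_deriv (h : IsConvexCurve γ) (t : ℝ) :
    HasDerivAt (deriv γ) (deriv (deriv γ) t) t :=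
  (h.smooth_deriv.differentiable (by simp) t).hasDerivAt

lemma IsConvexCurve.contDiff_norm_inv (h : IsConvexCurve γ) :
    ContDiff ℝ ∞ (fun t => ‖deriv γ t‖⁻¹) := by
  have h1 : ContDiff ℝ ∞ (fun t => ‖deriv γ t‖) :=
    h.smooth_deriv.norm ℝ h.regular
  exact h1.inv fun t => norm_ne_zero_iff.2 (h.regular t)

lemma IsConvexCurve.norm_tangent (h : IsConvexCurve γ) (t : ℝ) : ‖tangent γ t‖ = 1 :=
  norm_smul_inv_norm (h.regular t)

lemma eq_smul_rot_of_inner_eq_zero {T v : E2} (hT : ‖T‖ = 1) (h : inner ℝ T v = 0) :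
    v = det2 T v • rot T := by
  have h1 := norm_sq_eq T
  rw [hT, one_pow] at h1
  rw [inner_eq] at h
  refine PiLp.ext fun i => ?_
  fin_cases i
  · simp [rot, det2]
    linear_combination v 0 * h1 + T 0 * h
  · simp [rot, det2]
    linear_combination v 1 * h1 + T 1 * h

/-- The derivative of the unit tangent is `|γ'| κ` times the normal. -/
lemma IsConvexCurve.hasDerivAt_tangent (h : IsConvexCurve γ) (t : ℝ) :
    HasDerivAt (tangent γ) ((‖deriv γ t‖ * curvature γ t) • rot (tangent γ t)) t := by
  have h1 := (h.contDiff_norm_inv.differentiable (by simp) t).hasDerivAt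
  have h2 := h1.smul (h.hasDerivAt_deriv t)
  have h3 : HasDerivAt (tangent γ) (‖deriv γ t‖⁻¹ • deriv (deriv γ) t +
      deriv (fun t => ‖deriv γ t‖⁻¹) t • deriv γ t) t := h2
  have hn : ‖deriv γ t‖ ≠ 0 := norm_ne_zero_iff.2 (h.regular t)
  have h4 : inner ℝ (tangent γ t) (‖deriv γ t‖⁻¹ • deriv (deriv γ) t +
      deriv (fun t => ‖deriv γ t‖⁻¹) t • deriv γ t) = 0 := by
    have h5 := h3.norm_sq
    have h6 : (fun t => ‖tangent γ t‖ ^ 2) = fun _ => 1 := by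
      ext1 t; rw [h.norm_tangent]; norm_num
    rw [h6] at h5
    have := h5.unique (hasDerivAt_const t 1)
    linarith
  refine h3.congr_deriv ?_
  rw [eq_smul_rot_of_inner_eq_zero (h.norm_tangent t) h4]
  congr 1
  rw [det2_add_right, det2_smul_right, det2_smul_right, tangent, det2_smul_left, det2_smul_left,
    det2_self, curvature]
  field_simp
  ring

lemma IsConvexCurve.differentiable_curvature (h : IsConvexCurve γ) :
    Differentiable ℝ (curvature γ) := by
  have h1 : ContDiff ℝ ∞ (deriv γ) := h.smooth_deriv
  have h2 : ContDiff ℝ ∞ (deriv (deriv γ)) := ((contDiff_infty_iff_deriv (𝕜 := ℝ)).1 h1).2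
  have hc : ∀ (f : ℝ → E2) (i : Fin 2), ContDiff ℝ ∞ f → Differentiable ℝ (fun t => f t i) :=
    fun f i hf => (contDiff_euclidean.1 hf i).differentiable (by simp)
  have h3 := h.contDiff_norm_inv.differentiable (by simp)
  have h4 : curvature γ = fun t => (deriv γ t 0 * deriv (deriv γ) t 1 -
      deriv γ t 1 * deriv (deriv γ) t 0) * (‖deriv γ t‖⁻¹) ^ 3 := by
    ext1 t; rw [curvature, det2, div_eq_mul_inv, inv_pow]
  rw [h4]
  exact (((hc _ 0 h1).mul (hc _ 1 h2)).sub ((hc _ 1 h1).mul (hc _ 0 h2))).mul (h3.pow 3)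

end curve

/-! ### The upper curvature bound -/

section upper
variable {γ : ℝ → E2}

lemma norm_circle_sub_le (x y : ℝ) : ‖circle y - circle x‖ ≤ 2 * Real.pi * |y - x| :=
  norm_sub_le_of_hasDerivAt hasDerivAt_circle (fun t => by
    rw [norm_smul, norm_rot, norm_circle, Real.norm_of_nonneg (by positivity), mul_one]) x y

lemma tangent_eq (γ : ℝ → E2) (t : ℝ) :
    tangent γ t = ‖(2 * Real.pi)⁻¹ • deriv γ t‖⁻¹ • ((2 * Real.pi)⁻¹ • deriv γ t) := by
  rw [tangent, norm_smul, smul_smul, Real.norm_of_nonneg (by positivity)]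
  congr 1
  field_simp

lemma norm_deriv_eq (γ : ℝ → E2) (t : ℝ) :
    ‖deriv γ t‖ = 2 * Real.pi * ‖(2 * Real.pi)⁻¹ • deriv γ t‖ := by
  rw [norm_smul, Real.norm_of_nonneg (by positivity), mul_inv_cancel_left₀ two_pi_ne_zero]

/-- Nearly round curves with slowly varying curvature have curvature almost at most `1`: over a
short arc the tangent turns about as much as that of the unit circle, so the curvature is small
somewhere on the arc. -/
lemma IsConvexCurve.curvature_le (h : IsConvexCurve γ) {η x : ℝ} (hx0 : 0 < x)
    (hx : x ≤ 1 / 1000) (hη : η ≤ x ^ 2)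
    (hang : ∀ t, ‖(2 * Real.pi)⁻¹ • deriv γ t - rot (circle t)‖ ≤ η)
    (hpos : ∀ t, 0 < curvature γ t)
    (hκ : ∀ t, |arcDeriv γ (curvature γ) t| ≤ 1 / 100) (t : ℝ) : curvature γ t ≤ 1 + 3 * x := by
  have hpi1 := Real.pi_gt_d2
  have hpi2 := Real.pi_lt_d2
  have hη0 : 0 ≤ η := (norm_nonneg _).trans (hang 0)
  have hηs : η ≤ x / 1000 := by nlinarith
  have hm : ∀ t, |‖(2 * Real.pi)⁻¹ • deriv γ t‖ - 1| ≤ η := fun t =>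
    norm_sub_one_le (by rw [norm_rot, norm_circle]) (hang t)
  have hg : ∀ t, 2 * Real.pi * (1 - η) ≤ ‖deriv γ t‖ ∧ ‖deriv γ t‖ ≤ 10 := by
    intro t
    have := abs_le.1 (hm t)
    rw [norm_deriv_eq]
    constructor
    · gcongr; linarith
    · nlinarith
  have hT : ∀ t, ‖tangent γ t - rot (circle t)‖ ≤ 2 * η := by
    intro t
    have h1 : ‖tangent γ t - (2 * Real.pi)⁻¹ • deriv γ t‖ ≤ η := by
      have hn : ‖(2 * Real.pi)⁻¹ • deriv γ t‖ ≠ 0 := by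
        rw [norm_ne_zero_iff]; exact smul_ne_zero (by positivity) (h.regular t)
      have h2 : tangent γ t - (2 * Real.pi)⁻¹ • deriv γ t =
          (1 - ‖(2 * Real.pi)⁻¹ • deriv γ t‖) • tangent γ t := by
        rw [tangent_eq, sub_smul, smul_inv_smul₀ hn, one_smul]
      rw [h2, norm_smul, h.norm_tangent, mul_one, Real.norm_eq_abs, abs_sub_comm]
      exact hm t
    calc _ = ‖(tangent γ t - (2 * Real.pi)⁻¹ • deriv γ t) +
          ((2 * Real.pi)⁻¹ • deriv γ t - rot (circle t))‖ := by congr 1; abel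
      _ ≤ _ := (norm_add_le _ _).trans (by linarith [hang t])
  have hTT : ∀ τ, |τ - t| ≤ x → ‖tangent γ τ - tangent γ t‖ ≤ 2 * Real.pi * x + 4 * η := by
    intro τ hτ
    have h1 : ‖rot (circle τ) - rot (circle t)‖ ≤ 2 * Real.pi * x := by
      have : rot (circle τ) - rot (circle t) = rot (circle τ - circle t) := by
        refine PiLp.ext fun i => ?_
        fin_cases i
        · simp [rot]; ring
        · simp [rot]
      rw [this, norm_rot]
      exact (norm_circle_sub_le t τ).trans (by gcongr)
    calc _ = ‖(tangent γ τ - rot (circle τ)) + (rot (circle τ) - rot (circle t)) -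
          (tangent γ t - rot (circle t))‖ := by congr 1; abel
      _ ≤ _ := (norm_sub_le _ _).trans (add_le_add_left (norm_add_le _ _) _)
      _ ≤ _ := by linarith [hT τ, hT t]
  -- `det (T t, T τ)` is the sine of the angle by which the tangent turns from `t` to `τ`
  have hψ : ∀ τ, HasDerivAt (fun τ => det2 (tangent γ t) (tangent γ τ))
      (‖deriv γ τ‖ * curvature γ τ * inner ℝ (tangent γ t) (tangent γ τ)) τ := by
    intro τ
    have h1 := h.hasDerivAt_tangent τ
    have hc : ∀ i, HasDerivAt (fun t => tangent γ t i)
        (((‖deriv γ τ‖ * curvature γ τ) • rot (tangent γ τ)) i) τ := fun i =>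
      (EuclideanSpace.proj i : E2 →L[ℝ] ℝ).hasFDerivAt.comp_hasDerivAt τ h1
    have h2 := ((hc 1).const_mul (tangent γ t 0)).sub ((hc 0).const_mul (tangent γ t 1))
    refine h2.congr_deriv ?_
    rw [← det2_rot_right, ← det2_smul_right, det2]
  obtain ⟨ξ, hξ, hξe⟩ := exists_hasDerivAt_eq_slope
    (fun τ => det2 (tangent γ t) (tangent γ τ)) _ (show t < t + x by linarith)
    (fun τ _ => (hψ τ).continuousAt.continuousWithinAt) (fun τ _ => hψ τ)
  have hξ1 : |ξ - t| ≤ x := by rw [abs_le]; constructor <;> linarith [hξ.1, hξ.2]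
  have hup : det2 (tangent γ t) (tangent γ (t + x)) ≤ 2 * Real.pi * x + 4 * η := by
    have h1 := abs_det2_le (tangent γ t) (tangent γ (t + x) - tangent γ t)
    rw [det2_sub_right, det2_self, sub_zero, h.norm_tangent, one_mul] at h1
    refine (le_abs_self _).trans (h1.trans (hTT _ ?_))
    rw [add_sub_cancel_left, abs_of_pos hx0]
  rw [det2_self, sub_zero, add_sub_cancel_left, eq_div_iff hx0.ne'] at hξe
  have hin : 1 - 40 * x ^ 2 ≤ inner ℝ (tangent γ t) (tangent γ ξ) := by
    have h1 := norm_sub_sq_real (tangent γ ξ) (tangent γ t)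
    rw [h.norm_tangent, h.norm_tangent, real_inner_comm] at h1
    have h2 : ‖tangent γ ξ - tangent γ t‖ ≤ 7 * x := (hTT ξ hξ1).trans (by nlinarith)
    have h3 : ‖tangent γ ξ - tangent γ t‖ ^ 2 ≤ (7 * x) ^ 2 := by gcongr
    nlinarith
  have hx2 : x ^ 2 ≤ x / 1000 := by nlinarith
  have hξκ : curvature γ ξ ≤ 1 + 2 * x := by
    have hk := hpos ξ
    have h1 : 2 * Real.pi * (1 - η) * curvature γ ξ * (1 - 40 * x ^ 2) ≤
        ‖deriv γ ξ‖ * curvature γ ξ * inner ℝ (tangent γ t) (tangent γ ξ) := by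
      have := (hg ξ).1
      have h40 : 0 ≤ 1 - 40 * x ^ 2 := by linarith
      gcongr
    have h2 : 2 * Real.pi * (1 - η) * curvature γ ξ * (1 - 40 * x ^ 2) * x ≤
        2 * Real.pi * x + 4 * η := by
      refine le_trans ?_ (hξe.le.trans hup)
      gcongr
    have h3 : (1 - η) * curvature γ ξ * (1 - 40 * x ^ 2) ≤ 1 + x := by
      by_contra hcon
      push Not at hcon
      have h4 : 2 * Real.pi * x * (1 + x) <
          2 * Real.pi * x * ((1 - η) * curvature γ ξ * (1 - 40 * x ^ 2)) :=
        mul_lt_mul_of_pos_left hcon (by positivity)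
      nlinarith
    have h5 : (1 - η) * (1 - 40 * x ^ 2) ≥ 1 - x / 10 := by nlinarith
    by_contra hcon
    push Not at hcon
    have h6 : (1 + 2 * x) * (1 - x / 10) ≤ curvature γ ξ * ((1 - η) * (1 - 40 * x ^ 2)) := by
      have : 0 ≤ 1 - x / 10 := by linarith
      gcongr
    nlinarith
  have hκ' : ∀ τ, ‖deriv (curvature γ) τ‖ ≤ 1 / 10 := by
    intro τ
    have h1 := hκ τ
    have hn := norm_pos_iff.2 (h.regular τ)
    rw [arcDeriv, smul_eq_mul, abs_mul, abs_of_pos (inv_pos.2 hn), inv_mul_le_iff₀ hn] at h1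
    rw [Real.norm_eq_abs]
    nlinarith [(hg τ).2]
  have hfin := Convex.norm_image_sub_le_of_norm_deriv_le (s := Set.univ)
    (fun τ _ => h.differentiable_curvature τ) (fun τ _ => hκ' τ) convex_univ
    (Set.mem_univ ξ) (Set.mem_univ t)
  rw [Real.norm_eq_abs, Real.norm_eq_abs, abs_sub_comm t ξ] at hfin
  have := le_abs_self (curvature γ t - curvature γ ξ)
  linarith

end upper

/-! ### The cross sections of the neck -/

section slices
variable {U : Set ℝ} {γ : ℝ → E2} {F : ℝ → ℝ → E2} {ε s : ℝ}

lemma norm_le_of_normC20_le {V : Type*} [NormedAddCommGroup V] [NormedSpace ℝ V]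
    {f : ℝ → ℝ → V} {t : ℝ} (h : normC20 γ f s t ≤ ε) {k l : ℕ} (hk : k + l ≤ 20) :
    ‖iteratedDeriv k (fun s' => (arcDeriv γ)^[l] (f s') t) s‖ ≤ ε := by
  refine le_trans ?_ h
  refine le_trans ?_ (Finset.single_le_sum
    (f := fun k => ∑ l ∈ Finset.range (21 - k),
      ‖iteratedDeriv k (fun s' => (arcDeriv γ)^[l] (f s') t) s‖)
    (fun k _ => Finset.sum_nonneg fun l _ => norm_nonneg _)
    (Finset.mem_range.2 (show k < 21 by omega)))
  exact Finset.single_le_sum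
    (f := fun l => ‖iteratedDeriv k (fun s' => (arcDeriv γ)^[l] (f s') t) s‖)
    (fun l _ => norm_nonneg _) (Finset.mem_range.2 (show l < 21 - k by omega))

/-- The determinant of the first two derivatives of a curve, in terms of its derivatives with
respect to the arc length of `γ`. Only these are controlled by the `C^20` size: the tangential
part of the second derivative in the given parameter of `γ` drops out of the determinant. -/
lemma IsConvexCurve.bendDet_eq_arcDeriv (h : IsConvexCurve γ) {c : ℝ → ℝ → E2}
    (hc : ContDiff ℝ ∞ (c s)) (t : ℝ) :
    bendDet c s t = ‖(2 * Real.pi)⁻¹ • deriv γ t‖ ^ 3 *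
      det2 (arcDeriv γ (c s) t) (arcDeriv γ (arcDeriv γ (c s)) t) := by
  have h1 := (h.contDiff_norm_inv.differentiable (by simp) t).hasDerivAt
  have h2 : HasDerivAt (deriv (c s)) (deriv (deriv (c s)) t) t :=
    (((contDiff_infty_iff_deriv (𝕜 := ℝ)).1 hc).2.differentiable (by simp) t).hasDerivAt
  have h3 : deriv (arcDeriv γ (c s)) t = ‖deriv γ t‖⁻¹ • deriv (deriv (c s)) t +
      deriv (fun t => ‖deriv γ t‖⁻¹) t • deriv (c s) t := (h1.smul h2).deriv
  have hn : ‖deriv γ t‖ ≠ 0 := norm_ne_zero_iff.2 (h.regular t)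
  rw [bendDet_eq_det2, arcDeriv.eq_1 γ (arcDeriv γ (c s)), h3, arcDeriv, norm_smul,
    Real.norm_of_nonneg (by positivity)]
  simp only [det2_smul_left, det2_smul_right, det2_add_right, det2_self]
  field_simp
  ring

/-- Frenet's equation. -/
lemma IsConvexCurve.arcDeriv_arcDeriv_self (h : IsConvexCurve γ) (t : ℝ) :
    arcDeriv γ (arcDeriv γ γ) t = curvature γ t • rot (tangent γ t) := by
  have hn : ‖deriv γ t‖ ≠ 0 := norm_ne_zero_iff.2 (h.regular t)
  change ‖deriv γ t‖⁻¹ • deriv (tangent γ) t = _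
  rw [(h.hasDerivAt_tangent t).deriv, smul_smul]
  congr 1
  field_simp

/-- A perturbation `γ + μ F` of the constant family `γ`, with `F` small in `C^20`. -/
lemma perturbation_bounds (hU : IsOpen U) (h : IsConvexCurve γ)
    (hm : ∀ t, ‖(2 * Real.pi)⁻¹ • deriv γ t‖ ≤ 101 / 100)
    (hκ0 : ∀ t, 0 < curvature γ t) (hκ : ∀ t, curvature γ t ≤ 2)
    (hF : SmoothStrip U F) (hε : ∀ s ∈ U, ∀ t, normC20 γ F s t ≤ ε) (hε1 : ε ≤ 1)
    {μ μ₁ μ₂ : ℝ → ℝ} (hμ : ∀ s ∈ U, HasDerivAt μ (μ₁ s) s)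
    (hμ₁ : ∀ s ∈ U, HasDerivAt μ₁ (μ₂ s) s) {M : ℝ} (hM : 1 ≤ M) (hs : s ∈ U)
    (b0 : |μ s| ≤ M) (b1 : |μ₁ s| ≤ M) (b2 : |μ₂ s| ≤ M) (t : ℝ) :
    JetClose (5 * M ^ 2 * ε) (fun s t => γ t + μ s • F s t) (fun _ t => γ t) s t ∧
      |bendDet (fun s t => γ t + μ s • F s t) s t - bendDet (fun _ t => γ t) s t| ≤
        5 * M ^ 2 * ε := by
  have hb := hε s hs
  have n00 : ∀ t, ‖F s t‖ ≤ ε := fun t => by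
    simpa using norm_le_of_normC20_le (hb t) (k := 0) (l := 0) (by norm_num)
  have n10 : ‖dHeight F s t‖ ≤ ε := by
    simpa [iteratedDeriv_one, dHeight] using
      norm_le_of_normC20_le (hb t) (k := 1) (l := 0) (by norm_num)
  have n20 : ‖dHeight (dHeight F) s t‖ ≤ ε := by
    have := norm_le_of_normC20_le (hb t) (k := 2) (l := 0) (by norm_num)
    rw [iteratedDeriv_succ, iteratedDeriv_one] at this
    exact this
  have n01 : ‖arcDeriv γ (F s) t‖ ≤ ε := by
    simpa using norm_le_of_normC20_le (hb t) (k := 0) (l := 1) (by norm_num)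
  have n02 : ‖arcDeriv γ (arcDeriv γ (F s)) t‖ ≤ ε := by
    simpa using norm_le_of_normC20_le (hb t) (k := 0) (l := 2) (by norm_num)
  have n11 : ‖‖deriv γ t‖⁻¹ • deriv (fun s' => deriv (F s') t) s‖ ≤ ε := by
    have := norm_le_of_normC20_le (hb t) (k := 1) (l := 1) (by norm_num)
    rw [iteratedDeriv_one] at this
    rwa [show deriv (fun s' => (arcDeriv γ)^[1] (F s') t) s =
      ‖deriv γ t‖⁻¹ • deriv (fun s' => deriv (F s') t) s from
        deriv_const_smul_field ‖deriv γ t‖⁻¹ (fun s' => deriv (F s') t)] at this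
  have hε0 : 0 ≤ ε := (norm_nonneg _).trans n10
  have hn : ‖deriv γ t‖ ≠ 0 := norm_ne_zero_iff.2 (h.regular t)
  -- derivatives in the arc length of `γ` and in the angle differ by the speed of `γ` in the angle
  have key : ∀ v : E2, ‖‖deriv γ t‖⁻¹ • v‖ ≤ ε → ‖(2 * Real.pi)⁻¹ • v‖ ≤ 2 * ε := by
    intro v hv
    have h1 : (2 * Real.pi)⁻¹ • v =
        ‖(2 * Real.pi)⁻¹ • deriv γ t‖ • ‖deriv γ t‖⁻¹ • v := by
      rw [norm_smul, Real.norm_of_nonneg (by positivity), smul_smul, mul_assoc,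
        mul_inv_cancel₀ hn, mul_one]
    rw [h1, norm_smul, norm_norm]
    nlinarith [hm t, norm_nonneg ((2 * Real.pi)⁻¹ • deriv γ t),
      norm_nonneg (‖deriv γ t‖⁻¹ • v)]
  have nA : ‖dAngle F s t‖ ≤ 2 * ε := key _ n01
  have nHA : ‖dHeight (dAngle F) s t‖ ≤ 2 * ε := by
    rw [show dHeight (dAngle F) s t = (2 * Real.pi)⁻¹ • deriv (fun s' => deriv (F s') t) s from
      deriv_const_smul_field (2 * Real.pi)⁻¹ (fun s' => deriv (F s') t)]
    exact key _ n11
  have hcF : ∀ s ∈ U, ContDiff ℝ ∞ (F s) := fun s hs => contDiff_iff_contDiffAt.2 fun t =>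
    (hF.contDiffAt hU hs t).comp t (contDiffAt_const.prodMk contDiffAt_id)
  have hdF : ∀ s ∈ U, ∀ t, DifferentiableAt ℝ (F s) t := fun s hs t =>
    (hcF s hs).differentiable (by simp) t
  have hdγ : ∀ t, DifferentiableAt ℝ γ t := h.smooth.differentiable (by simp)
  have eH : dHeight (fun s t => γ t + μ s • F s t) = dHeight (fun s t => μ s • F s t) := by
    ext1 s; ext1 t
    exact deriv_const_add (f := fun s' => μ s' • F s' t) (γ t)
  have eA : ∀ s ∈ U, dAngle (fun s t => γ t + μ s • F s t) s =
      (fun s t => dAngle (fun _ t => γ t) s t + dAngle (fun s t => μ s • F s t) s t) s := by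
    intro s hs; ext1 t
    have := deriv_fun_add (hdγ t) ((hdF s hs t).fun_const_smul (μ s))
    simp only [dAngle]
    rw [this, smul_add]
  have eHA : dHeight (dAngle (fun s t => γ t + μ s • F s t)) s t =
      dHeight (dAngle (fun s t => μ s • F s t)) s t := by
    rw [dHeight_congr hU eA s hs]
    exact deriv_const_add (f := fun s' => dAngle (fun s t => μ s • F s t) s' t) _
  have hMM : M ≤ M ^ 2 := by nlinarith
  have hMε : M * ε ≤ M ^ 2 * ε := by gcongr
  have hM0 : 0 ≤ M := by linarith
  have sm : ∀ {a x : ℝ} {v : E2}, |a| ≤ M → ‖v‖ ≤ x → ‖a • v‖ ≤ M * x := by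
    intro a x v ha hv
    rw [norm_smul, Real.norm_eq_abs]
    exact mul_le_mul ha hv (norm_nonneg _) hM0
  have hMε0 : 0 ≤ M * ε := by positivity
  refine ⟨⟨?_, ?_, ?_, ?_, ?_⟩, ?_⟩
  · rw [add_sub_cancel_left]
    exact (sm b0 (n00 t)).trans (by linarith)
  · rw [congrFun (eA s hs) t, add_sub_cancel_left, dAngle_smul]
    exact (sm b0 nA).trans (by linarith)
  · rw [eH, dHeight_const, sub_zero, hF.dHeight_smul hU hμ hs]
    exact (norm_add_le _ _).trans (by linarith [sm b1 (n00 t), sm b0 n10])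
  · rw [eH, dHeight_dHeight_const, sub_zero, hF.dHeight_dHeight_smul hU hμ hμ₁ hs, mul_smul,
      two_smul]
    refine (norm_add₃_le).trans ?_
    have := norm_add_le (μ₁ s • dHeight F s t) (μ₁ s • dHeight F s t)
    linarith [sm b2 (n00 t), sm b1 n10, sm b0 n20]
  · rw [eHA, dHeight_dAngle_const, sub_zero, hF.dHeight_dAngle_smul hU hμ hs]
    exact (norm_add_le _ _).trans (by linarith [sm b1 nA, sm b0 nHA])
  · have hcσ : ContDiff ℝ ∞ ((fun s t => γ t + μ s • F s t) s) :=
      h.smooth.add ((hcF s hs).const_smul (μ s))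
    rw [h.bendDet_eq_arcDeriv hcσ, h.bendDet_eq_arcDeriv (c := fun _ t => γ t) h.smooth]
    have e1 : ∀ f g : ℝ → E2, (∀ t, DifferentiableAt ℝ f t) → (∀ t, DifferentiableAt ℝ g t) →
        arcDeriv γ (fun t => f t + μ s • g t) =
          fun t => arcDeriv γ f t + μ s • arcDeriv γ g t := by
      intro f g hf hg
      ext1 t
      simp only [arcDeriv]
      rw [deriv_fun_add (hf t) ((hg t).fun_const_smul (μ s)),
        show deriv (fun t => μ s • g t) t = μ s • deriv g t from deriv_const_smul_field (μ s) g,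
        smul_add, smul_comm (μ s)]
    have hda : ∀ f : ℝ → E2, ContDiff ℝ ∞ f → ∀ t, DifferentiableAt ℝ (arcDeriv γ f) t :=
      fun f hf => (h.contDiff_norm_inv.smul
        ((contDiff_infty_iff_deriv (𝕜 := ℝ)).1 hf).2).differentiable (by simp)
    simp only [e1 γ (F s) hdγ (hdF s hs),
      e1 (arcDeriv γ γ) (arcDeriv γ (F s)) (hda γ h.smooth) (hda (F s) (hcF s hs))]
    have hT : ‖arcDeriv γ γ t‖ = 1 := h.norm_tangent t
    have hk : ‖arcDeriv γ (arcDeriv γ γ) t‖ ≤ 2 := by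
      rw [h.arcDeriv_arcDeriv_self, norm_smul, norm_rot, h.norm_tangent, mul_one,
        Real.norm_of_nonneg (hκ0 t).le]
      exact hκ t
    generalize arcDeriv γ (arcDeriv γ γ) t = k at *
    generalize arcDeriv γ γ t = T at *
    generalize arcDeriv γ (arcDeriv γ (F s)) t = w at *
    generalize arcDeriv γ (F s) t = a at *
    have hm0 := norm_nonneg ((2 * Real.pi)⁻¹ • deriv γ t)
    have hm3 : ‖(2 * Real.pi)⁻¹ • deriv γ t‖ ^ 3 ≤ (101 / 100) ^ 3 := by gcongr; exact hm t
    have hd : det2 (T + μ s • a) (k + μ s • w) - det2 T k =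
        det2 (μ s • a) k + det2 T (μ s • w) + det2 (μ s • a) (μ s • w) := by
      simp only [det2_add_left, det2_add_right]; ring
    have q1 : |det2 (μ s • a) k| ≤ M * ε * 2 := (abs_det2_le _ _).trans
      (mul_le_mul (sm b0 n01) hk (norm_nonneg _) hMε0)
    have q2 : |det2 T (μ s • w)| ≤ M * ε := (abs_det2_le _ _).trans
      (by rw [hT, one_mul]; exact sm b0 n02)
    have q3 : |det2 (μ s • a) (μ s • w)| ≤ M * ε * (M * ε) := (abs_det2_le _ _).trans
      (mul_le_mul (sm b0 n01) (sm b0 n02) (norm_nonneg _) hMε0)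
    have q4 : M * ε * (M * ε) ≤ M ^ 2 * ε := by
      have : M ^ 2 * ε * ε ≤ M ^ 2 * ε * 1 := by gcongr
      linarith
    have q5 : |det2 (T + μ s • a) (k + μ s • w) - det2 T k| ≤ 4 * (M ^ 2 * ε) := by
      rw [hd]
      refine (abs_add_three _ _ _).trans ?_
      linarith
    rw [← mul_sub, abs_mul, abs_of_nonneg (by positivity)]
    calc _ ≤ (101 / 100) ^ 3 * (4 * (M ^ 2 * ε)) := by gcongr
      _ ≤ _ := by nlinarith [show 0 ≤ M ^ 2 * ε by positivity]

end slices

/-! ### Continuity of the integrand -/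

section continuity
variable {U : Set ℝ} {c : ℝ → ℝ → E2} {s t : ℝ}

lemma continuous_det2 : Continuous fun p : E2 × E2 => det2 p.1 p.2 := by
  unfold det2; fun_prop

lemma SmoothStrip.continuousAt_weight (hU : IsOpen U) (h : SmoothStrip U c) (hs : s ∈ U)
    (hreg : dAngle c s t ≠ 0) (β r₀ : ℝ) :
    ContinuousAt (fun z : ℝ × ℝ => weight β r₀ c z.1 z.2) (s, t) := by
  have hA := h.smooth_dAngle hU
  have hH := h.smooth_dHeight hU
  have c0 := (h.contDiffAt hU hs t).continuousAt
  have c1 := (hA.contDiffAt hU hs t).continuousAt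
  have c2 := (hH.contDiffAt hU hs t).continuousAt
  have c3 := ((hA.smooth_dAngle hU).contDiffAt hU hs t).continuousAt
  have c4 := ((hA.smooth_dHeight hU).contDiffAt hU hs t).continuousAt
  have c5 := ((hH.smooth_dHeight hU).contDiffAt hU hs t).continuousAt
  have hd : ∀ {f g : ℝ × ℝ → E2}, ContinuousAt f (s, t) → ContinuousAt g (s, t) →
      ContinuousAt (fun z => det2 (f z) (g z)) (s, t) := fun hf hg =>
    continuous_det2.continuousAt.comp (hf.prodMk hg)
  have hP : 0 < ‖dAngle c s t‖ ^ 2 + det2 (dAngle c s t) (dHeight c s t) ^ 2 := by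
    have := norm_pos_iff.2 hreg
    positivity
  have hPd : ContinuousAt (fun z : ℝ × ℝ => ‖dAngle c z.1 z.2‖ ^ 2 +
      det2 (dAngle c z.1 z.2) (dHeight c z.1 z.2) ^ 2) (s, t) :=
    (c1.norm.pow 2).add ((hd c1 c2).pow 2)
  have hsq : ContinuousAt (fun z : ℝ × ℝ => sliceA c z.1 z.2) (s, t) :=
    Real.continuous_sqrt.continuousAt.comp hPd
  have hHc : ContinuousAt (fun z : ℝ × ℝ => sliceH c z.1 z.2) (s, t) := by
    refine ContinuousAt.div ?_ (hsq.mul hPd) (mul_pos (Real.sqrt_pos.2 hP) hP).ne'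
    exact (((c1.norm.pow 2).mul (hd c1 c5)).sub
      ((continuousAt_const.mul (c2.inner c1)).mul (hd c1 c4))).add
      ((continuousAt_const.add (c2.norm.pow 2)).mul (hd c1 c3))
  exact (Real.continuous_exp.continuousAt.comp
    ((continuousAt_const.mul (c0.norm.pow 2)).sub (continuousAt_const.mul hHc))).mul
    (continuousAt_const.mul hsq)

lemma SmoothStrip.continuous_weight (hU : IsOpen U) (h : SmoothStrip U c) (hs : s ∈ U)
    (hreg : ∀ t, dAngle c s t ≠ 0) (β r₀ : ℝ) : Continuous (weight β r₀ c s) :=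
  continuous_iff_continuousAt.2 fun t =>
    ContinuousAt.comp (f := fun t => (s, t)) (h.continuousAt_weight hU hs (hreg t) β r₀)
      (by fun_prop)

lemma weight_nonneg (β r₀ : ℝ) (c : ℝ → ℝ → E2) (s t : ℝ) : 0 ≤ weight β r₀ c s t := by
  unfold weight sliceA; positivity

end continuity

/-! ### Comparison of the slices -/

/-- The slice at height `s` of the surface swept out by `c'` contributes at most as much as that of
`c`, for all Gaussians; together with the crude bounds needed for integrability. -/
structure SliceLE (β r₀ : ℝ) (c' c : ℝ → ℝ → E2) (s : ℝ) : Prop where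
  regular : ∀ t, dAngle c' s t ≠ 0
  norm_le : ∀ t, ‖c' s t‖ ≤ 2
  weight_le : ∀ t, weight β r₀ c' s t ≤ 14
  integral_le : ∀ Q : E2,
    ∫ t in Set.Icc (0 : ℝ) 1, weight β r₀ c' s t * Real.exp (inner ℝ Q (c' s t)) ≤
      ∫ t in Set.Icc (0 : ℝ) 1, weight β r₀ c s t * Real.exp (inner ℝ Q (c s t))

section compare
variable {U : Set ℝ} {c σ : ℝ → ℝ → E2} {s β r₀ ζ ε Λ : ℝ}

lemma NearRound.norm_le (h : ∀ t, NearRound ζ c s t) (hζ : ζ ≤ 1 / 100000) (t : ℝ) :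
    ‖c s t‖ ≤ 1 + 1 / 100000 := by
  have h1 := (h t).pos
  calc ‖c s t‖ = ‖(c s t - circle t) + circle t‖ := by congr 1; abel
    _ ≤ _ := (norm_add_le _ _).trans (by rw [norm_circle]; linarith)

lemma NearRound.regular (h : NearRound ζ c s t) (hζ : ζ ≤ 1 / 100000) : dAngle c s t ≠ 0 := by
  rw [← norm_pos_iff]
  have := abs_le.1 (norm_sub_one_le (by rw [norm_rot, norm_circle]) h.ang)
  linarith

lemma roundWeight_le (hβ : 0 ≤ β) (hr : 0 ≤ r₀) : roundWeight β r₀ ≤ 7 := by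
  have h1 : Real.exp (-β - r₀) ≤ 1 := Real.exp_le_one_iff.2 (by linarith)
  have := Real.pi_lt_d2
  have := Real.pi_pos
  have h0 := Real.exp_pos (-β - r₀)
  unfold roundWeight
  nlinarith

/-- The slices of a nearly round family satisfy the crude bounds. -/
lemma sliceLE_self (hζ : ζ ≤ 1 / 100000) (hβ : 0 ≤ β) (hr : 0 ≤ r₀)
    (h : ∀ t, NearRound ζ c s t)
    (hW : ∀ t, |weight β r₀ c s t - roundWeight β r₀| ≤ 1 / 100000 * roundWeight β r₀) :
    SliceLE β r₀ c c s where
  regular t := (h t).regular hζ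
  norm_le t := (NearRound.norm_le h hζ t).trans (by norm_num)
  weight_le t := by
    have h1 := (abs_le.1 (hW t)).2
    have h2 := roundWeight_le hβ hr
    linarith
  integral_le _ := le_rfl

/-- Bending the nearly round cross sections `σ` inwards decreases the integral, as long as `σ` is
much closer to the original cross sections than the amount of the bending. -/
lemma exists_sliceLE_bend : ∃ ζ > 0, ζ ≤ 1 / 100000 ∧
    (∀ (c : ℝ → ℝ → E2) (s t β r₀ : ℝ), 0 ≤ β → β ≤ 1 → 0 ≤ r₀ → r₀ ≤ 1 → NearRound ζ c s t →
      |bendDet c s t - 1| ≤ ζ →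
      |weight β r₀ c s t - roundWeight β r₀| ≤ 1 / 100000 * roundWeight β r₀) ∧
    ∀ (U : Set ℝ) (c σ : ℝ → ℝ → E2) (s β r₀ ε Λ : ℝ), IsOpen U → U ⊆ Set.Ioi 0 →
      SmoothStrip U σ → SmoothStrip U c → s ∈ U → s ≤ Λ → 1 / Λ ≤ ζ → 2 / Λ ^ 2 ≤ ζ →
      (∀ t, NearRound ζ σ s t) → (∀ t, NearRound ζ c s t) → (∀ t, |bendDet c s t - 1| ≤ ζ) →
      (∀ t, JetClose ε σ c s t) → (∀ t, bendDet c s t - ε ≤ bendDet σ s t) →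
      ε ≤ ζ → ε ≤ gap Λ s / 100000 → 0 ≤ β → β ≤ 9 / 20 → 1 / 1000 ≤ r₀ → r₀ ≤ 1 →
      SliceLE β r₀ (fun s t => bend Λ s • σ s t) c s := by
  obtain ⟨ζ₁, h1, h1', hw⟩ := exists_abs_weight_sub_le
  obtain ⟨ζ₂, h2, h2', hb⟩ := exists_weight_smul_le
  have hnr : ∀ {ζ : ℝ} {c : ℝ → ℝ → E2} {s t : ℝ}, NearRound (min ζ₁ ζ₂) c s t →
      NearRound ζ₁ c s t ∧ NearRound ζ₂ c s t := fun h =>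
    ⟨h.mono (min_le_left _ _), h.mono (min_le_right _ _)⟩
  refine ⟨min ζ₁ ζ₂, lt_min h1 h2, (min_le_left _ _).trans h1', fun c s t β r₀ hβ hβ1 hr hr1 hc
    hJ => hw c s t β r₀ hβ hβ1 hr hr1 (hc.mono (min_le_left _ _)) (hJ.trans (min_le_left _ _)),
    ?_⟩
  intro U c σ s β r₀ ε Λ hU hU0 hσs hcs hs hsΛ hΛ1 hΛ2 hσ hc hJ hcl hJσ hεζ hεu hβ hβ1 hr hr1
  have hs0 : 0 < s := hU0 hs
  have hΛ0 : 0 < Λ := hs0.trans_le hsΛ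
  have hm2 : min ζ₁ ζ₂ ≤ ζ₂ := min_le_right _ _
  have hm1 : min ζ₁ ζ₂ ≤ ζ₁ := min_le_left _ _
  have hu : gap Λ s ≤ 1 / 50 := (gap_mono hΛ0 hs0 hsΛ).trans
    ((gap_self hΛ0).trans_le exp_neg_four_bounds.2)
  have hu0 := gap_pos Λ s
  have hρ : bend Λ s = 1 - gap Λ s := rfl
  have hW : ∀ t, |weight β r₀ c s t - roundWeight β r₀| ≤ 1 / 100000 * roundWeight β r₀ :=
    fun t => hw c s t β r₀ hβ (by linarith) (by linarith) hr1 ((hc t).mono hm1)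
      ((hJ t).trans hm1)
  have hle : ∀ t, weight β r₀ (fun s t => bend Λ s • σ s t) s t ≤
      weight β r₀ c s t * Real.exp (-gap Λ s / 100) := fun t =>
    hb U c σ (bend Λ) (gap Λ) (gap₁ Λ) (gap₂ Λ) s t β r₀ ε hU hσs hs (fun _ _ => rfl)
      (fun s hs => hasDerivAt_gap (hU0 hs)) (fun s hs => hasDerivAt_gap₁ (hU0 hs))
      ((hσ t).mono hm2) ((hc t).mono hm2) ((hJ t).trans hm2) (hcl t) (hJσ t) hu0.le
      (by linarith) (gap₁_nonneg hΛ0) (gap₂_nonneg hΛ0 hs0 (by linarith))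
      (((gap₁_le hΛ0 hs0).trans hΛ1).trans hm2) (((gap₂_le hΛ0 hs0).trans hΛ2).trans hm2)
      (gap₁_le_add hΛ0 hs0 hsΛ) (hεζ.trans hm2) hεu hβ hβ1 hr hr1
  have hσn := NearRound.norm_le hσ (hm1.trans h1')
  refine ⟨fun t => ?_, fun t => ?_, fun t => ?_, fun Q => ?_⟩
  · rw [dAngle_smul]
    exact smul_ne_zero (by rw [hρ]; linarith) ((hσ t).regular (hm1.trans h1'))
  · rw [norm_smul, Real.norm_of_nonneg (by rw [hρ]; linarith), hρ]
    nlinarith [hσn t, norm_nonneg (σ s t)]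
  · refine (hle t).trans ?_
    have h3 := (abs_le.1 (hW t)).2
    have h4 := roundWeight_le (r₀ := r₀) hβ (by linarith)
    have h5 := weight_nonneg β r₀ c s t
    have h6 : Real.exp (-gap Λ s / 100) ≤ 1 := Real.exp_le_one_iff.2 (by linarith)
    nlinarith
  · refine integral_weight_mul_exp_le (ρ := bend Λ s) (roundWeight_pos β r₀)
      (hcs.continuous_slice hs)
      (hcs.continuous_weight hU hs (fun t => (hc t).regular (hm1.trans h1')) β r₀)
      (fun t => (hc t).pos.trans (hm1.trans h1')) hW (by rw [hρ]; linarith)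
      (by rw [hρ]; linarith) (fun t => ?_) (fun t => weight_nonneg _ _ _ _ _) (fun t => ?_) Q
    · rw [← smul_sub, norm_smul, Real.norm_of_nonneg (by rw [hρ]; linarith)]
      have := (hcl t).pos
      have h6 := norm_nonneg (σ s t - c s t)
      rw [hρ]
      nlinarith
    · rw [hρ, sub_sub_cancel]; exact hle t

/-- Replacing nearly round cross sections by the circles of a cap decreases the integral. -/
lemma sliceLE_cap {R R₁ R₂ : ℝ → ℝ} (hU : IsOpen U) (hcs : SmoothStrip U c) (hs : s ∈ U)
    (h1 : ∀ s ∈ U, HasDerivAt R (R₁ s) s) (h2 : ∀ s ∈ U, HasDerivAt R₁ (R₂ s) s)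
    (hR : 0 < R s) (hR1 : R s ≤ 99 / 100) (hR2 : R₂ s ≤ 0)
    (hA : R s * √(1 + R₁ s ^ 2) - 1 + 9 / 20 * (1 - R s ^ 2) ≤ -(1 / 1000))
    (hβ : 0 ≤ β) (hβ1 : β ≤ 9 / 20) (hr : 0 ≤ r₀)
    (hc : ∀ t, NearRound ζ c s t) (hζ : ζ ≤ 1 / 10000000)
    (hW : ∀ t, |weight β r₀ c s t - roundWeight β r₀| ≤ 1 / 100000 * roundWeight β r₀) :
    SliceLE β r₀ (fun s t => R s • circle t) c s := by
  have hw0 := roundWeight_pos β r₀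
  have hle : ∀ t, weight β r₀ (fun s t => R s • circle t) s t ≤
      roundWeight β r₀ * Real.exp (-1 / 1000) := fun t =>
    weight_cap_le hU hs h1 h2 hR (by linarith) hR2 hA hβ1 hr t
  have hreg : ∀ t, dAngle (fun s t => R s • circle t) s t ≠ 0 := by
    intro t
    rw [dAngle_smul, dAngle_circle, ← norm_pos_iff, norm_smul, norm_rot, norm_circle, mul_one]
    exact norm_pos_iff.2 hR.ne'
  have hexp : Real.exp (-1 / 1000) ≤ 1 := Real.exp_le_one_iff.2 (by norm_num)
  refine ⟨hreg, fun t => ?_, fun t => ?_, fun Q => ?_⟩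
  · rw [norm_smul, norm_circle, Real.norm_of_nonneg hR.le]; linarith
  · have := roundWeight_le hβ hr
    nlinarith [hle t]
  · have hcc := contDiff_circle.continuous
    have hint : ∀ {f : ℝ → ℝ}, Continuous f → MeasureTheory.IntegrableOn f (Set.Icc 0 1) :=
      fun hf => hf.continuousOn.integrableOn_compact isCompact_Icc
    -- the circle of radius `99 / 100` is the contraction of `c s` up to an error `ζ ≤ 10⁻⁷`
    have h99 : ∫ t in Set.Icc (0 : ℝ) 1, roundWeight β r₀ * Real.exp (-1 / 1000) *
        Real.exp (inner ℝ Q ((99 / 100 : ℝ) • circle t)) ≤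
        ∫ t in Set.Icc (0 : ℝ) 1, weight β r₀ c s t * Real.exp (inner ℝ Q (c s t)) := by
      refine integral_weight_mul_exp_le (ρ := 99 / 100)
        (W' := fun _ => roundWeight β r₀ * Real.exp (-1 / 1000))
        (x' := fun t => (99 / 100 : ℝ) • circle t) hw0 (hcs.continuous_slice hs)
        (hcs.continuous_weight hU hs (fun t => (hc t).regular (hζ.trans (by norm_num))) β r₀)
        (fun t => (hc t).pos.trans (hζ.trans (by norm_num))) hW (by norm_num) (by norm_num)
        (fun t => ?_) (fun t => by positivity) (fun t => ?_) Q
      · have := (hc t).pos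
        rw [← smul_sub, norm_smul, norm_sub_rev, Real.norm_of_nonneg (by norm_num)]
        linarith
      · have h3 := (abs_le.1 (hW t)).1
        have h4 : Real.exp (-1 / 1000) = Real.exp (-9 / 10000) * Real.exp (-1 / 10000) := by
          rw [← Real.exp_add]; norm_num
        have h5 : Real.exp (-9 / 10000) ≤ 1 - 1 / 100000 := by
          have h6 := Real.add_one_le_exp (9 / 10000 : ℝ)
          have h7 : Real.exp (-9 / 10000) = (Real.exp (9 / 10000))⁻¹ := by
            rw [← Real.exp_neg]; norm_num
          rw [h7, inv_le_comm₀ (Real.exp_pos _) (by norm_num)]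
          refine le_trans ?_ h6
          norm_num
        have h8 : (-(1 - 99 / 100) / 100 : ℝ) = -1 / 10000 := by norm_num
        rw [h8, h4, ← mul_assoc]
        have h9 := Real.exp_pos (-1 / 10000)
        have h10 : roundWeight β r₀ * Real.exp (-9 / 10000) ≤ weight β r₀ c s t := by nlinarith
        gcongr
    refine le_trans ?_ h99
    have h3 : ∫ t in Set.Icc (0 : ℝ) 1, weight β r₀ (fun s t => R s • circle t) s t *
          Real.exp (inner ℝ Q (R s • circle t)) ≤
        ∫ t in Set.Icc (0 : ℝ) 1, roundWeight β r₀ * Real.exp (-1 / 1000) *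
          Real.exp (inner ℝ Q (R s • circle t)) := by
      refine MeasureTheory.integral_mono_of_nonneg
        (Filter.Eventually.of_forall fun t => mul_nonneg (weight_nonneg _ _ _ _ _)
          (Real.exp_pos _).le) (hint (by fun_prop))
        (Filter.Eventually.of_forall fun t => ?_)
      exact mul_le_mul_of_nonneg_right (hle t) (Real.exp_pos _).le
    refine h3.trans ?_
    rw [MeasureTheory.integral_const_mul, MeasureTheory.integral_const_mul]
    exact mul_le_mul_of_nonneg_left (integral_exp_circle_mono hR.le hR1 Q) (by positivity)

end compare

/-! ### Integration over the height -/

/-- The comparison over the heights in `(a, b]`. -/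
def IntegralLE (f' f : ℝ × ℝ → ℝ) (a b : ℝ) : Prop :=
  MeasureTheory.IntegrableOn f' (Set.Ioc a b ×ˢ Set.Icc 0 1) ∧
  MeasureTheory.IntegrableOn f (Set.Ioc a b ×ˢ Set.Icc 0 1) ∧
  ∫ z in Set.Ioc a b ×ˢ Set.Icc 0 1, f' z ≤ ∫ z in Set.Ioc a b ×ˢ Set.Icc 0 1, f z

section fubini
open MeasureTheory

/-- Adjacent ranges of heights may be joined. -/
lemma IntegralLE.trans {f' f : ℝ × ℝ → ℝ} {a b d : ℝ} (h1 : IntegralLE f' f a b)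
    (h2 : IntegralLE f' f b d) (hab : a ≤ b) (hbd : b ≤ d) : IntegralLE f' f a d := by
  have hu : Set.Ioc a d ×ˢ Set.Icc (0 : ℝ) 1 =
      Set.Ioc a b ×ˢ Set.Icc 0 1 ∪ Set.Ioc b d ×ˢ Set.Icc 0 1 := by
    rw [← Set.union_prod, Set.Ioc_union_Ioc_eq_Ioc hab hbd]
  have hdis : Disjoint (Set.Ioc a b ×ˢ Set.Icc (0 : ℝ) 1) (Set.Ioc b d ×ˢ Set.Icc 0 1) :=
    Set.Disjoint.set_prod_left (Set.Ioc_disjoint_Ioc_of_le le_rfl) _ _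
  have hm : MeasurableSet (Set.Ioc b d ×ˢ Set.Icc (0 : ℝ) 1) :=
    measurableSet_Ioc.prod measurableSet_Icc
  refine ⟨?_, ?_, ?_⟩
  · rw [hu]; exact h1.1.union h2.1
  · rw [hu]; exact h1.2.1.union h2.2.1
  · rw [hu, setIntegral_union hdis hm h1.1 h2.1, setIntegral_union hdis hm h1.2.1 h2.2.1]
    exact add_le_add h1.2.2 h2.2.2

/-- The integrand is continuous on the open strip and bounded there. -/
lemma SmoothStrip.integrableOn_density {c : ℝ → ℝ → E2} {a b r₀ τ : ℝ}
    (h : SmoothStrip (Set.Ioo a b) c) (hτ : 0 < τ) (p : E3)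
    (hreg : ∀ s ∈ Set.Ioo a b, ∀ t, dAngle c s t ≠ 0)
    (hn : ∀ s ∈ Set.Ioo a b, ∀ t, ‖c s t‖ ≤ 2)
    (hw : ∀ s ∈ Set.Ioo a b, ∀ t, weight (1 / (4 * τ)) r₀ c s t ≤ 14) :
    IntegrableOn (density (sweep c) r₀ τ p) (Set.Ioo a b ×ˢ Set.Icc 0 1) := by
  have hm : MeasurableSet (Set.Ioo a b ×ˢ Set.Icc (0 : ℝ) 1) :=
    measurableSet_Ioo.prod measurableSet_Icc
  set Q := (1 / (2 * τ)) • horizontal p with hQ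
  set G : ℝ × ℝ → ℝ := fun z =>
    Real.exp (-(‖horizontal p‖ ^ 2 + (z.1 - p 2) ^ 2) / (4 * τ)) *
      (weight (1 / (4 * τ)) r₀ c z.1 z.2 * Real.exp (inner ℝ Q (c z.1 z.2))) with hG
  have heq : Set.EqOn G (density (sweep c) r₀ τ p) (Set.Ioo a b ×ˢ Set.Icc 0 1) := by
    rintro ⟨s, t⟩ ⟨hs, -⟩
    exact (h.density_eq isOpen_Ioo hs hτ p t).symm
  refine IntegrableOn.congr_fun ?_ heq hm
  refine ⟨?_, .restrict_of_bounded (C := 14 * Real.exp (‖Q‖ * 2)) ?_ ?_⟩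
  rotate_left
  · rw [Measure.volume_eq_prod, Measure.prod_prod]
    exact ENNReal.mul_lt_top measure_Ioo_lt_top measure_Icc_lt_top
  rotate_left
  · refine ContinuousOn.aestronglyMeasurable ?_ hm
    rintro ⟨s, t⟩ ⟨hs, -⟩
    refine ContinuousAt.continuousWithinAt ?_
    have c0 := (h.contDiffAt isOpen_Ioo hs t).continuousAt
    refine ContinuousAt.mul ?_ ((h.continuousAt_weight isOpen_Ioo hs (hreg s hs t) _ _).mul
      (Real.continuous_exp.continuousAt.comp ((continuousAt_const (y := Q)).inner c0)))
    exact Continuous.continuousAt (by fun_prop)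
  · refine (ae_restrict_iff' hm).2 (Filter.Eventually.of_forall ?_)
    rintro ⟨s, t⟩ ⟨hs, -⟩
    have h1 := weight_nonneg (1 / (4 * τ)) r₀ c s t
    have h2 := hw s hs t
    have h3 : Real.exp (inner ℝ Q (c s t)) ≤ Real.exp (‖Q‖ * 2) :=
      Real.exp_le_exp.2 ((real_inner_le_norm _ _).trans (by gcongr; exact hn s hs t))
    have h4 : Real.exp (-(‖horizontal p‖ ^ 2 + (s - p 2) ^ 2) / (4 * τ)) ≤ 1 := by
      apply Real.exp_le_one_iff.2
      rw [neg_div]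
      have : 0 ≤ (‖horizontal p‖ ^ 2 + (s - p 2) ^ 2) / (4 * τ) := by positivity
      linarith
    have h5 : 0 ≤ G (s, t) := by simp only [hG]; positivity
    rw [Real.norm_of_nonneg h5]
    calc G (s, t) ≤ 1 * (14 * Real.exp (‖Q‖ * 2)) := by
          simp only [hG]; gcongr
      _ = _ := one_mul _

/-- The comparison of the surfaces follows from that of the slices. -/
lemma integralLE_of_sliceLE {c c₁ c₂ : ℝ → ℝ → E2} {a b r₀ τ : ℝ} (hτ : 0 < τ) (p : E3)
    (heq : ∀ s ∈ Set.Ioo a b, c₂ s = c₁ s) (h₁ : SmoothStrip (Set.Ioo a b) c₁)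
    (h : SmoothStrip (Set.Ioo a b) c)
    (hs₁ : ∀ s ∈ Set.Ioo a b, SliceLE (1 / (4 * τ)) r₀ c₁ c s)
    (hs : ∀ s ∈ Set.Ioo a b, SliceLE (1 / (4 * τ)) r₀ c c s) :
    IntegralLE (density (sweep c₂) r₀ τ p) (density (sweep c) r₀ τ p) a b := by
  have hae : (Set.Ioo a b ×ˢ Set.Icc (0 : ℝ) 1 : Set (ℝ × ℝ)) =ᵐ[volume]
      (Set.Ioc a b ×ˢ Set.Icc 0 1 : Set (ℝ × ℝ)) := by
    rw [Measure.volume_eq_prod]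
    exact Measure.set_prod_ae_eq Ioo_ae_eq_Ioc (Filter.EventuallyEq.refl _ _)
  have hm : MeasurableSet (Set.Ioo a b ×ˢ Set.Icc (0 : ℝ) 1) :=
    measurableSet_Ioo.prod measurableSet_Icc
  have hi₁ := h₁.integrableOn_density hτ p (fun s hs => (hs₁ s hs).regular)
    (fun s hs => (hs₁ s hs).norm_le) (fun s hs => (hs₁ s hs).weight_le)
  have hi := h.integrableOn_density hτ p (fun s hs' => (hs s hs').regular)
    (fun s hs' => (hs s hs').norm_le) (fun s hs' => (hs s hs').weight_le)
  have hcongr : Set.EqOn (density (sweep c₁) r₀ τ p) (density (sweep c₂) r₀ τ p)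
      (Set.Ioo a b ×ˢ Set.Icc 0 1) := by
    rintro ⟨s, t⟩ ⟨hs', -⟩
    exact (density_congr isOpen_Ioo heq hs' r₀ τ p t).symm
  have hi₂ := hi₁.congr_fun hcongr hm
  refine ⟨hi₂.congr_set_ae hae.symm, hi.congr_set_ae hae.symm, ?_⟩
  rw [← setIntegral_congr_set hae, ← setIntegral_congr_set hae,
    ← setIntegral_congr_fun hm hcongr, Measure.volume_eq_prod]
  rw [Measure.volume_eq_prod] at hi₁ hi
  rw [setIntegral_prod _ hi₁, setIntegral_prod _ hi]
  have hIi : ∀ {f : ℝ × ℝ → ℝ},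
      IntegrableOn f (Set.Ioo a b ×ˢ Set.Icc (0 : ℝ) 1) (volume.prod volume) →
      IntegrableOn (fun s => ∫ t in Set.Icc (0 : ℝ) 1, f (s, t)) (Set.Ioo a b) := by
    intro f hf
    rw [IntegrableOn, ← Measure.prod_restrict] at hf
    exact hf.integral_prod_left
  refine setIntegral_mono_on (hIi hi₁) (hIi hi) measurableSet_Ioo fun s hs' => ?_
  simp only [h₁.density_eq isOpen_Ioo hs' hτ p, h.density_eq isOpen_Ioo hs' hτ p]
  rw [integral_const_mul, integral_const_mul]
  exact mul_le_mul_of_nonneg_left ((hs₁ s hs').integral_le _) (Real.exp_pos _).le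

end fubini

/-! ### Passing between nearly round families -/

section jets
variable {c c' c'' : ℝ → ℝ → E2} {s t x y : ℝ}

lemma norm_sub_le_add {u v w : E2} (h1 : ‖u - w‖ ≤ x) (h2 : ‖v - w‖ ≤ y) : ‖u - v‖ ≤ x + y := by
  rw [norm_sub_rev] at h2
  exact (norm_sub_le_norm_sub_add_norm_sub u w v).trans (add_le_add h1 h2)

lemma JetClose.trans_symm (h1 : JetClose x c c'' s t) (h2 : JetClose y c' c'' s t) :
    JetClose (x + y) c c' s t :=
  ⟨norm_sub_le_add h1.pos h2.pos, norm_sub_le_add h1.ang h2.ang, norm_sub_le_add h1.ht h2.ht,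
    norm_sub_le_add h1.ht2 h2.ht2, norm_sub_le_add h1.htAng h2.htAng⟩

lemma NearRound.jetClose (h1 : NearRound x c s t) (h2 : NearRound y c' s t) :
    JetClose (x + y) c c' s t :=
  ⟨norm_sub_le_add h1.pos h2.pos, norm_sub_le_add h1.ang h2.ang,
    (norm_sub_le _ _).trans (add_le_add h1.ht h2.ht),
    (norm_sub_le _ _).trans (add_le_add h1.ht2 h2.ht2),
    (norm_sub_le _ _).trans (add_le_add h1.htAng h2.htAng)⟩

lemma JetClose.mono (h : JetClose x c c' s t) (hx : x ≤ y) : JetClose y c c' s t :=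
  ⟨h.pos.trans hx, h.ang.trans hx, h.ht.trans hx, h.ht2.trans hx, h.htAng.trans hx⟩

lemma JetClose.nearRound (h1 : JetClose x c c' s t) (h2 : NearRound y c' s t) :
    NearRound (x + y) c s t := by
  have h3 : ∀ {u v : E2}, ‖u - v‖ ≤ x → ‖v‖ ≤ y → ‖u‖ ≤ x + y := fun {u v} hu hv => by
    calc ‖u‖ = ‖(u - v) + v‖ := by rw [sub_add_cancel]
      _ ≤ _ := (norm_add_le _ _).trans (add_le_add hu hv)
  have h4 : ∀ {u v w : E2}, ‖u - v‖ ≤ x → ‖v - w‖ ≤ y → ‖u - w‖ ≤ x + y := fun hu hv =>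
    (norm_sub_le_norm_sub_add_norm_sub _ _ _).trans (add_le_add hu hv)
  exact ⟨h4 h1.pos h2.pos, h4 h1.ang h2.ang, h3 h1.ht h2.ht, h3 h1.ht2 h2.ht2,
    h3 h1.htAng h2.htAng⟩

lemma SmoothStrip.smul {U : Set ℝ} {ρ : ℝ → ℝ} (h : SmoothStrip U c) (hρ : ContDiffOn ℝ ∞ ρ U) :
    SmoothStrip U (fun s t => ρ s • c s t) := by
  have h1 : ContDiffOn ℝ ∞ (fun z : ℝ × ℝ => ρ z.1) (U ×ˢ Set.univ) :=
    hρ.comp contDiffOn_fst fun z hz => hz.1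
  exact ContDiffOn.smul h1 h

end jets

/-! ### The cutoff function -/

/-- A continuous function which is constant on either side of `[1, 2]` is bounded. -/
lemma exists_abs_le_of_eventually_const {f : ℝ → ℝ} (hf : Continuous f) {x y : ℝ}
    (h1 : ∀ z < 1, f z = x) (h2 : ∀ z, 2 < z → f z = y) : ∃ M, ∀ z, |f z| ≤ M := by
  obtain ⟨M, hM⟩ := (isCompact_Icc (a := (0 : ℝ)) (b := 3)).exists_bound_of_continuousOn
    hf.continuousOn
  refine ⟨M, fun z => ?_⟩
  rcases lt_or_ge z 1 with h | h
  · rw [h1 z h, ← h1 0 one_pos]; exact hM 0 (by simp)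
  rcases lt_or_ge 2 z with h' | h'
  · rw [h2 z h', ← h2 3 (by norm_num)]; exact hM 3 (by simp)
  · exact hM z ⟨by linarith, by linarith⟩

lemma deriv_eq_zero_of_eventually_const {f : ℝ → ℝ} {x y : ℝ}
    (h1 : ∀ z < 1, f z = x) (h2 : ∀ z, 2 < z → f z = y) :
    (∀ z < 1, deriv f z = 0) ∧ ∀ z, 2 < z → deriv f z = 0 := by
  constructor
  · intro z hz
    have : f =ᶠ[𝓝 z] fun _ => x := by
      filter_upwards [Iio_mem_nhds hz] with w hw using h1 w hw
    rw [this.deriv_eq, deriv_const]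
  · intro z hz
    have : f =ᶠ[𝓝 z] fun _ => y := by
      filter_upwards [Ioi_mem_nhds hz] with w hw using h2 w hw
    rw [this.deriv_eq, deriv_const]

/-- The cutoff function need not take values in `[0, 1]`, but it is bounded along with its first two
derivatives, which vanish outside `[1, 2]`. -/
lemma IsCutoff.exists_bound {χ : ℝ → ℝ} (hχ : IsCutoff χ) : ∃ M, 1 ≤ M ∧
    ∀ z, |χ z| ≤ M ∧ |deriv χ z| ≤ M ∧ |deriv (deriv χ) z| ≤ M := by
  have s1 := ((contDiff_infty_iff_deriv (𝕜 := ℝ)).1 hχ.smooth).2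
  have s2 := ((contDiff_infty_iff_deriv (𝕜 := ℝ)).1 s1).2
  have a0 : ∀ z < 1, χ z = 1 := fun z hz => hχ.eq_one z hz.le
  have b0 : ∀ z, 2 < z → χ z = 0 := fun z hz => hχ.eq_zero z hz.le
  obtain ⟨a1, b1⟩ := deriv_eq_zero_of_eventually_const a0 b0
  obtain ⟨a2, b2⟩ := deriv_eq_zero_of_eventually_const a1 b1
  obtain ⟨M₀, h0⟩ := exists_abs_le_of_eventually_const hχ.smooth.continuous a0 b0
  obtain ⟨M₁, h1⟩ := exists_abs_le_of_eventually_const s1.continuous a1 b1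
  obtain ⟨M₂, h2⟩ := exists_abs_le_of_eventually_const s2.continuous a2 b2
  have p1 := (abs_nonneg _).trans (h1 0)
  have p2 := (abs_nonneg _).trans (h2 0)
  have p0 : 1 ≤ M₀ := by simpa [a0 0 one_pos] using h0 0
  exact ⟨M₀ + M₁ + M₂, by linarith, fun z => ⟨by linarith [h0 z], by linarith [h1 z],
    by linarith [h2 z]⟩⟩

/-! ### The cross sections near the model cross section -/

section neck
variable {om : ℝ → ℝ} {C δ ε L θ : ℝ} {N : Set E3} {γ : ℝ → E2} {γs γt : ℝ → ℝ → E2}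

/-- The cross section of a neck is nearly a round unit circle, including its curvature. -/
lemma IsNeck.bounds (hN : IsNeck δ ε L γ N) (hR : IsRounding om δ γ γt) (hθ : 0 < θ)
    (hθ1 : θ ≤ 1 / 1000) (hδ : 0 < δ) (hδθ : δ ≤ θ) (hom : om δ ≤ θ ^ 2) :
    (∀ t, ‖(2 * Real.pi)⁻¹ • deriv γ t‖ ≤ 101 / 100) ∧ (∀ t, curvature γ t ≤ 2) ∧
      ∀ s t, NearRound θ (fun _ t => γ t) s t ∧ |bendDet (fun _ t => γ t) s t - 1| ≤ 20 * θ := by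
  have hb : ∀ t, ‖γ t - circle t‖ ≤ om δ ∧
      ‖(2 * Real.pi)⁻¹ • deriv γ t - rot (circle t)‖ ≤ om δ := by
    intro t
    have := hR.norm_sub_circle_le le_rfl zero_le_one t
    rwa [dAngle, hR.eq_zero] at this
  have ho0 := hR.om_nonneg
  have hoθ : om δ ≤ θ / 1000 := hom.trans (by nlinarith)
  have hm : ∀ t, ‖(2 * Real.pi)⁻¹ • deriv γ t‖ ≤ 1 + om δ := fun t => by
    have := abs_le.1 (norm_sub_one_le (by rw [norm_rot, norm_circle]) (hb t).2)
    linarith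
  have hκ : ∀ t, curvature γ t ≤ 1 + 3 * θ :=
    hN.curve.curvature_le hθ hθ1 hom (fun t => (hb t).2) (fun t => (hN.noncollapsed t).1)
      fun t => (Finset.single_le_sum (f := fun l => |(arcDeriv γ)^[l] (curvature γ) t|)
        (fun l _ => abs_nonneg _) (Finset.mem_Icc.2 ⟨le_rfl, by norm_num⟩ :
          1 ∈ Finset.Icc 1 18)).trans (hN.curvature_deriv t)
  refine ⟨fun t => (hm t).trans (by linarith), fun t => (hκ t).trans (by linarith),
    fun s t => ⟨⟨(hb t).1.trans (by linarith), (hb t).2.trans (by linarith), ?_, ?_, ?_⟩, ?_⟩⟩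
  · rw [dHeight_const, norm_zero]; exact hθ.le
  · rw [dHeight_dHeight_const, norm_zero]; exact hθ.le
  · rw [dHeight_dAngle_const, norm_zero]; exact hθ.le
  · rw [abs_le]
    constructor
    · have := bendDet_ge_of_noncollapsed (c := fun _ t => γ t) (s := s) (η := om δ)
        (by linarith) hδ (by linarith) (hN.curve.regular t) hN.noncollapsed (fun t => (hb t).1)
        (hb t).2
      linarith
    · rw [bendDet_eq_curvature (fun _ t => γ t) (hN.curve.regular t)]
      have h1 : ‖dAngle (fun _ t => γ t) s t‖ ^ 3 ≤ (1 + θ / 1000) ^ 3 := by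
        gcongr; exact (hm t).trans (by linarith)
      have h2 : (1 + θ / 1000) ^ 3 ≤ 1 + θ := by nlinarith
      have h3 := (hN.noncollapsed t).1
      have h4 : curvature γ t * ‖dAngle (fun _ t => γ t) s t‖ ^ 3 ≤ (1 + 3 * θ) * (1 + θ) := by
        apply mul_le_mul (hκ t) (h1.trans h2) (by positivity) (by linarith)
      nlinarith

/-- Interpolations between the cross sections of a neck and its model cross section are nearly
round. -/
lemma IsSliceFamily.perturbation {U : Set ℝ} {μ μ₁ μ₂ : ℝ → ℝ} {M s : ℝ}
    (hS : IsSliceFamily C ε L γ N γs) (hN : IsNeck δ ε L γ N) (hR : IsRounding om δ γ γt)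
    (hθ : 0 < θ) (hθ1 : θ ≤ 1 / 1000) (hδ : 0 < δ) (hδθ : δ ≤ θ) (hom : om δ ≤ θ ^ 2)
    (hM : 1 ≤ M) (hd : 5 * M ^ 2 * (C * ε) ≤ θ) (hU : IsOpen U)
    (hUL : U ⊆ Set.Ioo (-(L - 1)) (L - 1))
    (hμ : ∀ s ∈ U, HasDerivAt μ (μ₁ s) s) (hμ₁ : ∀ s ∈ U, HasDerivAt μ₁ (μ₂ s) s)
    (hs : s ∈ U) (b0 : |μ s| ≤ M) (b1 : |μ₁ s| ≤ M) (b2 : |μ₂ s| ≤ M) (t : ℝ) :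
    NearRound (2 * θ) (fun s t => γ t + μ s • (γs s t - γ t)) s t ∧
    |bendDet (fun s t => γ t + μ s • (γs s t - γ t)) s t - 1| ≤ 21 * θ ∧
    JetClose (5 * M ^ 2 * (C * ε)) (fun s t => γ t + μ s • (γs s t - γ t)) (fun _ t => γ t) s t ∧
    |bendDet (fun s t => γ t + μ s • (γs s t - γ t)) s t - bendDet (fun _ t => γ t) s t| ≤
        5 * M ^ 2 * (C * ε) := by
  obtain ⟨hm, hκ, hγ⟩ := hN.bounds hR hθ hθ1 hδ hδθ hom
  have hε0 : 0 ≤ C * ε := le_trans (Finset.sum_nonneg fun k _ =>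
    Finset.sum_nonneg fun l _ => norm_nonneg _) (hS.close s (hUL hs) t)
  have hε1 : C * ε ≤ 1 := by nlinarith
  have hF : SmoothStrip U (fun s t => γs s t - γ t) := by
    refine ContDiffOn.sub (hS.smooth.mono (Set.prod_mono hUL subset_rfl)) ?_
    exact (hN.curve.smooth.comp contDiff_snd).contDiffOn
  obtain ⟨h1, h2⟩ := perturbation_bounds hU hN.curve hm (fun t => (hN.noncollapsed t).1) hκ hF
    (fun s hs => hS.close s (hUL hs)) hε1 hμ hμ₁ hM hs b0 b1 b2 t
  obtain ⟨h3, h4⟩ := hγ s t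
  refine ⟨(h1.nearRound h3).mono (by linarith), ?_, h1, h2⟩
  rw [abs_le] at h2 h4 ⊢
  constructor <;> linarith

end neck

/-! ### The cross sections of the modified surface -/

section pieces
variable {χ Φ : ℝ → ℝ} {Λ : ℝ} {γ : ℝ → E2} {γs γt : ℝ → ℝ → E2}

lemma modifiedSlice_of_le_quarterRoot {s : ℝ} (h0 : 0 < s) (h1 : s ≤ quarterRoot Λ) :
    modifiedSlice χ Φ Λ γ γs γt s = fun t => bend Λ s • γs s t := by
  ext1 t; rw [modifiedSlice, if_neg h0.not_ge, if_pos h1]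

/-- Up to height `Λ / 4` the homotopy has not started and the cutoff function vanishes beyond
`2 Λ^{1/4}`, so the interpolation formula persists. -/
lemma modifiedSlice_of_le_quarter {om : ℝ → ℝ} {δ s : ℝ} (hχ : IsCutoff χ)
    (hR : IsRounding om δ γ γt) (hl : 0 < quarterRoot Λ) (hΛ : 0 < Λ) (h0 : quarterRoot Λ < s)
    (h1 : s ≤ Λ / 4) :
    modifiedSlice χ Φ Λ γ γs γt s =
      fun t => bend Λ s • (γ t + χ (s / quarterRoot Λ) • (γs s t - γ t)) := by
  ext1 t
  rw [modifiedSlice, if_neg (by linarith), if_neg (by linarith)]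
  split_ifs with h2 h3
  · congr 1; module
  · have h4 : γt (s / Λ) t = γ t := hR.start _ (by rw [div_le_iff₀ hΛ]; linarith) t
    have h5 : χ (s / quarterRoot Λ) = 0 := hχ.eq_zero _ (by
      rw [le_div_iff₀ hl]; linarith)
    rw [h4, h5, zero_smul, add_zero]
  · exact absurd (by linarith) h3

lemma modifiedSlice_of_le {s : ℝ} (hl : 0 < quarterRoot Λ) (h0 : 2 * quarterRoot Λ < s)
    (h1 : s ≤ Λ) : modifiedSlice χ Φ Λ γ γs γt s = fun t => bend Λ s • γt (s / Λ) t := by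
  ext1 t
  rw [modifiedSlice, if_neg (by linarith), if_neg (by linarith), if_neg (by linarith),
    if_pos h1]

lemma modifiedSlice_of_gt {s : ℝ} (hl : 0 < quarterRoot Λ) (hlΛ : 2 * quarterRoot Λ < Λ)
    (h0 : Λ < s) :
    modifiedSlice χ Φ Λ γ γs γt s = fun t => (1 / 2 * capProfile Φ Λ s) • circle t := by
  ext1 t
  rw [modifiedSlice, if_neg (by linarith), if_neg (by linarith), if_neg (by linarith),
    if_neg (by linarith)]

lemma modifiedSlice_junction {s : ℝ} (hl : 0 < quarterRoot Λ) (hlΛ : 2 * quarterRoot Λ < Λ)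
    (h0 : Λ < s) (h1 : s ≤ Λ + quarterRoot Λ) :
    modifiedSlice χ Φ Λ γ γs γt s = fun t => junctionRadius Φ Λ s • circle t := by
  rw [modifiedSlice_of_gt hl hlΛ h0, capProfile, if_pos h1, junctionRadius]

lemma modifiedSlice_tip {s : ℝ} (hl : 0 < quarterRoot Λ) (hlΛ : 2 * quarterRoot Λ < Λ)
    (h0 : Λ + quarterRoot Λ < s) :
    modifiedSlice χ Φ Λ γ γs γt s = fun t => tipProfile Λ s • circle t := by
  rw [modifiedSlice_of_gt hl hlΛ (by linarith), capProfile, if_neg h0.not_ge]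
  ext1 t; congr 1; ring

end pieces

/-- The hypotheses do not bound the second derivatives of the homotopy in the angle; noncollapsing takes
the place of such a bound. -/
lemma IsRounding.bendDet_ge {om : ℝ → ℝ} {δ : ℝ} {γ : ℝ → E2} {γt : ℝ → ℝ → E2}
    (h : IsRounding om δ γ γt) {Λ s : ℝ} (hΛ : 1 ≤ Λ) (hs0 : 0 ≤ s) (hs1 : s ≤ Λ)
    (hδ : 0 < δ) (hδ' : δ ≤ 1 / 1000) (hom : om δ ≤ 1 / 1000) (t : ℝ) :
    1 - δ - 14 * om δ ≤ bendDet (fun s t => γt (s / Λ) t) s t :=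
  bendDet_ge_of_noncollapsed (c := fun s t => γt (s / Λ) t) hom hδ hδ'
    ((h.curve _).regular t) (h.noncollapsed _) (fun t => (h.nearRound hΛ hs0 hs1 t).pos)
    (h.nearRound hΛ hs0 hs1 t).ang

lemma tipProfile_le {Λ s : ℝ} (ha : 0 < capConst Λ) (hs : s < tipHeight Λ) :
    tipProfile Λ s ≤ capConst Λ := by
  have h1 := tipProfile_sq ha hs
  have h2 : 0 ≤ capConst Λ / (capConst Λ + tipHeight Λ - s) := div_nonneg ha.le (by linarith)
  refine (sq_le_sq₀ (tipProfile_pos ha hs).le ha.le).1 ?_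
  rw [h1]
  nlinarith [sq_nonneg (capConst Λ)]

lemma quarterRoot_bounds {Λ : ℝ} (h : 1000 ^ 4 < Λ) :
    1000 ≤ quarterRoot Λ ∧ 8 * quarterRoot Λ < Λ := by
  have hΛ0 : 0 < Λ := lt_trans (by norm_num) h
  have h4 := quarterRoot_pow_four hΛ0.le
  have h0 : 0 ≤ quarterRoot Λ := Real.rpow_nonneg hΛ0.le _
  have h1 : 1000 < quarterRoot Λ := lt_of_pow_lt_pow_left₀ 4 h0 (by rwa [h4])
  refine ⟨h1.le, ?_⟩
  have h3 : 8 < quarterRoot Λ ^ 3 := by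
    calc (8 : ℝ) < 1000 ^ 3 := by norm_num
      _ ≤ quarterRoot Λ ^ 3 := by gcongr
  nlinarith

end NeckSurgery

/-! ### Comparison of the integrals -/

open NeckSurgery in
set_option maxHeartbeats 1000000 in
theorem proposition2p7
    (χ : ℝ → ℝ) (hχ : NeckSurgery.IsCutoff χ)
    (Φ : ℝ → ℝ) (hΦ : NeckSurgery.IsSmoothedAbs Φ)
    (om : ℝ → ℝ) (hom : Filter.Tendsto om (𝓝[>] 0) (𝓝 0))
    (C : ℝ) :
    ∃ (δs Λs : ℝ) (Es : ℝ → ℝ), 0 < δs ∧ 0 < Λs ∧ (∀ Λ, Λs < Λ → 0 < Es Λ) ∧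
      ∀ δ Λ ε L : ℝ, 0 < δ → δ < δs → Λs < Λ → 0 < ε → ε < Es Λ →
        NeckSurgery.tipHeight Λ + 1 ≤ L →
      ∀ (N : Set NeckSurgery.E3) (γ : ℝ → NeckSurgery.E2) (γs γt : ℝ → ℝ → NeckSurgery.E2),
        NeckSurgery.IsNeck δ ε L γ N →
        NeckSurgery.IsSliceFamily C ε L γ N γs →
        NeckSurgery.IsRounding om δ γ γt →
      ∀ (r₀ τ : ℝ) (p : NeckSurgery.E3), r₀ ∈ Set.Icc (1 / 1000) 1 → 5 / 9 ≤ τ →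
        MeasureTheory.IntegrableOn
          (NeckSurgery.density
            (NeckSurgery.sweep (NeckSurgery.modifiedSlice χ Φ Λ γ γs γt)) r₀ τ p)
          (NeckSurgery.paramDomain Λ) ∧
        MeasureTheory.IntegrableOn
          (NeckSurgery.density (NeckSurgery.sweep γs) r₀ τ p)
          (NeckSurgery.paramDomain Λ) ∧
        ∫ z in NeckSurgery.paramDomain Λ,
            NeckSurgery.density
              (NeckSurgery.sweep (NeckSurgery.modifiedSlice χ Φ Λ γ γs γt)) r₀ τ p z
          ≤ ∫ z in NeckSurgery.paramDomain Λ,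
            NeckSurgery.density (NeckSurgery.sweep γs) r₀ τ p z := by
  obtain ⟨ζ, hζ, hζ1, hweight, hbend⟩ := exists_sliceLE_bend
  obtain ⟨M, hM, hMχ⟩ := hχ.exists_bound
  -- the tolerance for the deviation of all cross sections from the unit circle; `gap Λ s` is at
  -- least `exp (-16)` for `s ≥ Λ / 4`
  obtain ⟨θ, hθ, hθζ, hθe⟩ : ∃ θ > 0, 1000 * θ ≤ ζ ∧ 1000 * θ ≤ Real.exp (-16) / 100000 :=
    ⟨min ζ (Real.exp (-16) / 100000) / 1000, by positivity,
      by linarith [min_le_left ζ (Real.exp (-16) / 100000)],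
      by linarith [min_le_right ζ (Real.exp (-16) / 100000)]⟩
  have hθ1 : θ ≤ 1 / 1000 := by linarith
  obtain ⟨u, hu, hom'⟩ : ∃ u > 0, ∀ δ, 0 < δ → δ < u → om δ ≤ θ ^ 2 := by
    have h1 := hom.eventually (gt_mem_nhds (show (0 : ℝ) < θ ^ 2 by positivity))
    obtain ⟨u, hu, h2⟩ := mem_nhdsGT_iff_exists_Ioo_subset.1 h1
    exact ⟨u, hu, fun δ h3 h4 => (h2 ⟨h3, h4⟩ : om δ < θ ^ 2).le⟩
  refine ⟨min u θ, 1000 ^ 4 + 2 / ζ,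
    fun Λ => θ * gap Λ (quarterRoot Λ) / (1000000 * M ^ 2 * (|C| + 1)), lt_min hu hθ,
    by positivity, fun Λ _ => by have := gap_pos Λ (quarterRoot Λ); positivity, ?_⟩
  intro δ Λ ε L hδ hδs hΛs hε hεs hL N γ γs γt hN hS hR r₀ τ p hr₀ hτ
  have hδu : om δ ≤ θ ^ 2 := hom' δ hδ (hδs.trans_le (min_le_left _ _))
  have hδθ : δ ≤ θ := (hδs.trans_le (min_le_right _ _)).le
  have hζ2 : 0 < 2 / ζ := by positivity
  obtain ⟨hl, hlΛ⟩ := quarterRoot_bounds (show 1000 ^ 4 < Λ by linarith)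
  have hl0 : 0 < quarterRoot Λ := by linarith
  have hΛ0 : 0 < Λ := by linarith
  have hΛ1 : 1 / Λ ≤ ζ := by
    have h1 : 2 / ζ ≤ Λ := by linarith
    rw [div_le_iff₀ hζ] at h1
    rw [div_le_iff₀ hΛ0]; linarith
  have hΛ2 : 2 / Λ ^ 2 ≤ ζ := by
    refine le_trans ?_ hΛ1
    rw [div_le_div_iff₀ (by positivity) hΛ0]; nlinarith
  obtain ⟨ha, ha'⟩ := capConst_bounds hl
  have ha0 : 0 < capConst Λ := by linarith
  have hbL : Set.Ioo 0 (tipHeight Λ) ⊆ Set.Ioo (-(L - 1)) (L - 1) := by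
    intro s hs
    have hb : 0 < tipHeight Λ := hs.1.trans hs.2
    exact ⟨by linarith [hs.1], by linarith [hs.2]⟩
  have hb : tipHeight Λ = Λ + 2 * quarterRoot Λ := rfl
  -- the `C^20` bound is negligible, even compared with the bending at height `quarterRoot Λ`
  have hg0 := gap_pos Λ (quarterRoot Λ)
  have hg1 : gap Λ (quarterRoot Λ) ≤ 1 := by
    have := (gap_mono hΛ0 hl0 (by linarith : quarterRoot Λ ≤ Λ)).trans
      ((gap_self hΛ0).trans_le exp_neg_four_bounds.2)
    linarith
  obtain ⟨d, hd, hdg⟩ : ∃ d, d = 5 * M ^ 2 * (C * ε) ∧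
      d ≤ θ * gap Λ (quarterRoot Λ) / 200000 := by
    refine ⟨_, rfl, ?_⟩
    rw [lt_div_iff₀ (by positivity)] at hεs
    have h1 : C * ε ≤ (|C| + 1) * ε := by gcongr; linarith [le_abs_self C]
    have h2 : 5 * M ^ 2 * (C * ε) ≤ 5 * M ^ 2 * ((|C| + 1) * ε) := by gcongr
    linarith
  have hdθ : d ≤ θ := by
    have : θ * gap Λ (quarterRoot Λ) ≤ θ * 1 := by gcongr
    linarith
  have hdM : ∀ M', 1 ≤ M' → M' ≤ M → 0 ≤ C * ε → 5 * M' ^ 2 * (C * ε) ≤ d := by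
    intro M' h1 h2 h3; rw [hd]; gcongr
  -- the original cross sections are the interpolation with constant parameter `1`
  have hc : ∀ s ∈ Set.Ioo 0 (tipHeight Λ), ∀ t, NearRound (2 * θ) γs s t ∧
      |bendDet γs s t - 1| ≤ 21 * θ ∧ JetClose d γs (fun _ t => γ t) s t ∧
      |bendDet γs s t - bendDet (fun _ t => γ t) s t| ≤ d := by
    intro s hs t
    have := hS.perturbation hN hR hθ hθ1 hδ hδθ hδu hM (hd ▸ hdθ) isOpen_Ioo hbL
      (μ := fun _ => 1) (μ₁ := fun _ => 0) (μ₂ := fun _ => 0)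
      (fun s _ => hasDerivAt_const s 1) (fun s _ => hasDerivAt_const s 0) hs
      (by simpa using hM) (by simp; linarith) (by simp; linarith) t
    simp only [one_smul, add_sub_cancel] at this
    rw [hd]
    exact this
  have hβ : 0 ≤ 1 / (4 * τ) := by positivity
  have hτ0 : 0 < τ := by linarith
  have hβ1 : 1 / (4 * τ) ≤ 9 / 20 := by
    rw [div_le_div_iff₀ (by positivity) (by norm_num)]; linarith
  obtain ⟨hr, hr1⟩ := hr₀
  have hW : ∀ s ∈ Set.Ioo 0 (tipHeight Λ), ∀ t,
      |weight (1 / (4 * τ)) r₀ γs s t - roundWeight (1 / (4 * τ)) r₀| ≤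
        1 / 100000 * roundWeight (1 / (4 * τ)) r₀ := fun s hs t =>
    hweight γs s t _ r₀ hβ (by linarith) (by linarith) hr1
      ((hc s hs t).1.mono (by linarith)) ((hc s hs t).2.1.trans (by linarith))
  have hself : ∀ s ∈ Set.Ioo 0 (tipHeight Λ), SliceLE (1 / (4 * τ)) r₀ γs γs s := fun s hs =>
    sliceLE_self (by linarith) hβ (by linarith) (fun t => (hc s hs t).1) (hW s hs)
  have hsm : ∀ {x y : ℝ}, 0 ≤ x → y ≤ tipHeight Λ → SmoothStrip (Set.Ioo x y) γs :=
    fun hx hy => (hS.smooth.mono (Set.prod_mono hbL subset_rfl)).mono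
      (Set.prod_mono (Set.Ioo_subset_Ioo hx hy) subset_rfl)
  have hsub : ∀ {x y : ℝ}, 0 ≤ x → y ≤ tipHeight Λ → Set.Ioo x y ⊆ Set.Ioo 0 (tipHeight Λ) :=
    fun hx hy => Set.Ioo_subset_Ioo hx hy
  have hbd : ∀ {x y : ℝ}, 0 ≤ x → ContDiffOn ℝ ∞ (bend Λ) (Set.Ioo x y) := fun hx =>
    (contDiffOn_bend Λ).mono fun s hs => hx.trans_lt hs.1
  have hpos : ∀ {x y : ℝ}, 0 ≤ x → Set.Ioo x y ⊆ Set.Ioi 0 := fun hx s hs => hx.trans_lt hs.1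
  -- below `λ = Λ^{1/4}` the original cross sections are bent
  have P1 : IntegralLE (density (sweep (modifiedSlice χ Φ Λ γ γs γt)) r₀ τ p)
      (density (sweep γs) r₀ τ p) 0 (quarterRoot Λ) := by
    have hy : quarterRoot Λ ≤ tipHeight Λ := by linarith
    have hss := hsm le_rfl hy
    refine integralLE_of_sliceLE hτ0 p
      (fun s hs => modifiedSlice_of_le_quarterRoot hs.1 hs.2.le)
      (hss.smul (hbd le_rfl)) hss (fun s hs => ?_) (fun s hs => hself s (hsub le_rfl hy hs))
    have hcs := hc s (hsub le_rfl hy hs)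
    refine hbend _ γs γs s _ r₀ 0 Λ isOpen_Ioo (hpos le_rfl) hss hss hs (by linarith [hs.2])
      hΛ1 hΛ2 (fun t => (hcs t).1.mono (by linarith)) (fun t => (hcs t).1.mono (by linarith))
      (fun t => (hcs t).2.1.trans (by linarith)) (fun t => ⟨?_, ?_, ?_, ?_, ?_⟩)
      (fun t => by rw [sub_zero]) hζ.le (by have := gap_pos Λ s; positivity) hβ hβ1 hr hr1 <;>
    · rw [sub_self, norm_zero]
  -- between `λ` and `Λ / 4` they are interpolated with the model cross section
  have P2 : IntegralLE (density (sweep (modifiedSlice χ Φ Λ γ γs γt)) r₀ τ p)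
      (density (sweep γs) r₀ τ p) (quarterRoot Λ) (Λ / 4) := by
    have hy : Λ / 4 ≤ tipHeight Λ := by linarith
    have hss := hsm hl0.le hy
    have hχd : ContDiff ℝ ∞ (deriv χ) := ((contDiff_infty_iff_deriv (𝕜 := ℝ)).1 hχ.smooth).2
    have hlin : ∀ s, HasDerivAt (fun s => s / quarterRoot Λ) (quarterRoot Λ)⁻¹ s := fun s => by
      simpa using (hasDerivAt_id s).div_const (quarterRoot Λ)
    have hμ : ∀ s, HasDerivAt (fun s => χ (s / quarterRoot Λ))
        (deriv χ (s / quarterRoot Λ) * (quarterRoot Λ)⁻¹) s := fun s =>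
      (hχ.smooth.differentiable (by simp) _).hasDerivAt.comp s (hlin s)
    have hμ₁ : ∀ s, HasDerivAt (fun s => deriv χ (s / quarterRoot Λ) * (quarterRoot Λ)⁻¹)
        (deriv (deriv χ) (s / quarterRoot Λ) * (quarterRoot Λ)⁻¹ * (quarterRoot Λ)⁻¹) s :=
      fun s => (((hχd.differentiable (by simp) _).hasDerivAt.comp s (hlin s)).mul_const _)
    have hi : |(quarterRoot Λ)⁻¹| ≤ 1 := by
      rw [abs_of_pos (by positivity)]; exact inv_le_one_of_one_le₀ (by linarith)
    have hσsm : SmoothStrip (Set.Ioo (quarterRoot Λ) (Λ / 4))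
        (fun s t => γ t + χ (s / quarterRoot Λ) • (γs s t - γ t)) := by
      have hγ : ContDiff ℝ ∞ (fun z : ℝ × ℝ => γ z.2) := hN.curve.smooth.comp contDiff_snd
      have hχ' : ContDiff ℝ ∞ (fun z : ℝ × ℝ => χ (z.1 / quarterRoot Λ)) :=
        hχ.smooth.comp (contDiff_fst.div_const _)
      exact hγ.contDiffOn.add (hχ'.contDiffOn.smul (ContDiffOn.sub hss hγ.contDiffOn))
    refine integralLE_of_sliceLE hτ0 p
      (fun s hs => modifiedSlice_of_le_quarter hχ hR hl0 hΛ0 hs.1 hs.2.le)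
      (hσsm.smul (hbd hl0.le)) hss (fun s hs => ?_) (fun s hs => hself s (hsub hl0.le hy hs))
    have hcs := hc s (hsub hl0.le hy hs)
    have hσ := fun t => hS.perturbation hN hR hθ hθ1 hδ hδθ hδu hM (hd ▸ hdθ) isOpen_Ioo
      ((hsub hl0.le hy).trans hbL) (fun s _ => hμ s) (fun s _ => hμ₁ s) hs (hMχ _).1
      (by rw [abs_mul]; nlinarith [(hMχ (s / quarterRoot Λ)).2.1, abs_nonneg (quarterRoot Λ)⁻¹,
            abs_nonneg (deriv χ (s / quarterRoot Λ))])
      (by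
        rw [abs_mul, abs_mul]
        have h1 : |deriv (deriv χ) (s / quarterRoot Λ)| * |(quarterRoot Λ)⁻¹| ≤ M * 1 :=
          mul_le_mul (hMχ _).2.2 hi (abs_nonneg _) (by linarith)
        have h2 := mul_le_mul h1 hi (abs_nonneg _) (by linarith)
        linarith) t
    rw [← hd] at hσ
    have hgs : gap Λ (quarterRoot Λ) ≤ gap Λ s := gap_mono hΛ0 hl0 hs.1.le
    refine hbend _ γs _ s _ r₀ (d + d) Λ isOpen_Ioo (hpos hl0.le) hσsm hss hs
      (by linarith [hs.2]) hΛ1 hΛ2 (fun t => (hσ t).1.mono (by linarith))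
      (fun t => (hcs t).1.mono (by linarith)) (fun t => (hcs t).2.1.trans (by linarith))
      (fun t => (hσ t).2.2.1.trans_symm (hcs t).2.2.1) (fun t => ?_) (by linarith) ?_ hβ hβ1 hr hr1
    · have h1 := (abs_le.1 (hσ t).2.2.2).1
      have h2 := (abs_le.1 (hcs t).2.2.2).2
      linarith
    · have : θ * gap Λ (quarterRoot Λ) ≤ 1 * gap Λ s := by gcongr; linarith
      linarith
  -- between `Λ / 4` and `Λ` the cross section follows the homotopy to the circle
  have P3 : IntegralLE (density (sweep (modifiedSlice χ Φ Λ γ γs γt)) r₀ τ p)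
      (density (sweep γs) r₀ τ p) (Λ / 4) Λ := by
    have hy : Λ ≤ tipHeight Λ := by linarith
    have hx : 0 ≤ Λ / 4 := by linarith
    have hss := hsm hx hy
    have hσsm : SmoothStrip (Set.Ioo (Λ / 4) Λ) (fun s t => γt (s / Λ) t) :=
      (hR.smooth.comp ((contDiff_fst.div_const Λ).prodMk contDiff_snd)).contDiffOn
    refine integralLE_of_sliceLE hτ0 p
      (fun s hs => modifiedSlice_of_le hl0 (by linarith [hs.1]) hs.2.le)
      (hσsm.smul (hbd hx)) hss (fun s hs => ?_) (fun s hs => hself s (hsub hx hy hs))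
    have hcs := hc s (hsub hx hy hs)
    have hs0 : 0 ≤ s := by linarith [hs.1]
    have hoθ : om δ ≤ θ := hδu.trans (by nlinarith)
    have hσ := fun t => (hR.nearRound (by linarith) hs0 hs.2.le t).mono hoθ
    have hgs : Real.exp (-16) ≤ gap Λ s := gap_quarter hΛ0 ▸ gap_mono hΛ0 (by linarith) hs.1.le
    refine hbend _ γs _ s _ r₀ (36 * θ) Λ isOpen_Ioo (hpos hx) hσsm hss hs hs.2.le hΛ1 hΛ2
      (fun t => (hσ t).mono (by linarith)) (fun t => (hcs t).1.mono (by linarith))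
      (fun t => (hcs t).2.1.trans (by linarith)) (fun t => ?_) (fun t => ?_)
      (by linarith) (by linarith) hβ hβ1 hr hr1
    · exact ((hσ t).jetClose (hcs t).1).mono (by linarith)
    · have h1 := (abs_le.1 (hcs t).2.1).2
      have h2 := hR.bendDet_ge (by linarith) hs0 hs.2.le hδ (by linarith) (by linarith) t
      linarith
  -- above `Λ` the cross sections are circles
  have P4 : IntegralLE (density (sweep (modifiedSlice χ Φ Λ γ γs γt)) r₀ τ p)
      (density (sweep γs) r₀ τ p) Λ (Λ + quarterRoot Λ) := by
    have hy : Λ + quarterRoot Λ ≤ tipHeight Λ := by linarith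
    have hss := hsm hΛ0.le hy
    refine integralLE_of_sliceLE hτ0 p
      (fun s hs => modifiedSlice_junction hl0 (by linarith) hs.1 hs.2.le)
      ((smoothStrip_circle _).smul ((contDiffOn_junctionRadius hΦ ha0).mono (hsub hΛ0.le hy)))
      hss (fun s hs => ?_) (fun s hs => hself s (hsub hΛ0.le hy hs))
    obtain ⟨j1, j2, j3, j4⟩ := junction_estimate hΦ hl hΛ0 hs.1 hs.2
    exact sliceLE_cap isOpen_Ioo hss hs
      (fun s hs => hasDerivAt_junctionRadius hΦ hl0 ha0 (by linarith [hs.1]) (by linarith [hs.2]))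
      (fun s hs => hasDerivAt_junctionRadius₁ hΦ ha0 (by linarith [hs.1]) (by linarith [hs.2]))
      j1 (by linarith) j3 j4 hβ hβ1 (by linarith) (fun t => (hc s (hsub hΛ0.le hy hs) t).1)
      (by linarith) (hW s (hsub hΛ0.le hy hs))
  have P5 : IntegralLE (density (sweep (modifiedSlice χ Φ Λ γ γs γt)) r₀ τ p)
      (density (sweep γs) r₀ τ p) (Λ + quarterRoot Λ) (tipHeight Λ) := by
    have hx : 0 ≤ Λ + quarterRoot Λ := by linarith
    have hss := hsm hx le_rfl
    refine integralLE_of_sliceLE hτ0 p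
      (fun s hs => modifiedSlice_tip hl0 (by linarith) hs.1)
      ((smoothStrip_circle _).smul ((contDiffOn_tipProfile ha0).mono fun s hs => hs.2))
      hss (fun s hs => ?_) (fun s hs => hself s (hsub hx le_rfl hs))
    have hle := (tipProfile_le ha0 hs.2).trans ha'
    exact sliceLE_cap isOpen_Ioo hss hs
      (fun s hs => hasDerivAt_tipProfile ha0 hs.2) (fun s hs => hasDerivAt_tipProfile₁ ha0 hs.2)
      (tipProfile_pos ha0 hs.2) (by linarith) (tipProfile₂_nonpos ha0 hs.2)
      (tip_estimate ha ha' hs.2) hβ hβ1 (by linarith) (fun t => (hc s (hsub hx le_rfl hs) t).1)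
      (by linarith) (hW s (hsub hx le_rfl hs))
  -- the finitely many heights left out do not matter
  have P := (((P1.trans P2 hl0.le (by linarith)).trans P3 (by linarith) (by linarith)).trans P4
    hΛ0.le (by linarith)).trans P5 (by linarith) (by linarith)
  have hae : (Set.Ioc 0 (tipHeight Λ) ×ˢ Set.Icc (0 : ℝ) 1 : Set (ℝ × ℝ)) =ᵐ[MeasureTheory.volume]
      paramDomain Λ := by
    rw [MeasureTheory.Measure.volume_eq_prod]
    exact MeasureTheory.Measure.set_prod_ae_eq MeasureTheory.Ioc_ae_eq_Icc
      (Filter.EventuallyEq.refl _ _)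
  refine ⟨P.1.congr_set_ae hae.symm, P.2.1.congr_set_ae hae.symm, ?_⟩
  rw [← MeasureTheory.setIntegral_congr_set hae, ← MeasureTheory.setIntegral_congr_set hae]
  exact P.2.2
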